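/- Let $d\ge 1$, $\mathbb R_+=[0,\infty)$, and let $\mathcal K$ be the space of convex bodies (compact convex sets) $K\subset\mathbb R^d$ with $0\in\operatorname{int}K$, equipped with the Hausdorff metric and its Borel $\sigma$-field. Let $\mathbf N$ be the set of all $\psi\subset\mathbb R^d\times\mathbb R_+\times\mathcal K$ such that only finitely many $(x,t,K)\in\psi$ have $x\in B$, for each bounded $B\subset\mathbb R^d$, and different points of $\psi$ have different first components; $\mathbf N$ carries the $\sigma$-field generated by the counting maps $\psi\mapsto\operatorname{card}(\psi\cap C)$, $C$ measurable. *Growth-maximal hard-core models.* Let $\psi\in\mathbf N$ and $R:\psi\to\mathbb R_+$. For $u=(x,t,K)\in\psi$ put $u^*=x+R(u)K$. A point $v=(y,s,L)\in\psi\setminus\{u\}$ with $R(v)>0$ is an *earlier neighbour* of $u=(x,t,K)$ if either $R(u)=0$, $x\in v^*$ and $t\ge s+\inf\{r\ge0: x\in y+rL\}$; or $R(u)>0$, $t+R(u)\ge s+R(v)$ and $u^*\cap v^*\neq\emptyset$. The function $R$ is a *growth-maximal hard-core function* on $\psi$ if $\operatorname{int}u^*\cap\operatorname{int}v^*=\emptyset$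 for all $u\ne v$ in $\psi$ and every $u\in\psi$ has at least one earlier neighbour. *Clusters* are the connected components of the graph with vertex set $\{u\in\psi:R(u)>0\}$ in which $u\neq v$ are adjacent if $u^*\cap v^*\ne\emptyset$. Let $Z=\bigcup_{u\in\psi}u^*$. *Assumptions.* Let $\Psi$ be a random element of $\mathbf N$, defined on some probability space. For $k\ge1$ let $\nu^{(k)}(C)$ be the expected number of $k$-tuples of pairwise different points of $\Psi$ that lie in $C$. Suppose that, for some $a>0$ and some probability measure $\mathbb Q$ on $\mathbb R_+\times\mathcal K$, $$\nu^{(k)}\le a^k(\lambda^d\otimes\mathbb Q)^{k}\quad(k\ge 1),\qquad \int (r^{2d}+1)(\rho(K)^{2d}+1)\,\mathbb Q(d(r,K))<\infty,$$ where $\lambda^d$ is Lebesgue measure and $\rho(K)$ is the radius of the smallest ball circumscribing $K$. Suppose further that $\mathbb Q$ is concentrated on strictly convex bodies, that $\Psi$ is stationary (the distribution of $x+\Psi=\{(x+y,t,K):(y,t,K)\in\Psi\}$ does not depend on $x\in\mathbb R^d$), and that $\Psi\ne\emptyset$ almost surely. **Theorem 3.1.** Almost surely, there is exactly one growth-maximal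 hard-core function on $\Psi$, and the model that it defines has no infinite cluster. In particular, almost surely the union $Z$ of the grains does not percolate: it contains no unbounded closed connected set. -/

import Mathlib

open MeasureTheory
open scoped NNReal ENNReal

noncomputable section

/-- Euclidean space `ℝ^d`. -/
abbrev Space (d : ℕ) : Type := EuclideanSpace ℝ (Fin d)

/-- Shapes: convex bodies of `ℝ^d` with the origin in their interior, with the Hausdorff metric
(inherited from Mathlib's `ConvexBody`). -/
abbrev Shape (d : ℕ) : Type := {K : ConvexBody (Space d) // (0 : Space d) ∈ interior (K : Set (Space d))}

/-- The set of points of a shape. -/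
def Shape.toSet {d : ℕ} (K : Shape d) : Set (Space d) := (K.1 : Set (Space d))

/-- The Borel σ-field of the Hausdorff metric. -/
instance Shape.instMeasurableSpace (d : ℕ) : MeasurableSpace (Shape d) := borel (Shape d)

instance Shape.instBorelSpace (d : ℕ) : BorelSpace (Shape d) := ⟨rfl⟩

/-- Radius of the smallest ball circumscribing a shape. -/
def Shape.circumradius {d : ℕ} (K : Shape d) : ℝ :=
  sInf {r : ℝ | 0 ≤ r ∧ ∃ c : Space d, K.toSet ⊆ Metric.closedBall c r}

/-- Grains `(x, t, K)`: position, birth time, shape. -/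
abbrev Grain (d : ℕ) : Type := Space d × (ℝ≥0 × Shape d)

/-- Position of a grain. -/
def Grain.pos {d : ℕ} (u : Grain d) : Space d := u.1

/-- Birth time of a grain. -/
def Grain.birth {d : ℕ} (u : Grain d) : ℝ≥0 := u.2.1

/-- Shape of a grain. -/
def Grain.shape {d : ℕ} (u : Grain d) : Shape d := u.2.2

/-- The set `x + r K` occupied by the grain `(x, t, K)` after growth during a time `r`. -/
def Grain.grown {d : ℕ} (u : Grain d) (r : ℝ) : Set (Space d) :=
  (fun z => u.pos + r • z) '' u.shape.toSet

/-- The growth time `inf {r ≥ 0 : y ∈ x + r K}` that the grain `(x, t, K)` needs to reach `y`. -/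
def Grain.reachTime {d : ℕ} (u : Grain d) (y : Space d) : ℝ :=
  sInf {r : ℝ | 0 ≤ r ∧ y ∈ u.grown r}

/-- Locally finite sets of grains, different grains having different positions. -/
structure Config (d : ℕ) where
  carrier : Set (Grain d)
  locallyFinite : ∀ B : Set (Space d), Bornology.IsBounded B → {u ∈ carrier | u.pos ∈ B}.Finite
  pos_injOn : Set.InjOn Grain.pos carrier

/-- The smallest σ-field for which all the counting maps `ψ ↦ ψ(C)`, `C` measurable, are
measurable. -/
instance Config.instMeasurableSpace (d : ℕ) : MeasurableSpace (Config d) :=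
  ⨆ C : {C : Set (Grain d) // MeasurableSet C},
    MeasurableSpace.comap (fun ψ : Config d => (ψ.carrier ∩ C.1).encard) ⊤

/-- The grain `(y + x, t, K)`. -/
def Grain.translate {d : ℕ} (y : Space d) (u : Grain d) : Grain d := (y + u.1, u.2)

/-- The translate `y + ψ` of a configuration. -/
def Config.translate {d : ℕ} (y : Space d) (ψ : Config d) : Config d where
  carrier := Grain.translate y '' ψ.carrier
  locallyFinite := by
    intro B hB
    have hB' : Bornology.IsBounded ((fun x : Space d => y + x) ⁻¹' B) := by
      rw [isBounded_iff_forall_norm_le] at hB ⊢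
      obtain ⟨c, hc⟩ := hB
      refine ⟨c + ‖y‖, fun x hx => ?_⟩
      have h1 : ‖y + x‖ ≤ c := hc _ hx
      have h2 : ‖x‖ ≤ ‖y + x‖ + ‖y‖ := by
        simpa using norm_sub_le (y + x) y
      linarith
    refine ((ψ.locallyFinite _ hB').image (Grain.translate y)).subset ?_
    rintro _ ⟨⟨u, hu, rfl⟩, hv⟩
    exact ⟨u, ⟨hu, hv⟩, rfl⟩
  pos_injOn := by
    rintro _ ⟨u, hu, rfl⟩ _ ⟨v, hv, rfl⟩ h
    have h' : y + u.1 = y + v.1 := h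
    rw [ψ.pos_injOn hu hv (add_left_cancel h')]

/-- The `k`-th factorial moment measure of the point process `Ψ`, evaluated at `C`: the expected
number of `k`-tuples of pairwise different points of `Ψ` that lie in `C`. -/
def factorialMoment {Ω : Type*} [MeasurableSpace Ω] {d : ℕ} (P : Measure Ω) (Ψ : Ω → Config d)
    (k : ℕ) (C : Set (Fin k → Grain d)) : ℝ≥0∞ :=
  ∫⁻ ω, (({v : Fin k → Grain d |
    Function.Injective v ∧ (∀ i, v i ∈ (Ψ ω).carrier) ∧ v ∈ C}.encard : ℕ∞) : ℝ≥0∞) ∂P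

/-- Stationarity: the distribution of `x + Ψ` does not depend on `x`. -/
def IsStationaryPointProcess {Ω : Type*} [MeasurableSpace Ω] {d : ℕ} (P : Measure Ω) (Ψ : Ω → Config d) :
    Prop :=
  ∀ (x : Space d) (A : Set (Config d)), MeasurableSet A →
    P {ω | (Ψ ω).translate x ∈ A} = P {ω | Ψ ω ∈ A}

namespace Config

variable {d : ℕ} {ψ : Config d}

/-- The full-grown grain `x + R(u) K` of the point `u = (x, t, K)`, for growth times `R`. -/
def fullGrain (R : ψ.carrier → ℝ≥0) (u : ψ.carrier) : Set (Space d) :=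
  u.1.grown (R u)

/-- The interiors of different full-grown grains do not intersect. -/
def IsHardCore (R : ψ.carrier → ℝ≥0) : Prop :=
  ∀ u v : ψ.carrier, u ≠ v → interior (fullGrain R u) ∩ interior (fullGrain R v) = ∅

/-- `v` is an earlier (stopping) neighbour of `u`. If `u` did not grow at all, then the grain of
`v` covered the position of `u` not later than the birth of `u`; if `u` did grow, then the
full-grown grains touch and `v` reached its final size not later than `u`. -/
def IsEarlierNeighbour (R : ψ.carrier → ℝ≥0) (u v : ψ.carrier) : Prop :=
  v ≠ u ∧ 0 < R v ∧
    ((R u = 0 ∧ u.1.pos ∈ fullGrain R v ∧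
        (v.1.birth : ℝ) + v.1.reachTime u.1.pos ≤ (u.1.birth : ℝ)) ∨
      (0 < R u ∧ v.1.birth + R v ≤ u.1.birth + R u ∧
        (fullGrain R u ∩ fullGrain R v).Nonempty))

/-- The growth times `R` define a growth-maximal hard-core model based on `ψ`. -/
def IsGrowthMaximal (R : ψ.carrier → ℝ≥0) : Prop :=
  IsHardCore R ∧ ∀ u : ψ.carrier, ∃ v : ψ.carrier, IsEarlierNeighbour R u v

/-- The graph whose vertices are the grains with positive growth time, two different ones being
adjacent if their full-grown grains intersect. -/
def contactGraph (R : ψ.carrier → ℝ≥0) : SimpleGraph {u : ψ.carrier // 0 < R u} where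
  Adj u v := u ≠ v ∧ (fullGrain R u.1 ∩ fullGrain R v.1).Nonempty
  symm := ⟨fun u v h => ⟨h.1.symm, by rw [Set.inter_comm]; exact h.2⟩⟩
  loopless := ⟨fun _ h => h.1 rfl⟩

/-- A cluster is a connected component of the contact graph. -/
abbrev Cluster (R : ψ.carrier → ℝ≥0) : Type := (contactGraph R).ConnectedComponent

/-- The union of all full-grown grains. -/
def grainUnion (R : ψ.carrier → ℝ≥0) : Set (Space d) := ⋃ u : ψ.carrier, fullGrain R u

/-- The union of the grains percolates: it contains an unbounded closed connected set.
(If the union is closed, as for a locally finite family of grains, this means that it has an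
unbounded connected component.) -/
def Percolates (R : ψ.carrier → ℝ≥0) : Prop :=
  ∃ F : Set (Space d), F ⊆ grainUnion R ∧ IsClosed F ∧ IsConnected F ∧ ¬ Bornology.IsBounded F

end Config

end

open MeasureTheory
open scoped NNReal ENNReal

/-! ### Geometry of growing grains -/

noncomputable section

namespace Shape

variable {d : ℕ} (K : Shape d)

/-! Growth-maximal functions are fixed points of the operator `stopTime ψ`, which takes growth times
of all grains to the growth times after which each grain is stopped by the others. For a
growth-maximal function, earlier neighbours give one inequality and the hard-core property the other
(`fixed_of_isGrowthMaximal`); conversely a finite fixed point is growth-maximal once each grain has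
finitely many contacts in bounded time (`isHardCore_of_fixed`, `exists_earlierNeighbour_of_fixed`).
The operator is antitone, so its iterates from `0` enclose every fixed point between the increasing
`lower` and the decreasing `upper`. Existence and uniqueness reduce to the equality of the two
limits.

If the bounds never meet at a grain with finite `growth`, then at most two contacts lead to another
such grain that is stopped strictly earlier (`exists_earlier_not_settled`), and such grains do not
touch before they stop. An infinite descent would therefore end up in the contacts of an arbitrarily
short time window around the limit of the stopping times (`Regular.finite_range`). The contacts in a
short window have only finite components: the volume of relative positions with first contact in the
window tends to `0`, so by the moment bound the expected number of chains of `2 * j` contacts decays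
geometrically in `j` (`chainMass_two_mul_le`, `ae_sparse`). Growth times are finite because, by
stationarity, grains born before some fixed time occur arbitrarily far away, and a grain that grew
forever would have to reach each of them no later than its birth.

For the clusters, the same window argument shows that a chain of earlier neighbours visits finitely
many grains, so it repeats, which forces a pair of grains that stop each other simultaneously: the
roots. Almost surely there are no other coincidences. Growth times in a finite family closed under
earlier neighbours depend on that family alone (`growth_eq_of_closed`), so the position of one
further grain can be integrated separately, and the bad positions are null; strict convexity enters
in `volume_hitReal_eq_hitReal`. Hence any two earlier neighbours of a grain touch each other,
touching grains have the same roots, and the roots are constant on clusters. Mass transport ends the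
argument: each grain sends a unit mass to each of its at most two roots, and by stationarity a cell
receives as much in the mean as it sends, a finite amount. So each root belongs to finitely many
grains, and clusters are finite.

The union of the grains is then a countable disjoint union of compact sets, and Sierpiński's theorem
on continua rules out an unbounded closed connected subset. -/

lemma convex_toSet : Convex ℝ K.toSet := K.1.convex

lemma isCompact_toSet : IsCompact K.toSet := K.1.isCompact

lemma zero_mem_interior : (0 : Space d) ∈ interior K.toSet := K.2

lemma zero_mem : (0 : Space d) ∈ K.toSet := interior_subset K.2

lemma smul_mem_interior {c : ℝ} (h0 : 0 ≤ c) (h1 : c < 1) {z : Space d} (hz : z ∈ K.toSet) :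
    c • z ∈ interior K.toSet := by
  have := K.convex_toSet.combo_interior_self_mem_interior K.zero_mem_interior hz
    (a := 1 - c) (b := c) (by linarith) h0 (by ring)
  simpa using this

end Shape

namespace Grain

variable {d : ℕ}

lemma mem_grown {u : Grain d} {r : ℝ} {z : Space d} :
    z ∈ u.grown r ↔ ∃ k ∈ u.shape.toSet, u.pos + r • k = z := Iff.rfl

lemma pos_mem_grown (u : Grain d) (r : ℝ) : u.pos ∈ u.grown r :=
  ⟨0, u.shape.zero_mem, by simp⟩

lemma grown_zero (u : Grain d) : u.grown 0 = {u.pos} := by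
  ext z
  simp only [mem_grown, zero_smul, add_zero, Set.mem_singleton_iff]
  exact ⟨fun ⟨_, _, h⟩ => h.symm, fun h => ⟨0, u.shape.zero_mem, h.symm⟩⟩

lemma convex_grown (u : Grain d) (r : ℝ) : Convex ℝ (u.grown r) := by
  have h := (u.shape.convex_toSet.is_linear_image (f := fun z : Space d => r • z)
    (IsLinearMap.isLinearMap_smul r)).translate u.pos
  rw [Set.image_image] at h
  exact h

lemma isCompact_grown (u : Grain d) (r : ℝ) : IsCompact (u.grown r) :=
  u.shape.isCompact_toSet.image (by fun_prop)

/-- As `0` is interior to the convex shape, contraction by `r / r' < 1` moves the shape into its own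
interior. -/
lemma grown_subset_interior (u : Grain d) {r r' : ℝ} (h0 : 0 ≤ r) (h : r < r') :
    u.grown r ⊆ interior (u.grown r') := by
  have hr' : r' ≠ 0 := by linarith
  have ho : IsOpen ((fun z => u.pos + r' • z) '' interior u.shape.toSet) := by
    have : (fun z => u.pos + r' • z) = (Homeomorph.addLeft u.pos) ∘ (Homeomorph.smulOfNeZero r' hr')
      := rfl
    rw [this]
    exact ((Homeomorph.addLeft u.pos).isOpenMap.comp
      (Homeomorph.smulOfNeZero r' hr').isOpenMap) _ isOpen_interior
  have hs : (fun z => u.pos + r' • z) '' interior u.shape.toSet ⊆ interior (u.grown r') :=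
    interior_maximal (Set.image_mono interior_subset) ho
  rintro _ ⟨k, hk, rfl⟩
  apply hs
  refine ⟨(r / r') • k, u.shape.smul_mem_interior (div_nonneg h0 (by linarith))
    ((div_lt_one (by linarith)).2 h) hk, ?_⟩
  simp only [smul_smul]
  rw [mul_div_cancel₀ _ hr']

lemma grown_mono (u : Grain d) {r r' : ℝ} (h0 : 0 ≤ r) (h : r ≤ r') :
    u.grown r ⊆ u.grown r' := by
  rcases h.eq_or_lt with rfl | h
  · exact le_rfl
  · exact (u.grown_subset_interior h0 h).trans interior_subset

/-- An interior point can be pushed away from the centre by a factor `c > 1` without leaving the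
set, so it is already covered at growth time `r / c`. -/
lemma exists_lt_of_mem_interior (u : Grain d) {r : ℝ} (hr : 0 < r) {z : Space d}
    (hz : z ∈ interior (u.grown r)) : ∃ r', 0 ≤ r' ∧ r' < r ∧ z ∈ u.grown r' := by
  have hc : Filter.Tendsto (fun c : ℝ => u.pos + c • (z - u.pos)) (nhdsWithin 1 (Set.Ioi 1))
      (nhds z) := by
    have : Continuous (fun c : ℝ => u.pos + c • (z - u.pos)) := by fun_prop
    have h := (this.tendsto 1).mono_left (nhdsWithin_le_nhds (s := Set.Ioi 1))
    simpa using h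
  have h1 := hc.eventually (isOpen_interior.mem_nhds hz)
  obtain ⟨c, hc, hc1⟩ := (h1.and self_mem_nhdsWithin).exists
  obtain ⟨k, hk, hkz⟩ := interior_subset hc
  have hc1 : 1 < c := hc1
  refine ⟨r / c, by positivity, div_lt_self hr hc1, k, hk, ?_⟩
  have h2 : r • k = c • (z - u.pos) := add_left_cancel hkz
  have h3 : (r / c) • k = z - u.pos := by
    rw [div_eq_inv_mul, mul_smul, h2, smul_smul, inv_mul_cancel₀ (by linarith), one_smul]
  simp only [h3]; abel

lemma interior_grown_nonempty (u : Grain d) {r : ℝ} (hr : 0 < r) :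
    (interior (u.grown r)).Nonempty :=
  ⟨u.pos, u.grown_subset_interior le_rfl hr (by rw [grown_zero]; rfl)⟩

lemma grown_subset_closure_interior (u : Grain d) {r : ℝ} (hr : 0 < r) :
    u.grown r ⊆ closure (interior (u.grown r)) := by
  rw [(u.convex_grown r).closure_interior_eq_closure_of_nonempty_interior
    (u.interior_grown_nonempty hr)]
  exact subset_closure

/-- After growing for the times `r` and `r'`, the grains `u` and `v` have a common point. -/
def Touch (u : Grain d) (r : ℝ≥0) (v : Grain d) (r' : ℝ≥0) : Prop :=
  (u.grown r ∩ v.grown r').Nonempty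

lemma Touch.symm {u v : Grain d} {r r' : ℝ≥0} (h : Touch u r v r') : Touch v r' u r := by
  unfold Touch; rwa [Set.inter_comm]

lemma Touch.mono {u v : Grain d} {r r' s s' : ℝ≥0} (h : Touch u r v r') (hs : r ≤ s)
    (hs' : r' ≤ s') : Touch u s v s' :=
  Set.Nonempty.mono (Set.inter_subset_inter (u.grown_mono r.2 hs) (v.grown_mono r'.2 hs')) h

lemma touch_zero_left {u v : Grain d} {r : ℝ≥0} : Touch u 0 v r ↔ u.pos ∈ v.grown r := by
  simp [Touch, grown_zero]

lemma touch_zero_zero {u v : Grain d} : Touch u 0 v 0 ↔ u.pos = v.pos := by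
  simp [touch_zero_left, grown_zero]

/-- The contact point is interior to the larger `u.grown s` and a limit of interior points of
`v.grown r'`. Contact followed by further growth thus violates the hard-core condition. -/
lemma Touch.interior_inter {u v : Grain d} {r r' s : ℝ≥0} (h : Touch u r v r') (hs : r < s)
    (hr' : 0 < r') : (interior (u.grown s) ∩ interior (v.grown r')).Nonempty := by
  obtain ⟨z, hz, hz'⟩ := h
  have h1 := u.grown_subset_interior r.2 (NNReal.coe_lt_coe.2 hs) hz
  have h2 := v.grown_subset_closure_interior (NNReal.coe_pos.2 hr') hz'
  exact mem_closure_iff.1 h2 _ isOpen_interior h1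

lemma exists_touch_of_interior_inter {u v : Grain d} {r r' : ℝ≥0} (hr : 0 < r) (hr' : 0 < r')
    (h : (interior (u.grown r) ∩ interior (v.grown r')).Nonempty) :
    ∃ s s' : ℝ≥0, s < r ∧ s' < r' ∧ Touch u s v s' := by
  obtain ⟨z, hz, hz'⟩ := h
  obtain ⟨s, s0, hs, h1⟩ := u.exists_lt_of_mem_interior (NNReal.coe_pos.2 hr) hz
  obtain ⟨s', s0', hs', h2⟩ := v.exists_lt_of_mem_interior (NNReal.coe_pos.2 hr') hz'
  exact ⟨⟨s, s0⟩, ⟨s', s0'⟩, hs, hs', z, h1, h2⟩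

lemma exists_touch_radius (u v : Grain d) : ∃ r : ℝ≥0, Touch u r v 0 := by
  obtain ⟨δ, hδ, hb⟩ := Metric.mem_nhds_iff.1 (mem_interior_iff_mem_nhds.1 u.shape.zero_mem_interior)
  have hn : 0 ≤ ‖v.pos - u.pos‖ := norm_nonneg _
  refine ⟨⟨2 * (‖v.pos - u.pos‖ + 1) / δ, by positivity⟩, v.pos, ?_, v.pos_mem_grown _⟩
  set R := 2 * (‖v.pos - u.pos‖ + 1) / δ with hR
  have hR0 : 0 < R := by positivity
  refine ⟨R⁻¹ • (v.pos - u.pos), hb ?_, ?_⟩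
  · rw [mem_ball_zero_iff, norm_smul, norm_inv, Real.norm_of_nonneg hR0.le, inv_mul_lt_iff₀ hR0, hR,
      div_mul_cancel₀ _ hδ.ne']
    linarith
  · show u.pos + R • R⁻¹ • _ = _
    rw [smul_inv_smul₀ hR0.ne']; abel

/-- Growth time at time `θ` of a freely growing grain. -/
def rad (θ : ℝ) (u : Grain d) : ℝ≥0 := Real.toNNReal (θ - u.birth)

lemma rad_mono {θ θ' : ℝ} (h : θ ≤ θ') (u : Grain d) : rad θ u ≤ rad θ' u :=
  Real.toNNReal_le_toNNReal (by linarith)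

lemma le_rad {θ : ℝ} {u : Grain d} {r : ℝ≥0} (h : (u.birth : ℝ) + r ≤ θ) : r ≤ rad θ u := by
  have : r = Real.toNNReal r := by simp
  rw [this, rad]; exact Real.toNNReal_le_toNNReal (by linarith)

lemma rad_birth_add (u : Grain d) (r : ℝ≥0) : rad (u.birth + r) u = r := by
  simp [rad]

lemma continuous_rad (u : Grain d) : Continuous fun θ => rad θ u := by
  unfold rad; fun_prop

/-- Two freely growing grains have a common point at time `θ`. -/
def TouchAt (θ : ℝ) (u v : Grain d) : Prop := Touch u (rad θ u) v (rad θ v)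

lemma TouchAt.symm {θ : ℝ} {u v : Grain d} (h : TouchAt θ u v) : TouchAt θ v u := Touch.symm h

/-- Since `rad` truncates at `0`, an unborn grain counts as the point at its position. Contact is
then monotone in time, so a pair has a single instant of first contact. -/
lemma TouchAt.mono {θ θ' : ℝ} {u v : Grain d} (h : TouchAt θ u v) (hθ : θ ≤ θ') : TouchAt θ' u v :=
  Touch.mono h (rad_mono hθ u) (rad_mono hθ v)

lemma Touch.touchAt {θ : ℝ} {u v : Grain d} {r r' : ℝ≥0} (h : Touch u r v r')
    (hr : (u.birth : ℝ) + r ≤ θ) (hr' : (v.birth : ℝ) + r' ≤ θ) : TouchAt θ u v :=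
  Touch.mono h (le_rad hr) (le_rad hr')

/-- Points of converging shapes are approximated by points of the limit shape, and a subsequence of
these converges. Joint closedness serves twice: infima of contact times are attained, and contact is
a measurable relation. -/
lemma isClosed_touch :
    IsClosed {p : (Grain d × ℝ≥0) × (Grain d × ℝ≥0) | Touch p.1.1 p.1.2 p.2.1 p.2.2} := by
  have key : ∀ (K : ℕ → Shape d) (K' : Shape d), Filter.Tendsto K Filter.atTop (nhds K') →
      ∀ k : ℕ → Space d, (∀ n, k n ∈ (K n).toSet) → ∃ k' : ℕ → Space d, (∀ n, k' n ∈ K'.toSet) ∧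
        Filter.Tendsto (fun n => dist (k n) (k' n)) Filter.atTop (nhds 0) := by
    intro K K' hK k hk
    have h1 : ∀ n, ∃ k' ∈ K'.toSet, dist (k n) k' ≤ dist (K n) K' := by
      intro n
      obtain ⟨k', hk', h⟩ := K'.isCompact_toSet.exists_infDist_eq_dist ⟨0, K'.zero_mem⟩ (k n)
      refine ⟨k', hk', h ▸ ?_⟩
      exact Metric.infDist_le_hausdorffDist_of_mem (hk n)
        (Metric.hausdorffEDist_ne_top_of_nonempty_of_bounded ⟨0, (K n).zero_mem⟩ ⟨0, K'.zero_mem⟩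
          (K n).isCompact_toSet.isBounded K'.isCompact_toSet.isBounded)
    choose k' hk' h using h1
    refine ⟨k', hk', squeeze_zero (fun _ => dist_nonneg) h ?_⟩
    exact tendsto_iff_dist_tendsto_zero.1 hK
  apply IsSeqClosed.isClosed
  intro p q hp hpq
  have hu1 : Filter.Tendsto (fun n => (p n).1.1.1) Filter.atTop (nhds q.1.1.1) :=
    ((by fun_prop : Continuous fun p : (Grain d × ℝ≥0) × (Grain d × ℝ≥0) => p.1.1.1).tendsto q).comp hpq
  have hv1 : Filter.Tendsto (fun n => (p n).2.1.1) Filter.atTop (nhds q.2.1.1) :=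
    ((by fun_prop : Continuous fun p : (Grain d × ℝ≥0) × (Grain d × ℝ≥0) => p.2.1.1).tendsto q).comp hpq
  have hu3 : Filter.Tendsto (fun n => (p n).1.1.2.2) Filter.atTop (nhds q.1.1.2.2) :=
    ((by fun_prop : Continuous fun p : (Grain d × ℝ≥0) × (Grain d × ℝ≥0) => p.1.1.2.2).tendsto q).comp hpq
  have hv3 : Filter.Tendsto (fun n => (p n).2.1.2.2) Filter.atTop (nhds q.2.1.2.2) :=
    ((by fun_prop : Continuous fun p : (Grain d × ℝ≥0) × (Grain d × ℝ≥0) => p.2.1.2.2).tendsto q).comp hpq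
  have hr : Filter.Tendsto (fun n => ((p n).1.2 : ℝ)) Filter.atTop (nhds q.1.2) :=
    ((by fun_prop : Continuous fun p : (Grain d × ℝ≥0) × (Grain d × ℝ≥0) => (p.1.2 : ℝ)).tendsto q).comp hpq
  have hr' : Filter.Tendsto (fun n => ((p n).2.2 : ℝ)) Filter.atTop (nhds q.2.2) :=
    ((by fun_prop : Continuous fun p : (Grain d × ℝ≥0) × (Grain d × ℝ≥0) => (p.2.2 : ℝ)).tendsto q).comp hpq
  have h1 : ∀ n, ∃ k l, k ∈ (p n).1.1.2.2.toSet ∧ l ∈ (p n).2.1.2.2.toSet ∧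
      (p n).1.1.1 + ((p n).1.2 : ℝ) • k = (p n).2.1.1 + ((p n).2.2 : ℝ) • l := by
    intro n
    obtain ⟨z, ⟨k, hk, h1⟩, ⟨l, hl, h2⟩⟩ := hp n
    exact ⟨k, l, hk, hl, h1.trans h2.symm⟩
  choose k l hk hl hkl using h1
  obtain ⟨k', hk', hkk⟩ := key _ _ hu3 k hk
  obtain ⟨l', hl', hll⟩ := key _ _ hv3 l hl
  obtain ⟨⟨a, b⟩, hab, φ, hφ, hlim⟩ := (q.1.1.2.2.isCompact_toSet.prod
    q.2.1.2.2.isCompact_toSet).tendsto_subseq (x := fun n => (k' n, l' n)) fun n => ⟨hk' n, hl' n⟩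
  have hk'' : Filter.Tendsto (fun n => k (φ n)) Filter.atTop (nhds a) :=
    (tendsto_iff_of_dist (f₁ := fun n => k (φ n)) (f₂ := fun n => k' (φ n))
      (hkk.comp hφ.tendsto_atTop)).2 ((continuous_fst.tendsto _).comp hlim)
  have hl'' : Filter.Tendsto (fun n => l (φ n)) Filter.atTop (nhds b) :=
    (tendsto_iff_of_dist (f₁ := fun n => l (φ n)) (f₂ := fun n => l' (φ n))
      (hll.comp hφ.tendsto_atTop)).2 ((continuous_snd.tendsto _).comp hlim)
  have e1 := (hu1.comp hφ.tendsto_atTop).add ((hr.comp hφ.tendsto_atTop).smul hk'')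
  have e2 := (hv1.comp hφ.tendsto_atTop).add ((hr'.comp hφ.tendsto_atTop).smul hl'')
  have e3 := tendsto_nhds_unique e1 (e2.congr fun n => (hkl (φ n)).symm)
  exact ⟨_, ⟨a, hab.1, rfl⟩, ⟨b, hab.2, e3.symm⟩⟩

lemma isClosed_touch_radii (u v : Grain d) :
    IsClosed {p : ℝ≥0 × ℝ≥0 | Touch u p.1 v p.2} :=
  isClosed_touch.preimage (f := fun p : ℝ≥0 × ℝ≥0 => ((u, p.1), (v, p.2))) (by fun_prop)

end Grain

end

/-! ### Stopping times and their iterates -/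

noncomputable section

namespace Config

open Grain

variable {d : ℕ} {ψ : Config d}

/-- If the growth times of the other grains are `f`, then `v` stops `u` not later than after the
growth time `r`. -/
def BlockedBy (f : Grain d → ℝ≥0∞) (u : Grain d) (r : ℝ≥0) (v : Grain d) : Prop :=
  v.pos ≠ u.pos ∧ ∃ s : ℝ≥0, 0 < s ∧ (s : ℝ≥0∞) ≤ f v ∧ v.birth + s ≤ u.birth + r ∧ Touch u r v s

/-- Some point of `ψ` stops `u` not later than after the growth time `r`. -/
def Blocked (ψ : Config d) (f : Grain d → ℝ≥0∞) (u : Grain d) (r : ℝ≥0) : Prop :=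
  ∃ v ∈ ψ.carrier, BlockedBy f u r v

/-- The growth time after which `u` is stopped, if the growth times of the others are `f`. -/
def stopTime (ψ : Config d) (f : Grain d → ℝ≥0∞) (u : Grain d) : ℝ≥0∞ :=
  ⨅ (r : ℝ≥0) (_ : Blocked ψ f u r), (r : ℝ≥0∞)

lemma BlockedBy.mono {f g : Grain d → ℝ≥0∞} {u v : Grain d} {r r' : ℝ≥0}
    (h : BlockedBy f u r v) (hf : f v ≤ g v) (hr : r ≤ r') : BlockedBy g u r' v := by
  obtain ⟨h1, s, h2, h3, h4, h5⟩ := h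
  exact ⟨h1, s, h2, h3.trans hf, h4.trans (by gcongr), h5.mono hr le_rfl⟩

lemma Blocked.mono {f g : Grain d → ℝ≥0∞} {u : Grain d} {r r' : ℝ≥0}
    (h : Blocked ψ f u r) (hf : f ≤ g) (hr : r ≤ r') : Blocked ψ g u r' := by
  obtain ⟨v, hv, h⟩ := h
  exact ⟨v, hv, h.mono (hf v) hr⟩

lemma stopTime_le {f : Grain d → ℝ≥0∞} {u : Grain d} {r : ℝ≥0} (h : Blocked ψ f u r) :
    stopTime ψ f u ≤ r := iInf₂_le r h

lemma stopTime_lt_iff {f : Grain d → ℝ≥0∞} {u : Grain d} {c : ℝ≥0∞} :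
    stopTime ψ f u < c ↔ ∃ r : ℝ≥0, Blocked ψ f u r ∧ (r : ℝ≥0∞) < c := by
  simp only [stopTime, iInf_lt_iff, exists_prop]

lemma blocked_of_stopTime_lt {f : Grain d → ℝ≥0∞} {u : Grain d} {r : ℝ≥0}
    (h : stopTime ψ f u < r) : Blocked ψ f u r := by
  obtain ⟨r', h1, h2⟩ := stopTime_lt_iff.1 h
  exact h1.mono le_rfl (ENNReal.coe_le_coe.1 h2.le)

/-- If the others grow longer, then more blockers are available. Antitonicity makes the even
iterates from `0` increase, the odd ones decrease, and the former stay below the latter. -/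
lemma stopTime_anti : Antitone (stopTime ψ) := by
  intro f g h u
  exact le_iInf₂ fun r hr => stopTime_le (hr.mono h le_rfl)

/-- The iterates of `stopTime`, starting with `0`. -/
def iter (ψ : Config d) : ℕ → Grain d → ℝ≥0∞
  | 0 => 0
  | n + 1 => stopTime ψ (iter ψ n)

/-- The lower bounds for the growth times. -/
def lower (ψ : Config d) (n : ℕ) : Grain d → ℝ≥0∞ := iter ψ (2 * n)

/-- The upper bounds for the growth times. -/
def upper (ψ : Config d) (n : ℕ) : Grain d → ℝ≥0∞ := iter ψ (2 * n + 1)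

lemma lower_succ (n : ℕ) : lower ψ (n + 1) = stopTime ψ (upper ψ n) := rfl

lemma lower_le_succ (n : ℕ) : lower ψ n ≤ lower ψ (n + 1) := by
  induction n with
  | zero => exact fun u => zero_le
  | succ n ih => exact stopTime_anti (stopTime_anti ih)

lemma lower_mono : Monotone (lower ψ) := monotone_nat_of_le_succ lower_le_succ

lemma upper_anti : Antitone (upper ψ) := fun _ _ h => stopTime_anti (lower_mono h)

lemma lower_le_upper_self (n : ℕ) : lower ψ n ≤ upper ψ n := by
  induction n with
  | zero => exact fun u => zero_le
  | succ n ih => exact stopTime_anti ((stopTime_anti ih : lower ψ (n + 1) ≤ upper ψ n))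

lemma lower_le_upper (n m : ℕ) : lower ψ n ≤ upper ψ m :=
  (lower_mono (le_max_left n m)).trans
    ((lower_le_upper_self _).trans (upper_anti (le_max_right n m)))

/-- The supremum of the lower bounds for the growth times. -/
def growth (ψ : Config d) (u : Grain d) : ℝ≥0∞ := ⨆ n, lower ψ n u

lemma lower_le_growth (n : ℕ) (u : Grain d) : lower ψ n u ≤ growth ψ u :=
  le_iSup (fun n => lower ψ n u) n

lemma growth_le_upper (n : ℕ) (u : Grain d) : growth ψ u ≤ upper ψ n u :=
  iSup_le fun m => lower_le_upper m n u

/-- The growth time of `u` is determined after finitely many iterations. -/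
def Settled (ψ : Config d) (u : Grain d) : Prop := ∃ n, lower ψ n u = upper ψ n u

/-- The time at which `u` is stopped. -/
def stopAt (ψ : Config d) (u : Grain d) : ℝ≥0∞ := u.birth + growth ψ u

lemma Settled.eventually {u : Grain d} (h : Settled ψ u) :
    ∀ᶠ n in Filter.atTop, lower ψ n u = growth ψ u ∧ upper ψ n u = growth ψ u := by
  obtain ⟨n, hn⟩ := h
  filter_upwards [Filter.eventually_ge_atTop n] with m hm
  have h1 := lower_mono (ψ := ψ) hm u
  have h2 := upper_anti (ψ := ψ) hm u
  have h3 := lower_le_growth (ψ := ψ) m u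
  have h4 := growth_le_upper (ψ := ψ) m u
  refine ⟨le_antisymm h3 ?_, le_antisymm ?_ h4⟩
  · exact (growth_le_upper n u).trans (hn ▸ h1)
  · exact h2.trans (hn ▸ lower_le_growth n u)

/-- Only finitely many grains can stop `u` before its limit time. Once the settled ones among them
have reached their final values, a blocker at an earlier time would block at every later iteration
as well and so would bound the limit itself. -/
lemma lower_eventually_eq {u : Grain d} {a : ℝ≥0} (ha : growth ψ u = a)
    (hfin : {v ∈ ψ.carrier | TouchAt (u.birth + a) u v}.Finite)
    (hrel : ∀ v ∈ ψ.carrier, v.pos ≠ u.pos → ¬ Settled ψ v → TouchAt (u.birth + a) u v →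
      stopAt ψ u ≤ stopAt ψ v) :
    ∃ n, lower ψ n u = growth ψ u := by
  classical
  have h1 : ∀ᶠ n in Filter.atTop, ∀ v ∈ {v ∈ ψ.carrier | TouchAt (u.birth + a) u v},
      Settled ψ v → upper ψ n v = growth ψ v := by
    rw [Filter.eventually_all_finite hfin]
    intro v _
    by_cases hv : Settled ψ v
    · filter_upwards [hv.eventually] with n hn _ using hn.2
    · exact Filter.Eventually.of_forall fun n h => absurd h hv
  obtain ⟨N, hN⟩ := h1.exists
  refine ⟨N + 1, le_antisymm (lower_le_growth _ _) ?_⟩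
  by_contra hlt
  rw [not_le, lower_succ, stopTime_lt_iff] at hlt
  obtain ⟨r, ⟨v, hv, hvu, s, hs, hsf, hst, ht⟩, hr⟩ := hlt
  have hra : r < a := by rw [ha] at hr; exact_mod_cast hr
  have hstr : (v.birth : ℝ) + s ≤ u.birth + r := by exact_mod_cast hst
  have hrar : (r : ℝ) < a := hra
  have hT : TouchAt (u.birth + a) u v := ht.touchAt (by linarith) (by linarith)
  -- For settled `v` the bound `upper` at stage `N` is already final; for unsettled `v` the
  -- hypothesis `hrel` says that it stops no earlier than `u`, so it is still growing when it
  -- blocks.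
  have key : ∀ m, (s : ℝ≥0∞) ≤ upper ψ m v := by
    intro m
    by_cases hset : Settled ψ v
    · exact (hsf.trans (hN v ⟨hv, hT⟩ hset).le).trans (growth_le_upper m v)
    · have h2 := hrel v hv hvu hset hT
      refine le_trans ?_ (growth_le_upper m v)
      by_contra hlt
      rw [not_le] at hlt
      have h3 : stopAt ψ v < v.birth + s :=
        ENNReal.add_lt_add_left ENNReal.coe_ne_top hlt
      have h4 : (v.birth : ℝ≥0∞) + s ≤ u.birth + r := by exact_mod_cast hst
      have h5 : (u.birth : ℝ≥0∞) + r ≤ stopAt ψ u := by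
        unfold stopAt; rw [ha]; gcongr
      exact absurd (h2.trans_lt h3) (not_lt.2 (h4.trans h5))
  have h6 : growth ψ u ≤ r := by
    refine iSup_le fun m => (lower_le_succ m u).trans ?_
    exact stopTime_le ⟨v, hv, hvu, s, hs, key m, hst, ht⟩
  exact absurd hr (not_lt.2 h6)

/-- A pigeonhole argument: the conditions at stage `n` and radius `a + 1 / (n + 1)` become stricter
with `n`, and only finitely many grains touch `u` by time `u.birth + a + 1`, so one of them
satisfies all conditions. -/
lemma exists_persistent_blocker {f : ℕ → Grain d → ℝ≥0∞} (hf : Antitone f) {u : Grain d} {a : ℝ≥0}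
    (ha : ∀ n, stopTime ψ (f n) u ≤ a)
    (hfin : {v ∈ ψ.carrier | TouchAt (u.birth + a + 1) u v}.Finite) :
    ∃ v ∈ ψ.carrier, ∀ m, ∀ r, a < r → BlockedBy (f m) u r v := by
  by_contra hcon
  push Not at hcon
  have h1 : ∀ᶠ n : ℕ in Filter.atTop, ∀ v ∈ {v ∈ ψ.carrier | TouchAt (u.birth + a + 1) u v},
      ¬ BlockedBy (f n) u (a + 1 / ((n : ℝ≥0) + 1)) v := by
    rw [Filter.eventually_all_finite hfin]
    rintro v ⟨hv, -⟩
    obtain ⟨m, r, har, hm⟩ := hcon v hv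
    have hlim : Filter.Tendsto (fun n : ℕ => a + 1 / ((n : ℝ≥0) + 1)) Filter.atTop (nhds (a + 0)) :=
      tendsto_const_nhds.add tendsto_one_div_add_atTop_nhds_zero_nat
    rw [add_zero] at hlim
    filter_upwards [Filter.eventually_ge_atTop m, hlim.eventually (gt_mem_nhds har)] with n h1 h2 h3
    exact hm (h3.mono (hf h1 v) h2.le)
  obtain ⟨n, hn⟩ := h1.exists
  have hpos : (0 : ℝ≥0) < 1 / ((n : ℝ≥0) + 1) := by positivity
  have h2 : Blocked ψ (f n) u (a + 1 / ((n : ℝ≥0) + 1)) := by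
    apply blocked_of_stopTime_lt
    refine (ha n).trans_lt ?_
    exact_mod_cast lt_add_of_pos_right a hpos
  obtain ⟨v, hv, hb⟩ := h2
  refine hn v ⟨hv, ?_⟩ hb
  obtain ⟨-, s, -, -, h4, h5⟩ := hb
  have h4' : (v.birth : ℝ) + s ≤ u.birth + (a + 1 / ((n : ℝ≥0) + 1) : ℝ≥0) := by exact_mod_cast h4
  have h6 : ((a + 1 / ((n : ℝ≥0) + 1) : ℝ≥0) : ℝ) ≤ a + 1 := by
    push_cast
    gcongr
    rw [div_le_one (by positivity)]; simp
  exact h5.touchAt (by linarith) (by linarith)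

lemma touchAt_of_persistent {u v : Grain d} {a : ℝ≥0} {f : Grain d → ℝ≥0∞}
    (h : ∀ r, a < r → BlockedBy f u r v) :
    v.birth ≤ u.birth + a ∧ TouchAt (u.birth + a) u v := by
  constructor
  · refine le_of_forall_gt_imp_ge_of_dense fun c hc => ?_
    obtain ⟨-, s, -, -, h4, -⟩ := h (c - u.birth) (lt_tsub_iff_left.2 hc)
    have huc : u.birth ≤ c := (le_add_of_nonneg_right a.2).trans hc.le
    rw [add_tsub_cancel_of_le huc] at h4
    exact (le_add_of_nonneg_right s.2).trans h4
  · have hcl : IsClosed {r : ℝ≥0 | Touch u r v (rad (u.birth + r) v)} :=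
      (isClosed_touch_radii u v).preimage (f := fun r : ℝ≥0 => (r, rad (u.birth + r) v))
        (continuous_id.prodMk ((continuous_rad v).comp (by fun_prop)))
    have hsub : Set.Ioi a ⊆ {r : ℝ≥0 | Touch u r v (rad (u.birth + r) v)} := by
      intro r hr
      obtain ⟨-, s, -, -, h4, h5⟩ := h r hr
      exact h5.mono le_rfl (le_rad (by exact_mod_cast h4))
    have hmem : a ∈ closure (Set.Ioi a) := by
      rw [closure_Ioi' ⟨a + 1, by simp⟩]; exact Set.self_mem_Ici
    have := closure_minimal hsub hcl hmem
    unfold TouchAt; rw [rad_birth_add]; exact this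

/-- The persistent blocker `v` of the upper bounds is shown to block `u` already when the others
grow only for some lower bound. This bounds an upper iterate of `u` by `growth ψ u`, which the lower
iterates attain by `hlow`. -/
lemma settled_of_relevant (hu : ∀ v ∈ ψ.carrier, ∀ T : ℝ, {w ∈ ψ.carrier | TouchAt T v w}.Finite)
    {u : Grain d} (huψ : u ∈ ψ.carrier) {a : ℝ≥0} (ha : growth ψ u = a)
    (hlow : ∃ n, lower ψ n u = growth ψ u)
    (hrel : ∀ v ∈ ψ.carrier, v.pos ≠ u.pos → ¬ Settled ψ v → TouchAt (u.birth + a) u v →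
      stopAt ψ u ≤ stopAt ψ v ∧ (stopAt ψ u = stopAt ψ v → ∃ n, lower ψ n v = growth ψ v)) :
    Settled ψ u := by
  obtain ⟨v, hv, hper⟩ := exists_persistent_blocker upper_anti
    (fun n => (lower_le_growth (n + 1) u).trans ha.le) (hu u huψ _)
  obtain ⟨hbirth, htouch⟩ := touchAt_of_persistent (hper 0)
  have hvu : v.pos ≠ u.pos := (hper 0 (a + 1) (by simp)).1
  suffices h : ∃ n, ∀ r, a < r → Blocked ψ (lower ψ n) u r by
    obtain ⟨n, hn⟩ := h
    obtain ⟨m, hm⟩ := hlow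
    refine ⟨max n m, le_antisymm (lower_le_upper _ _ u) ?_⟩
    have h1 : growth ψ u ≤ lower ψ (max n m) u := hm ▸ lower_mono (le_max_right n m) u
    refine le_trans ?_ h1
    rw [ha]
    refine (upper_anti (le_max_left n m) u).trans ?_
    refine le_of_forall_gt_imp_ge_of_dense fun c hc => ?_
    obtain ⟨r, hr1, hr2⟩ := ENNReal.lt_iff_exists_nnreal_btwn.1 hc
    exact (stopTime_le (hn r (by exact_mod_cast hr1))).trans hr2.le
  by_cases hset : Settled ψ v
  · obtain ⟨n, hn1, hn2⟩ := hset.eventually.exists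
    exact ⟨n, fun r hr => ⟨v, hv, (hper n r hr).mono (hn2.trans hn1.symm).le le_rfl⟩⟩
  obtain ⟨hle, heq⟩ := hrel v hv hvu hset htouch
  have hsa : stopAt ψ u = ((u.birth + a : ℝ≥0) : ℝ≥0∞) := by simp [stopAt, ha]
  -- If `v` stops strictly later than `u`, some lower bound already lets it grow beyond the stopping
  -- time of `u`; restricting to radii below `c - u.birth` makes that bound sufficient.
  rcases hle.lt_or_eq with hlt | heq'
  · obtain ⟨n, hn⟩ : ∃ n, stopAt ψ u < v.birth + lower ψ n v := by
      rw [stopAt.eq_def ψ v, growth, ENNReal.add_iSup] at hlt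
      exact (lt_iSup_iff.1 hlt)
    obtain ⟨c, hc1, hc2⟩ := ENNReal.lt_iff_exists_nnreal_btwn.1 hn
    have hc1' : u.birth + a < c := by rw [hsa] at hc1; exact_mod_cast hc1
    have hcu : u.birth ≤ c := (le_add_of_nonneg_right a.2).trans hc1'.le
    refine ⟨n, fun r hr => ?_⟩
    have hr0 : a < min r (c - u.birth) := lt_min hr (lt_tsub_iff_left.2 hc1')
    obtain ⟨h1, s, h2, h3, h4, h5⟩ := hper n _ hr0
    refine Blocked.mono ⟨v, hv, h1, s, h2, ?_, h4, h5⟩ le_rfl (min_le_left _ _)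
    have h6 : v.birth + s ≤ c := by
      refine h4.trans ?_
      calc u.birth + min r (c - u.birth) ≤ u.birth + (c - u.birth) := by gcongr; exact min_le_right _ _
        _ = c := add_tsub_cancel_of_le hcu
    have h7 : (v.birth : ℝ≥0∞) + s ≤ v.birth + lower ψ n v :=
      le_trans (by exact_mod_cast h6) hc2.le
    exact (ENNReal.add_le_add_iff_left ENNReal.coe_ne_top).1 h7
  · obtain ⟨n, hn⟩ := heq heq'
    have hgv : growth ψ v ≠ ⊤ := by
      intro h
      rw [hsa, stopAt, h] at heq'
      simp at heq'
    obtain ⟨b, hb⟩ : ∃ b : ℝ≥0, growth ψ v = b := ⟨_, (ENNReal.coe_toNNReal hgv).symm⟩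
    have hab : u.birth + a = v.birth + b := by
      rw [hsa, stopAt, hb] at heq'; exact_mod_cast heq'
    have habr : (u.birth : ℝ) + a = v.birth + b := by exact_mod_cast hab
    have hT : Touch u a v b := by
      have := htouch
      unfold TouchAt at this
      rwa [rad_birth_add, habr, rad_birth_add] at this
    -- In a tie, `v` blocks with its final radius `b`, if this is positive. If `b = 0`, either the
    -- positions coincide or `u` itself, at radius `a`, blocks `v` at birth, so that `v` would be
    -- settled.
    rcases eq_or_lt_of_le (zero_le : 0 ≤ b) with hb0 | hb0
    · subst hb0
      exfalso
      rcases eq_or_lt_of_le (zero_le : 0 ≤ a) with ha0 | ha0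
      · subst ha0
        exact hvu (touch_zero_zero.1 hT).symm
      · obtain ⟨m, hm⟩ := hlow
        apply hset
        refine ⟨m, le_antisymm (lower_le_upper _ _ _) ?_⟩
        refine le_trans ?_ zero_le
        refine stopTime_le (r := 0) ⟨u, huψ, hvu.symm, a, ha0, ?_, hab.le, hT.symm⟩
        show (a : ℝ≥0∞) ≤ lower ψ m u
        rw [hm, ha]
    · refine ⟨n, fun r hr => Blocked.mono ⟨v, hv, hvu, b, hb0, ?_, hab.ge, hT⟩ le_rfl hr.le⟩
      rw [hn, hb]

end Config

end

/-! ### Regular configurations -/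

noncomputable section

namespace Config

open Grain

variable {d : ℕ} {ψ : Config d}

lemma pos_ne {u v : Grain d} (hu : u ∈ ψ.carrier) (hv : v ∈ ψ.carrier) (h : u ≠ v) :
    u.pos ≠ v.pos := fun h' => h (ψ.pos_injOn hu hv h')

/-- Two freely growing grains meet in the time window `(τ, τ']`. -/
def WindowAdj (ψ : Config d) (τ τ' : ℝ) (u v : Grain d) : Prop :=
  u ∈ ψ.carrier ∧ v ∈ ψ.carrier ∧ u.pos ≠ v.pos ∧ TouchAt τ' u v ∧ ¬ TouchAt τ u v

/-- All the components of the graph of contacts in the window `(τ, τ']` are finite. -/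
def WindowFinite (ψ : Config d) (τ τ' : ℝ) : Prop :=
  ∀ u ∈ ψ.carrier, {v | Relation.ReflTransGen (WindowAdj ψ τ τ') u v}.Finite

/-- Configurations in which information only spreads finitely far in bounded time. -/
structure Regular (ψ : Config d) : Prop where
  finite_touchAt : ∀ u ∈ ψ.carrier, ∀ T : ℝ, {v ∈ ψ.carrier | TouchAt T u v}.Finite
  exists_window : ∀ θ : ℝ, 0 ≤ θ → ∃ τ τ' : ℝ, τ < θ ∧ θ < τ' ∧ WindowFinite ψ τ τ'

/-- The times `e i` decrease to a limit `θ`. From some index on they all lie in one window around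
`θ` with finite components, and the tail of the sequence stays in a single component. -/
lemma Regular.finite_range (hψ : Regular ψ) {x : ℕ → Grain d} (hx : ∀ i, x i ∈ ψ.carrier)
    {e : ℕ → ℝ} (he0 : ∀ i, 0 ≤ e i) (he : Antitone e)
    (h : ∀ i τ τ', τ < e (i + 1) → e i < τ' →
      Relation.ReflTransGen (WindowAdj ψ τ τ') (x i) (x (i + 1))) :
    (Set.range x).Finite := by
  have hbdd : BddBelow (Set.range e) := ⟨0, by rintro _ ⟨i, rfl⟩; exact he0 i⟩
  set θ := ⨅ i, e i with hθ
  have hlim : Filter.Tendsto e Filter.atTop (nhds θ) := tendsto_atTop_ciInf he hbdd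
  obtain ⟨τ, τ', h1, h2, hfin⟩ := hψ.exists_window θ (le_ciInf he0)
  obtain ⟨N, hN⟩ := Filter.eventually_atTop.1 (hlim.eventually (gt_mem_nhds h2))
  have hpath : ∀ n, Relation.ReflTransGen (WindowAdj ψ τ τ') (x N) (x (N + n)) := by
    intro n
    induction n with
    | zero => exact Relation.ReflTransGen.refl
    | succ n ih =>
      exact ih.trans (h (N + n) τ τ' (h1.trans_le (ciInf_le hbdd _)) (hN _ (Nat.le_add_right _ _)))
  refine (((Set.finite_lt_nat N).image x).union (hfin (x N) (hx N))).subset ?_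
  rintro _ ⟨i, rfl⟩
  rcases lt_or_ge i N with hi | hi
  · exact Or.inl ⟨i, hi, rfl⟩
  · right
    obtain ⟨n, rfl⟩ := Nat.exists_eq_add_of_le hi
    exact hpath n

/-- The contrapositive of `settled_of_relevant`. The second contact is needed for a neighbour `w`
tied with `u`: if no unsettled neighbour of `w` stops earlier, then `lower_eventually_eq` applies to
`w`. -/
lemma exists_earlier_not_settled (hψ : Regular ψ) {u : Grain d} (huψ : u ∈ ψ.carrier)
    (hu : ¬ Settled ψ u) {a : ℝ≥0} (ha : growth ψ u = a) :
    ∃ v ∈ ψ.carrier, ¬ Settled ψ v ∧ stopAt ψ v < stopAt ψ u ∧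
      (TouchAt (u.birth + a) u v ∨ ∃ w ∈ ψ.carrier, ¬ Settled ψ w ∧ stopAt ψ w = stopAt ψ u ∧
        w.pos ≠ u.pos ∧ TouchAt (u.birth + a) u w ∧ TouchAt (u.birth + a) w v) := by
  by_contra hcon
  push Not at hcon
  apply hu
  have hrel : ∀ v ∈ ψ.carrier, v.pos ≠ u.pos → ¬ Settled ψ v → TouchAt (u.birth + a) u v →
      stopAt ψ u ≤ stopAt ψ v := by
    intro v hv hvu hvs ht
    by_contra hlt
    exact (hcon v hv hvs (not_le.1 hlt)).1 ht
  refine settled_of_relevant hψ.finite_touchAt huψ ha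
    (lower_eventually_eq ha (hψ.finite_touchAt u huψ _) hrel) fun v hv hvu hvs ht =>
      ⟨hrel v hv hvu hvs ht, fun heq => ?_⟩
  have hgv : growth ψ v ≠ ⊤ := by
    intro h
    rw [stopAt, ha, stopAt, h] at heq
    simp at heq
  obtain ⟨b, hb⟩ : ∃ b : ℝ≥0, growth ψ v = b := ⟨_, (ENNReal.coe_toNNReal hgv).symm⟩
  have hab : u.birth + a = v.birth + b := by
    rw [stopAt, ha, stopAt, hb] at heq; exact_mod_cast heq
  have habr : (v.birth : ℝ) + b = u.birth + a := by exact_mod_cast hab.symm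
  refine lower_eventually_eq hb (hψ.finite_touchAt v hv _) fun w hw hwv hws htw => ?_
  by_contra hlt
  rw [← heq] at hlt
  rw [habr] at htw
  exact (hcon w hw hws (not_le.1 hlt)).2 v hv hvs heq.symm hvu ht htw

/-- At time `τ` the grain `v` is born and not yet stopped, so some lower bound of `v` exceeds its
current radius and blocks `u` in the next upper bound. -/
lemma upper_le_of_touchAt {u v : Grain d} {τ : ℝ} (hvψ : v ∈ ψ.carrier) (hvu : v.pos ≠ u.pos)
    {b : ℝ≥0} (hb : growth ψ v = b) (hv : τ < v.birth + b) (hτ : (v.birth : ℝ) < τ)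
    (ht : TouchAt τ u v) : ∃ n, upper ψ n u ≤ rad τ u := by
  have hrad : ((rad τ v : ℝ≥0) : ℝ) = τ - v.birth := Real.coe_toNNReal _ (by linarith)
  have h1 : (rad τ v : ℝ≥0∞) < growth ψ v := by
    rw [hb, ENNReal.coe_lt_coe, ← NNReal.coe_lt_coe, hrad]; linarith
  obtain ⟨n, hn⟩ := lt_iSup_iff.1 h1
  refine ⟨n, stopTime_le ⟨v, hvψ, hvu, rad τ v, ?_, hn.le, ?_, ht⟩⟩
  · rw [← NNReal.coe_pos, hrad]; linarith
  · rw [← NNReal.coe_le_coe]; push_cast; rw [hrad, rad]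
    have := Real.le_coe_toNNReal (τ - u.birth)
    linarith

lemma rad_lt_growth {u : Grain d} (hus : ¬ Settled ψ u) {a : ℝ≥0} (ha : growth ψ u = a) {τ : ℝ}
    (hτ : τ < u.birth + a) (n : ℕ) : (rad τ u : ℝ≥0∞) < upper ψ n u := by
  rcases le_or_gt τ u.birth with h | h
  · have h0 : rad τ u = 0 := Real.toNNReal_of_nonpos (by linarith)
    rw [h0, ENNReal.coe_zero]
    by_contra h1
    rw [not_lt] at h1
    exact hus ⟨n, le_antisymm (lower_le_upper _ _ _) (h1.trans zero_le)⟩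
  · refine lt_of_lt_of_le ?_ (growth_le_upper n u)
    rw [ha, ENNReal.coe_lt_coe, ← NNReal.coe_lt_coe, rad, Real.coe_toNNReal _ (by linarith)]
    linarith

/-- A contact before both stopping times would stop one of the grains early as soon as the other is
born. If neither is born, both are single points, at different positions. -/
lemma not_touchAt_of_not_settled {u v : Grain d} {τ : ℝ} (huψ : u ∈ ψ.carrier)
    (hvψ : v ∈ ψ.carrier) (hvu : v.pos ≠ u.pos) (hus : ¬ Settled ψ u) (hvs : ¬ Settled ψ v)
    {a b : ℝ≥0} (ha : growth ψ u = a) (hb : growth ψ v = b) (hu : τ < u.birth + a)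
    (hv : τ < v.birth + b) : ¬ TouchAt τ u v := by
  intro ht
  rcases lt_or_ge (v.birth : ℝ) τ with h | h
  · obtain ⟨n, hn⟩ := upper_le_of_touchAt hvψ hvu hb hv h ht
    exact absurd (rad_lt_growth hus ha hu n) (not_lt.2 hn)
  rcases lt_or_ge (u.birth : ℝ) τ with h' | h'
  · obtain ⟨n, hn⟩ := upper_le_of_touchAt huψ hvu.symm ha hu h' ht.symm
    exact absurd (rad_lt_growth hvs hb hv n) (not_lt.2 hn)
  have e1 : rad τ u = 0 := Real.toNNReal_of_nonpos (by linarith)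
  have e2 : rad τ v = 0 := Real.toNNReal_of_nonpos (by linarith)
  rw [TouchAt, e1, e2, touch_zero_zero] at ht
  exact hvu ht.symm

/-- Infinite descent along unsettled grains with strictly decreasing stopping times. Each step uses
contacts that occur between consecutive stopping times, so `Regular.finite_range` contradicts the
injectivity of the sequence. -/
lemma Regular.settled (hψ : Regular ψ) {u : Grain d} (huψ : u ∈ ψ.carrier)
    (hu : growth ψ u ≠ ⊤) : Settled ψ u := by
  by_contra hus
  let S := {v : Grain d // v ∈ ψ.carrier ∧ ¬ Settled ψ v ∧ growth ψ v ≠ ⊤}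
  have hsa : ∀ v : Grain d, growth ψ v ≠ ⊤ ↔ stopAt ψ v ≠ ⊤ := by
    intro v; simp [stopAt]
  have hg : ∀ v : Grain d, growth ψ v ≠ ⊤ → growth ψ v = (growth ψ v).toNNReal := fun v hv =>
    (ENNReal.coe_toNNReal hv).symm
  have hreal : ∀ v : Grain d, growth ψ v ≠ ⊤ →
      (stopAt ψ v).toReal = v.birth + (growth ψ v).toNNReal := by
    intro v hv
    rw [stopAt, ENNReal.toReal_add ENNReal.coe_ne_top hv]; rfl
  have hstep : ∀ v : S, ∃ w : S, (stopAt ψ w.1).toReal < (stopAt ψ v.1).toReal ∧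
      ∀ τ τ', τ < (stopAt ψ w.1).toReal → (stopAt ψ v.1).toReal < τ' →
        Relation.ReflTransGen (WindowAdj ψ τ τ') v.1 w.1 := by
    rintro ⟨v, hv, hvs, hvt⟩
    obtain ⟨w, hw, hws, hlt, hcase⟩ := exists_earlier_not_settled hψ hv hvs (hg v hvt)
    have hwt : growth ψ w ≠ ⊤ := (hsa w).2 hlt.ne_top
    have hlt' := (ENNReal.toReal_lt_toReal ((hsa w).1 hwt) ((hsa v).1 hvt)).2 hlt
    have hwv : w.pos ≠ v.pos := pos_ne hw hv (by rintro rfl; exact lt_irrefl _ hlt)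
    refine ⟨⟨w, hw, hws, hwt⟩, hlt', fun τ τ' h1 h2 => ?_⟩
    simp only at h1 h2 hlt'
    have h1v := h1.trans hlt'
    rw [hreal _ hwt] at h1
    rw [hreal _ hvt] at h2 h1v
    rcases hcase with ht | ⟨x, hx, hxs, hxe, hxv, ht1, ht2⟩
    · exact Relation.ReflTransGen.single ⟨hv, hw, hwv.symm, ht.mono h2.le,
        not_touchAt_of_not_settled hv hw hwv hvs hws (hg v hvt) (hg w hwt) h1v h1⟩
    · have hxt : growth ψ x ≠ ⊤ := (hsa x).2 (hxe ▸ (hsa v).1 hvt)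
      have h1x : τ < x.birth + (growth ψ x).toNNReal := by
        rw [← hreal _ hxt, hxe, hreal _ hvt]; exact h1v
      have hwx : w.pos ≠ x.pos := pos_ne hw hx (by rintro rfl; exact hlt.ne hxe)
      exact (Relation.ReflTransGen.single ⟨hv, hx, hxv.symm, ht1.mono h2.le,
        not_touchAt_of_not_settled hv hx hxv hvs hxs (hg v hvt) (hg x hxt) h1v h1x⟩).tail
        ⟨hx, hw, hwx.symm, ht2.mono h2.le,
        not_touchAt_of_not_settled hx hw hwx hxs hws (hg x hxt) (hg w hwt) h1x h1⟩
  choose next hnext1 hnext2 using hstep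
  let x : ℕ → S := fun n => next^[n] ⟨u, huψ, hus, hu⟩
  have hx : ∀ n, x (n + 1) = next (x n) := fun n => Function.iterate_succ_apply' _ _ _
  have hanti : StrictAnti fun n => (stopAt ψ (x n).1).toReal :=
    strictAnti_nat_of_succ_lt fun n => by simp only [hx]; exact hnext1 _
  have hfin := hψ.finite_range (x := fun n => (x n).1) (fun i => (x i).2.1)
    (e := fun n => (stopAt ψ (x n).1).toReal) (fun _ => ENNReal.toReal_nonneg) hanti.antitone
    (fun i τ τ' h1 h2 => by simp only [hx] at h1 ⊢; exact hnext2 _ _ _ h1 h2)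
  refine Set.infinite_range_of_injective (fun i j hij => hanti.injective ?_) hfin
  exact congrArg (fun v => (stopAt ψ v).toReal) hij

/-- The lower and the upper bounds have the same limit. -/
lemma Regular.iInf_upper (hψ : Regular ψ) {u : Grain d} (huψ : u ∈ ψ.carrier) :
    ⨅ n, upper ψ n u = growth ψ u := by
  refine le_antisymm ?_ (le_iInf fun n => growth_le_upper n u)
  by_cases hu : growth ψ u = ⊤
  · rw [hu]; exact le_top
  · obtain ⟨n, -, hn⟩ := (hψ.settled huψ hu).eventually.exists
    exact hn ▸ iInf_le _ n

lemma stopTime_congr {f g : Grain d → ℝ≥0∞} (h : ∀ v ∈ ψ.carrier, f v ≤ g v) :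
    stopTime ψ g ≤ stopTime ψ f := by
  intro u
  refine le_iInf₂ fun r ⟨v, hv, hb⟩ => stopTime_le ⟨v, hv, hb.mono (h v hv) le_rfl⟩

/-- Both `lower` and `upper` converge to `growth ψ`; comparing `growth ψ` with each of them and
applying the antitone operator gives the two inequalities. -/
lemma Regular.stopTime_growth (hψ : Regular ψ) {u : Grain d} (huψ : u ∈ ψ.carrier) :
    stopTime ψ (growth ψ) u = growth ψ u := by
  refine le_antisymm ?_ ?_
  · rw [← hψ.iInf_upper huψ]
    exact le_iInf fun n => stopTime_anti (fun v => lower_le_growth n v) u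
  · refine iSup_le fun n => (lower_le_succ n u).trans ?_
    exact stopTime_anti (fun v => growth_le_upper n v) u

/-- A fixed point lies above `0`, and applying the operator repeatedly keeps it between the lower
and the upper bounds. -/
lemma Regular.eq_growth_of_fixed (hψ : Regular ψ) {f : Grain d → ℝ≥0∞}
    (hf : ∀ u ∈ ψ.carrier, stopTime ψ f u = f u) {u : Grain d} (huψ : u ∈ ψ.carrier) :
    f u = growth ψ u := by
  have h : ∀ n, (∀ v ∈ ψ.carrier, lower ψ n v ≤ f v) ∧ (∀ v ∈ ψ.carrier, f v ≤ upper ψ n v) := by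
    intro n
    induction n with
    | zero =>
      have h0 : ∀ v ∈ ψ.carrier, lower ψ 0 v ≤ f v := fun v _ => zero_le
      exact ⟨h0, fun v hv => hf v hv ▸ stopTime_congr h0 v⟩
    | succ n ih =>
      have h0 : ∀ v ∈ ψ.carrier, lower ψ (n + 1) v ≤ f v := fun v hv =>
        hf v hv ▸ stopTime_congr ih.2 v
      exact ⟨h0, fun v hv => hf v hv ▸ stopTime_congr h0 v⟩
  refine le_antisymm ?_ (iSup_le fun n => (h n).1 u huψ)
  rw [← hψ.iInf_upper huψ]
  exact le_iInf fun n => (h n).2 u huψ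

end Config

end

/-! ### Existence and uniqueness of the growth times -/

noncomputable section

namespace Grain

variable {d : ℕ}

lemma exists_reachTime_eq {u v : Grain d} {r : ℝ≥0} (h : u.pos ∈ v.grown r) :
    ∃ r₀ : ℝ≥0, (r₀ : ℝ) = v.reachTime u.pos ∧ u.pos ∈ v.grown r₀ ∧ r₀ ≤ r := by
  set S : Set ℝ := {r : ℝ | 0 ≤ r ∧ u.pos ∈ v.grown r} with hS
  have hcl : IsClosed S := by
    have h1 : IsClosed {r : ℝ≥0 | Touch u 0 v r} :=
      (isClosed_touch_radii u v).preimage (f := fun r : ℝ≥0 => ((0 : ℝ≥0), r)) (by fun_prop)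
    convert NNReal.isClosedEmbedding_coe.isClosedMap _ h1 using 1
    ext x
    constructor
    · rintro ⟨hx, hx'⟩
      exact ⟨⟨x, hx⟩, touch_zero_left.2 hx', rfl⟩
    · rintro ⟨x, hx, rfl⟩
      exact ⟨x.2, touch_zero_left.1 hx⟩
  have hbdd : BddBelow S := ⟨0, fun x hx => hx.1⟩
  have hmem := hcl.csInf_mem ⟨r, r.2, h⟩ hbdd
  exact ⟨⟨sInf S, hmem.1⟩, rfl, hmem.2, csInf_le hbdd ⟨r.2, h⟩⟩

lemma reachTime_le {u : Grain d} {y : Space d} {r : ℝ≥0} (h : y ∈ u.grown r) :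
    u.reachTime y ≤ r := csInf_le ⟨0, fun _ hx => hx.1⟩ ⟨r.2, h⟩

/-- A grain with growth time `0` is a single point, which has empty interior because `1 ≤ d`. -/
lemma pos_of_interior_grown (hd : 1 ≤ d) {u : Grain d} {r : ℝ≥0}
    (h : (interior (u.grown r)).Nonempty) : 0 < r := by
  rcases eq_or_lt_of_le (zero_le : 0 ≤ r) with rfl | h0
  · have : Nonempty (Fin d) := ⟨⟨0, hd⟩⟩
    rw [NNReal.coe_zero, grown_zero, interior_singleton] at h
    exact absurd h Set.not_nonempty_empty
  · exact h0

end Grain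

namespace Config

open Grain

variable {d : ℕ} {ψ : Config d}

lemma blocked_of_interior_inter (hd : 1 ≤ d) {F : Grain d → ℝ≥0} {u v : Grain d}
    (hv : v ∈ ψ.carrier) (hvu : v.pos ≠ u.pos) (hle : v.birth + F v ≤ u.birth + F u)
    (h : (interior (u.grown (F u)) ∩ interior (v.grown (F v))).Nonempty) :
    ∃ r < F u, Blocked ψ (fun w => F w) u r := by
  have hu0 : 0 < F u := pos_of_interior_grown hd (h.mono Set.inter_subset_left)
  have hv0 : 0 < F v := pos_of_interior_grown hd (h.mono Set.inter_subset_right)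
  obtain ⟨s, s', hs, hs', ht⟩ := exists_touch_of_interior_inter hu0 hv0 h
  -- The contact radius `s'` may be `0`, whereas a blocker needs a positive one; the maximum with `F
  -- v / 2` stays below `F v`. The radius of `u` is raised accordingly, so that `v` is not later.
  have hx : max s' (F v / 2) < F v := max_lt hs' (NNReal.half_lt_self hv0.ne')
  refine ⟨max s (v.birth + max s' (F v / 2) - u.birth), max_lt hs ?_, v, hv, hvu,
    max s' (F v / 2), lt_max_of_lt_right (by positivity), ENNReal.coe_le_coe.2 hx.le, ?_,
    ht.mono (le_max_left _ _) (le_max_left _ _)⟩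
  · have h1 : v.birth + max s' (F v / 2) < u.birth + F u := lt_of_lt_of_le (by gcongr) hle
    rcases le_total u.birth (v.birth + max s' (F v / 2)) with h2 | h2
    · exact (tsub_lt_iff_left h2).2 h1
    · rwa [tsub_eq_zero_of_le h2]
  · refine le_trans ?_ (add_le_add_right (le_max_right _ _) _)
    exact le_add_tsub

lemma isHardCore_of_fixed (hd : 1 ≤ d) {F : Grain d → ℝ≥0}
    (hF : ∀ u ∈ ψ.carrier, stopTime ψ (fun w => F w) u = F u) :
    IsHardCore (ψ := ψ) fun u => F u := by
  have key : ∀ u ∈ ψ.carrier, ∀ v ∈ ψ.carrier, u ≠ v → v.birth + F v ≤ u.birth + F u →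
      ¬ (interior (u.grown (F u)) ∩ interior (v.grown (F v))).Nonempty := by
    intro u hu v hv huv hle h
    obtain ⟨r, hr, hb⟩ := blocked_of_interior_inter hd hv (pos_ne hv hu huv.symm) hle h
    have := stopTime_le hb
    rw [hF u hu] at this
    exact absurd hr (not_lt.2 (by exact_mod_cast this))
  intro u v huv
  have huv' : u.1 ≠ v.1 := fun h => huv (Subtype.ext h)
  rw [← Set.not_nonempty_iff_eq_empty]
  rcases le_total (v.1.birth + F v.1) (u.1.birth + F u.1) with h | h
  · exact key _ u.2 _ v.2 huv' h
  · rw [Set.inter_comm]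
    exact key _ v.2 _ u.2 huv'.symm h

lemma touch_of_persistent {F : Grain d → ℝ≥0} {u v : Grain d} {a : ℝ≥0}
    (h : ∀ r, a < r → BlockedBy (fun w => F w) u r v) :
    Touch u a v (min (F v) (rad (u.birth + a) v)) := by
  have hcl : IsClosed {r : ℝ≥0 | Touch u r v (min (F v) (rad (u.birth + r) v))} :=
    (isClosed_touch_radii u v).preimage (f := fun r : ℝ≥0 => (r, min (F v) (rad (u.birth + r) v)))
      (continuous_id.prodMk (continuous_const.min ((continuous_rad v).comp (by fun_prop))))
  have hsub : Set.Ioi a ⊆ {r : ℝ≥0 | Touch u r v (min (F v) (rad (u.birth + r) v))} := by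
    intro r hr
    obtain ⟨-, s, -, h3, h4, h5⟩ := h r hr
    exact h5.mono le_rfl (le_min (ENNReal.coe_le_coe.1 h3) (le_rad (by exact_mod_cast h4)))
  have hmem : a ∈ closure (Set.Ioi a) := by
    rw [closure_Ioi' ⟨a + 1, by simp⟩]; exact Set.self_mem_Ici
  exact closure_minimal hsub hcl hmem

/-- The grain that blocks `u` at all radii above `F u` is an earlier neighbour, by passing to the
limit in the closed contact relation. -/
lemma exists_earlierNeighbour_of_fixed {F : Grain d → ℝ≥0}
    (hfin : ∀ u ∈ ψ.carrier, ∀ T : ℝ, {v ∈ ψ.carrier | TouchAt T u v}.Finite)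
    (hF : ∀ u ∈ ψ.carrier, stopTime ψ (fun w => F w) u = F u) (u : ψ.carrier) :
    ∃ v : ψ.carrier, IsEarlierNeighbour (ψ := ψ) (fun u => F u) u v := by
  obtain ⟨u, hu⟩ := u
  obtain ⟨v, hv, hper⟩ := exists_persistent_blocker (ψ := ψ) (f := fun _ w => F w) (a := F u)
    (fun _ _ _ => le_rfl) (fun _ => (hF u hu).le) (hfin u hu _)
  replace hper := hper 0
  have hbirth := (touchAt_of_persistent hper).1
  have ht := touch_of_persistent hper
  obtain ⟨hvu, s, hs0, hsF, -, -⟩ := hper (F u + 1) (by simp)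
  have hFv : 0 < F v := hs0.trans_le (ENNReal.coe_le_coe.1 hsF)
  have hrad : v.birth + rad (u.birth + F u) v = u.birth + F u := by
    rw [← NNReal.coe_inj]; push_cast
    rw [rad, Real.coe_toNNReal]
    · ring
    · have : (v.birth : ℝ) ≤ u.birth + F u := by exact_mod_cast hbirth
      linarith
  refine ⟨⟨v, hv⟩, ?_, hFv, ?_⟩
  · rintro h; exact hvu (by rw [Subtype.mk.inj h])
  rcases eq_or_lt_of_le (zero_le : 0 ≤ F u) with h0 | h0
  · left
    rw [← h0] at ht hrad
    have hm := touch_zero_left.1 ht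
    refine ⟨h0.symm, touch_zero_left.1 (ht.mono le_rfl (min_le_left _ _)), ?_⟩
    have h1 := reachTime_le hm
    have h2 : ((min (F v) (rad (u.birth + (0 : ℝ≥0)) v) : ℝ≥0) : ℝ) ≤ rad (u.birth + (0 : ℝ≥0)) v :=
      NNReal.coe_le_coe.2 (min_le_right _ _)
    have h3 : (v.birth : ℝ) + rad (u.birth + (0 : ℝ≥0)) v = u.birth + (0 : ℝ≥0) := by
      exact_mod_cast hrad
    simp only [NNReal.coe_zero, add_zero] at h1 h2 h3 ⊢
    linarith
  · right
    refine ⟨h0, ?_, ht.mono le_rfl (min_le_left _ _)⟩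
    show v.birth + F v ≤ u.birth + F u
    -- If `v` grew on beyond the stopping time of `u`, then `u` with its full radius would block `v`
    -- at that time, contrary to the fixed point property at `v`.
    by_contra hlt
    rw [not_le, ← hrad] at hlt
    have hlt' : rad (u.birth + F u) v < F v := lt_of_add_lt_add_left hlt
    have hb : Blocked ψ (fun w => F w) v (rad (u.birth + F u) v) :=
      ⟨u, hu, hvu.symm, F u, h0, le_rfl, hrad.ge, (ht.mono le_rfl (min_le_right _ _)).symm⟩
    have := stopTime_le hb
    rw [hF v hv] at this
    exact absurd hlt' (not_lt.2 (by exact_mod_cast this))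

/-- An earlier neighbour is a blocker at `F u`, used at its reach time if `F u = 0`. A blocker at a
smaller radius would make interiors overlap in the full model. -/
lemma fixed_of_isGrowthMaximal {F : Grain d → ℝ≥0}
    (h : IsGrowthMaximal (ψ := ψ) fun u => F u) {u : Grain d} (hu : u ∈ ψ.carrier) :
    stopTime ψ (fun w => F w) u = F u := by
  refine le_antisymm ?_ ?_
  · obtain ⟨⟨v, hv⟩, hne, hv0, hcase⟩ := h.2 ⟨u, hu⟩
    have hvu : v.pos ≠ u.pos := pos_ne hv hu fun h => hne (Subtype.ext h)
    refine stopTime_le ⟨v, hv, hvu, ?_⟩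
    rcases hcase with ⟨h0, hmem, hle⟩ | ⟨h0, hle, ht⟩
    · simp only at h0
      obtain ⟨r, hr1, hr2, hr3⟩ := exists_reachTime_eq hmem
      have ht : Touch u 0 v r := touch_zero_left.2 hr2
      refine ⟨r, ?_, ENNReal.coe_le_coe.2 hr3, ?_, h0.symm ▸ ht⟩
      · rcases eq_or_lt_of_le (zero_le : 0 ≤ r) with rfl | h1
        · exact absurd (touch_zero_zero.1 ht).symm hvu
        · exact h1
      · rw [h0, add_zero, ← NNReal.coe_le_coe, NNReal.coe_add, hr1]; exact hle
    · have ht' : Touch u (F u) v (F v) := ht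
      have hle' : v.birth + F v ≤ u.birth + F u := hle
      exact ⟨F v, hv0, ENNReal.coe_le_coe.2 le_rfl, hle', ht'⟩
  · refine le_iInf₂ fun r ⟨v, hv, hvu, s, hs0, hs, hst, ht⟩ => ?_
    by_contra hlt
    rw [not_le, ENNReal.coe_lt_coe] at hlt
    have hsF : s ≤ F v := ENNReal.coe_le_coe.1 hs
    have hne : (⟨u, hu⟩ : ψ.carrier) ≠ ⟨v, hv⟩ := fun h => hvu (by rw [Subtype.mk.inj h])
    have := (ht.mono le_rfl hsF).interior_inter hlt (hs0.trans_le hsF)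
    have h2 := h.1 ⟨u, hu⟩ ⟨v, hv⟩ hne
    exact this.ne_empty h2

lemma Regular.isGrowthMaximal (hd : 1 ≤ d) (hψ : Regular ψ)
    (hfin : ∀ u ∈ ψ.carrier, growth ψ u ≠ ⊤) :
    IsGrowthMaximal (ψ := ψ) fun u => (growth ψ u).toNNReal := by
  obtain ⟨F, hF⟩ : ∃ F : Grain d → ℝ≥0, ∀ u, F u = (growth ψ u).toNNReal := ⟨_, fun _ => rfl⟩
  have e : ∀ w ∈ ψ.carrier, (F w : ℝ≥0∞) = growth ψ w := fun w hw => by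
    rw [hF]; exact ENNReal.coe_toNNReal (hfin w hw)
  have h : ∀ u ∈ ψ.carrier, stopTime ψ (fun w => F w) u = F u := by
    intro u hu
    rw [e u hu]
    conv_rhs => rw [← hψ.stopTime_growth hu]
    exact le_antisymm (stopTime_congr (fun v hv => (e v hv).ge) u)
      (stopTime_congr (fun v hv => (e v hv).le) u)
  simp only [← hF]
  exact ⟨isHardCore_of_fixed hd h, exists_earlierNeighbour_of_fixed hψ.finite_touchAt h⟩

lemma exists_extension (R : ψ.carrier → ℝ≥0) :
    ∃ F : Grain d → ℝ≥0, R = fun u : ψ.carrier => F u := by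
  classical
  exact ⟨fun u => if h : u ∈ ψ.carrier then R ⟨u, h⟩ else 0, by ext u; simp⟩

lemma Regular.eq_growth (hψ : Regular ψ) {R : ψ.carrier → ℝ≥0} (hR : IsGrowthMaximal R)
    (u : ψ.carrier) : growth ψ u = R u := by
  obtain ⟨F, rfl⟩ := exists_extension R
  exact (hψ.eq_growth_of_fixed (f := fun w => F w)
    (fun u hu => fixed_of_isGrowthMaximal hR hu) u.2).symm

/-- There is some grain `v` that is born before it would be reached by `u`. -/
def Outgrown (ψ : Config d) : Prop :=
  ∀ u ∈ ψ.carrier, ∃ v ∈ ψ.carrier, ∀ r : ℝ≥0, v.pos ∈ u.grown r → v.birth < u.birth + r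

/-- If `u` is never stopped, no other grain grows at all, since `u` would eventually touch it. Every
other grain is then blocked at birth by `u` alone, hence reached by `u` no later than its birth,
which `Outgrown` excludes for some grain. -/
lemma Regular.growth_ne_top (hψ : Regular ψ) (ho : Outgrown ψ) {u : Grain d}
    (hu : u ∈ ψ.carrier) : growth ψ u ≠ ⊤ := by
  intro htop
  have hfix := hψ.stopTime_growth hu
  rw [htop] at hfix
  have hnot : ∀ r, ¬ Blocked ψ (growth ψ) u r := by
    intro r hr
    have := stopTime_le hr
    rw [hfix] at this
    simp at this
  have hzero : ∀ v ∈ ψ.carrier, v.pos ≠ u.pos → growth ψ v = 0 := by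
    intro v hv hvu
    by_contra h0
    obtain ⟨s, hs0, hs⟩ := ENNReal.lt_iff_exists_nnreal_btwn.1 (pos_iff_ne_zero.2 h0)
    obtain ⟨r, hr⟩ := u.exists_touch_radius v
    refine hnot (max r (v.birth + s)) ⟨v, hv, hvu, s, by exact_mod_cast hs0, hs.le, ?_,
      hr.mono (le_max_left _ _) zero_le⟩
    exact (le_max_right _ _).trans (le_add_of_nonneg_left zero_le)
  obtain ⟨v, hv, hvb⟩ := ho u hu
  have hvu : v.pos ≠ u.pos := by
    intro h
    have hvu' := ψ.pos_injOn hv hu h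
    have := hvb 0 (by rw [h]; exact u.pos_mem_grown _)
    rw [hvu', add_zero] at this
    exact lt_irrefl _ this
  have hper : ∀ r : ℝ≥0, 0 < r → BlockedBy (growth ψ) v r u := by
    intro r hr
    have h1 : stopTime ψ (growth ψ) v < r := by
      rw [hψ.stopTime_growth hv, hzero v hv hvu]; exact_mod_cast hr
    obtain ⟨w, hw, hb⟩ := blocked_of_stopTime_lt h1
    by_cases hwu : w = u
    · exact hwu ▸ hb
    · obtain ⟨-, s, hs0, hs, -⟩ := hb
      rw [hzero w hw (pos_ne hw hu hwu)] at hs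
      exact absurd hs0 (not_lt.2 (by exact_mod_cast hs))
  obtain ⟨h1, h2⟩ := touchAt_of_persistent hper
  rw [TouchAt, rad_birth_add, touch_zero_left] at h2
  have h3 := hvb _ h2
  rw [add_zero] at h1
  have h4 : u.birth + rad (v.birth + (0 : ℝ≥0)) u = v.birth := by
    rw [← NNReal.coe_inj]; push_cast
    have : (u.birth : ℝ) ≤ v.birth := by exact_mod_cast h1
    rw [rad, Real.coe_toNNReal _ (by simpa using this)]
    ring
  rw [h4] at h3
  exact lt_irrefl _ h3

theorem Regular.existsUnique (hd : 1 ≤ d) (hψ : Regular ψ) (ho : Outgrown ψ) :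
    ∃! R : ψ.carrier → ℝ≥0, IsGrowthMaximal R := by
  refine ⟨_, hψ.isGrowthMaximal hd fun u hu => hψ.growth_ne_top ho hu, fun R hR => ?_⟩
  ext u
  rw [hψ.eq_growth hR u]; rfl

end Config

end

/-! ### Earlier neighbours and clusters -/

noncomputable section

namespace Grain

variable {d : ℕ}

/-- The time that `w` needs to grow until it hits the set `u.grown r`. -/
def hit (w u : Grain d) (r : ℝ≥0) : ℝ≥0 := sInf {q : ℝ≥0 | Touch w q u r}

lemma hit_le_iff {w u : Grain d} {r q : ℝ≥0} : hit w u r ≤ q ↔ Touch w q u r := by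
  have hcl : IsClosed {q : ℝ≥0 | Touch w q u r} :=
    (isClosed_touch_radii w u).preimage (f := fun q : ℝ≥0 => (q, r)) (by fun_prop)
  have hne : {q : ℝ≥0 | Touch w q u r}.Nonempty := by
    obtain ⟨q, hq⟩ := w.exists_touch_radius u
    exact ⟨q, hq.mono le_rfl zero_le⟩
  constructor
  · intro h
    exact (hcl.csInf_mem hne (OrderBot.bddBelow _)).mono h le_rfl
  · intro h
    exact csInf_le (OrderBot.bddBelow _) h

end Grain

namespace Config

open Grain

variable {d : ℕ} {ψ : Config d}

/-- Configurations for which the growth-maximal model exists and is unique. -/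
structure Solvable (ψ : Config d) : Prop extends Regular ψ where
  outgrown : Outgrown ψ

/-- The growth time as a real number. -/
def gt (ψ : Config d) (u : Grain d) : ℝ≥0 := (growth ψ u).toNNReal

/-- Among the grains with positive growth times, `v` is an earlier neighbour of `u`. -/
def Early (ψ : Config d) (u v : Grain d) : Prop :=
  u.pos ≠ v.pos ∧ 0 < gt ψ u ∧ 0 < gt ψ v ∧ v.birth + gt ψ v ≤ u.birth + gt ψ u ∧
    Touch u (gt ψ u) v (gt ψ v)

lemma isGrowthMaximal_gt (hd : 1 ≤ d) (hψ : Solvable ψ) :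
    IsGrowthMaximal (ψ := ψ) fun u => gt ψ u :=
  hψ.isGrowthMaximal hd fun _ hu => hψ.growth_ne_top hψ.outgrown hu

lemma coe_gt (hψ : Solvable ψ) {u : Grain d} (hu : u ∈ ψ.carrier) : (gt ψ u : ℝ≥0∞) = growth ψ u :=
  ENNReal.coe_toNNReal (hψ.growth_ne_top hψ.outgrown hu)

lemma not_interior_inter (hd : 1 ≤ d) (hψ : Solvable ψ) {u v : Grain d} (hu : u ∈ ψ.carrier)
    (hv : v ∈ ψ.carrier) (huv : u.pos ≠ v.pos) :
    interior (u.grown (gt ψ u)) ∩ interior (v.grown (gt ψ v)) = ∅ := by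
  have h := (isGrowthMaximal_gt hd hψ).1 ⟨u, hu⟩ ⟨v, hv⟩ (by
    intro h; exact huv (by rw [Subtype.mk.inj h]))
  exact h

lemma exists_early (hd : 1 ≤ d) (hψ : Solvable ψ) {u : Grain d} (hu : u ∈ ψ.carrier)
    (h0 : 0 < gt ψ u) : ∃ v ∈ ψ.carrier, Early ψ u v := by
  obtain ⟨⟨v, hv⟩, hne, hv0, hcase⟩ := (isGrowthMaximal_gt hd hψ).2 ⟨u, hu⟩
  refine ⟨v, hv, pos_ne hu hv fun h => hne (Subtype.ext h.symm), h0, hv0, ?_⟩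
  rcases hcase with ⟨h1, -⟩ | ⟨-, h2, h3⟩
  · exact absurd h1 h0.ne'
  · exact ⟨h2, h3⟩

/-- A smaller hitting time would violate the hard-core property. So the growth time of `u` is
determined by `u` and any one touching neighbour, which turns coincidences of stopping times into
coincidences of hitting times. -/
lemma hit_eq_gt (hd : 1 ≤ d) (hψ : Solvable ψ) {u v : Grain d} (hu : u ∈ ψ.carrier)
    (hv : v ∈ ψ.carrier) (huv : u.pos ≠ v.pos) (hv0 : 0 < gt ψ v)
    (ht : Touch u (gt ψ u) v (gt ψ v)) : hit u v (gt ψ v) = gt ψ u := by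
  refine le_antisymm (hit_le_iff.2 ht) ?_
  by_contra hlt
  rw [not_le] at hlt
  have h := (hit_le_iff.1 le_rfl : Touch u (hit u v (gt ψ v)) v (gt ψ v)).interior_inter hlt hv0
  exact h.ne_empty (not_interior_inter hd hψ hu hv huv)

lemma not_touchAt_of_lt (hψ : Solvable ψ) {u v : Grain d} {τ : ℝ}
    (huψ : u ∈ ψ.carrier) (hvψ : v ∈ ψ.carrier) (hvu : v.pos ≠ u.pos) (hu0 : 0 < gt ψ u)
    (hv0 : 0 < gt ψ v) (hu : τ < u.birth + gt ψ u) (hv : τ < v.birth + gt ψ v) :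
    ¬ TouchAt τ u v := by
  intro ht
  have key : ∀ {u v : Grain d}, u ∈ ψ.carrier → v ∈ ψ.carrier → v.pos ≠ u.pos → 0 < gt ψ u →
      τ < u.birth + gt ψ u → τ < v.birth + gt ψ v → (v.birth : ℝ) < τ → ¬ TouchAt τ u v := by
    intro u v huψ hvψ hvu hu0 hu hv hlt ht
    obtain ⟨n, hn⟩ := upper_le_of_touchAt hvψ hvu (coe_gt hψ hvψ).symm hv hlt ht
    have h1 : gt ψ u ≤ rad τ u := by
      have := (growth_le_upper n u).trans hn
      rw [← coe_gt hψ huψ] at this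
      exact ENNReal.coe_le_coe.1 this
    rw [← NNReal.coe_le_coe, rad] at h1
    rcases le_total τ u.birth with h | h
    · rw [Real.toNNReal_of_nonpos (by linarith)] at h1
      exact absurd hu0 (not_lt.2 h1)
    · rw [Real.coe_toNNReal _ (by linarith)] at h1
      linarith
  rcases lt_or_ge (v.birth : ℝ) τ with h | h
  · exact key huψ hvψ hvu hu0 hu hv h ht
  rcases lt_or_ge (u.birth : ℝ) τ with h' | h'
  · exact key hvψ huψ hvu.symm hv0 hv hu h' ht.symm
  have e1 : rad τ u = 0 := Real.toNNReal_of_nonpos (by linarith)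
  have e2 : rad τ v = 0 := Real.toNNReal_of_nonpos (by linarith)
  rw [TouchAt, e1, e2, touch_zero_zero] at ht
  exact hvu ht.symm

/-- Consecutive grains touch when the later one stops but not before the earlier one stops, so each
contact falls into every window that contains both stopping times in its interior. -/
lemma finite_range_of_early (hψ : Solvable ψ) {x : ℕ → Grain d} (hx : ∀ i, x i ∈ ψ.carrier)
    (h : ∀ i, Early ψ (x i) (x (i + 1))) : (Set.range x).Finite := by
  have hle : ∀ i, (((x (i + 1)).birth : ℝ) + gt ψ (x (i + 1))) ≤ (x i).birth + gt ψ (x i) :=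
    fun i => by exact_mod_cast (h i).2.2.2.1
  refine hψ.finite_range hx (e := fun i => (x i).birth + gt ψ (x i)) (fun i => by positivity)
    (antitone_nat_of_succ_le hle) fun i τ τ' h1 h2 => Relation.ReflTransGen.single ?_
  obtain ⟨e1, e2, e3, e4, e5⟩ := h i
  exact ⟨hx _, hx _, e1, e5.touchAt h2.le ((hle i).trans h2.le),
    not_touchAt_of_lt hψ (hx _) (hx _) e1.symm e2 e3 (h1.trans_le (hle i)) h1⟩

lemma exists_early_seq (hd : 1 ≤ d) (hψ : Solvable ψ) {u : Grain d} (hu : u ∈ ψ.carrier)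
    (h0 : 0 < gt ψ u) : ∃ x : ℕ → Grain d, x 0 = u ∧ (∀ i, x i ∈ ψ.carrier) ∧
      (∀ i, Early ψ (x i) (x (i + 1))) := by
  have hstep : ∀ v : {v : Grain d // v ∈ ψ.carrier ∧ 0 < gt ψ v},
      ∃ w : {v : Grain d // v ∈ ψ.carrier ∧ 0 < gt ψ v}, Early ψ v.1 w.1 := by
    rintro ⟨v, hv, hv0⟩
    obtain ⟨w, hw, hvw⟩ := exists_early hd hψ hv hv0
    exact ⟨⟨w, hw, hvw.2.2.1⟩, hvw⟩
  choose next hnext using hstep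
  refine ⟨fun n => (next^[n] ⟨u, hu, h0⟩).1, rfl, fun i => (next^[i] ⟨u, hu, h0⟩).2.1, fun i => ?_⟩
  simp only [Function.iterate_succ_apply']
  exact hnext _

/-- A finite set of grains in which every grain has an earlier neighbour. -/
lemma exists_finite_closed (hd : 1 ≤ d) (hψ : Solvable ψ) {u : Grain d} (hu : u ∈ ψ.carrier)
    (h0 : 0 < gt ψ u) : ∃ A : Set (Grain d), A.Finite ∧ A ⊆ ψ.carrier ∧ u ∈ A ∧
      (∀ x ∈ A, x.birth + gt ψ x ≤ u.birth + gt ψ u) ∧ ∀ x ∈ A, ∃ y ∈ A, Early ψ x y := by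
  obtain ⟨x, hx0, hx, he⟩ := exists_early_seq hd hψ hu h0
  refine ⟨Set.range x, finite_range_of_early hψ hx he, ?_, ⟨0, hx0⟩, ?_, ?_⟩
  · rintro _ ⟨i, rfl⟩; exact hx i
  · rintro _ ⟨i, rfl⟩
    have : Antitone fun i => (x i).birth + gt ψ (x i) :=
      antitone_nat_of_succ_le fun i => (he i).2.2.2.1
    rw [← hx0]; exact this (Nat.zero_le i)
  · rintro _ ⟨i, rfl⟩; exact ⟨_, ⟨i + 1, rfl⟩, he i⟩

lemma regular_of_finite (h : ψ.carrier.Finite) : Regular ψ where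
  finite_touchAt _ _ _ := h.subset fun _ hv => hv.1
  exists_window θ _ := by
    refine ⟨θ - 1, θ + 1, by linarith, by linarith, fun u hu => h.subset fun v hv => ?_⟩
    induction hv with
    | refl => exact hu
    | tail _ h _ => exact h.2.1

/-- The restricted growth times are growth-maximal on `φ`, since each grain keeps an earlier
neighbour, and a finite configuration is regular. By uniqueness the grains outside `φ` have no
influence. -/
lemma growth_eq_of_closed (hd : 1 ≤ d) (hψ : Solvable ψ) {φ : Config d}
    (hfin : φ.carrier.Finite) (hφ : φ.carrier ⊆ ψ.carrier)
    (hcl : ∀ x ∈ φ.carrier, ∃ y ∈ φ.carrier, Early ψ x y) {u : Grain d} (hu : u ∈ φ.carrier) :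
    gt φ u = gt ψ u := by
  have hgm : IsGrowthMaximal (ψ := φ) fun u => gt ψ u := by
    constructor
    · rintro ⟨u, hu⟩ ⟨v, hv⟩ huv
      exact not_interior_inter hd hψ (hφ hu) (hφ hv) (pos_ne hu hv fun h => huv (Subtype.ext h))
    · rintro ⟨u, hu⟩
      obtain ⟨v, hv, h1, h2, h3, h4, h5⟩ := hcl u hu
      exact ⟨⟨v, hv⟩, fun h => h1 (by rw [Subtype.mk.inj h]), h3, Or.inr ⟨h2, h4, h5⟩⟩
  have := (regular_of_finite hfin).eq_growth hgm ⟨u, hu⟩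
  rw [gt, this]
  rfl

/-- Grains with an earlier neighbour that is stopped at the same time. -/
def Tie (ψ : Config d) (u : Grain d) : Prop :=
  ∃ v ∈ ψ.carrier, Early ψ u v ∧ v.birth + gt ψ v = u.birth + gt ψ u

/-- Chains of earlier neighbours. -/
def Desc (ψ : Config d) : Grain d → Grain d → Prop :=
  Relation.ReflTransGen fun u v => v ∈ ψ.carrier ∧ Early ψ u v

/-- The ties at the end of the chains of earlier neighbours of `u`. -/
def roots (ψ : Config d) (u : Grain d) : Set (Grain d) := {ρ | Desc ψ u ρ ∧ Tie ψ ρ}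

/-- A sequence of earlier neighbours has finite range, so it returns to some grain. Its stopping
times are antitone, hence constant between the two visits, which gives a tie. -/
lemma roots_nonempty (hd : 1 ≤ d) (hψ : Solvable ψ) {u : Grain d} (hu : u ∈ ψ.carrier)
    (h0 : 0 < gt ψ u) : (roots ψ u).Nonempty := by
  obtain ⟨x, hx0, hx, he⟩ := exists_early_seq hd hψ hu h0
  have hfin := finite_range_of_early hψ hx he
  have hanti : Antitone fun i => (x i).birth + gt ψ (x i) :=
    antitone_nat_of_succ_le fun i => (he i).2.2.2.1
  have hdesc : ∀ i, Desc ψ u (x i) := by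
    intro i
    induction i with
    | zero => rw [hx0]; exact Relation.ReflTransGen.refl
    | succ i ih => exact ih.tail ⟨hx _, he i⟩
  have hninj : ¬ Function.Injective x := fun h => Set.infinite_range_of_injective h hfin
  obtain ⟨i, j, hij, hlt⟩ : ∃ i j, x i = x j ∧ i < j := by
    simp only [Function.Injective, not_forall] at hninj
    obtain ⟨i, j, hij, hne⟩ := hninj
    rcases lt_or_gt_of_ne hne with h | h
    · exact ⟨i, j, hij, h⟩
    · exact ⟨j, i, hij.symm, h⟩
  refine ⟨x i, hdesc i, x (i + 1), hx _, he i, le_antisymm (he i).2.2.2.1 ?_⟩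
  have := hanti (show i + 1 ≤ j from hlt)
  simp only at this
  rwa [← hij] at this

/-- No ties between different earlier neighbours, except for grains that touch each other. -/
structure Generic (ψ : Config d) : Prop extends Solvable ψ where
  tie_unique : ∀ u ∈ ψ.carrier, ∀ v ∈ ψ.carrier, ∀ w ∈ ψ.carrier, Early ψ u v → Early ψ u w →
    v.birth + gt ψ v = u.birth + gt ψ u → v = w
  touch : ∀ u ∈ ψ.carrier, ∀ v ∈ ψ.carrier, ∀ w ∈ ψ.carrier, Early ψ u v → Early ψ u w →
    v.birth + gt ψ v < u.birth + gt ψ u → w.birth + gt ψ w < u.birth + gt ψ u →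
    Touch v (gt ψ v) w (gt ψ w)

lemma mem_roots_of_early {u v ρ : Grain d} (hv : v ∈ ψ.carrier) (h : Early ψ u v)
    (hρ : ρ ∈ roots ψ v) : ρ ∈ roots ψ u := ⟨Relation.ReflTransGen.head ⟨hv, h⟩ hρ.1, hρ.2⟩

lemma exists_early_of_mem_roots {u ρ : Grain d} (hρ : ρ ∈ roots ψ u) (hu : ¬ Tie ψ u) :
    ∃ v ∈ ψ.carrier, Early ψ u v ∧ ρ ∈ roots ψ v := by
  obtain ⟨h1, h2⟩ := hρ
  rcases Relation.ReflTransGen.cases_head h1 with rfl | ⟨v, ⟨hv, huv⟩, h⟩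
  · exact absurd h2 hu
  · exact ⟨v, hv, huv, h, h2⟩

lemma Early.symm_of_eq {u v : Grain d} (h : Early ψ u v)
    (he : v.birth + gt ψ v = u.birth + gt ψ u) : Early ψ v u :=
  ⟨h.1.symm, h.2.2.1, h.2.1, he.ge, h.2.2.2.2.symm⟩

lemma roots_of_tie (hψ : Generic ψ) {u v : Grain d} (hu : u ∈ ψ.carrier) (hv : v ∈ ψ.carrier)
    (h : Early ψ u v) (he : v.birth + gt ψ v = u.birth + gt ψ u) : roots ψ u = {u, v} := by
  have key : ∀ x, Desc ψ u x → x = u ∨ x = v := by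
    intro x hx
    induction hx with
    | refl => exact Or.inl rfl
    | tail _ hbc ih =>
      rcases ih with rfl | rfl
      · exact Or.inr (hψ.tie_unique _ hu _ hv _ hbc.1 h hbc.2 he).symm
      · exact Or.inl (hψ.tie_unique _ hv _ hu _ hbc.1 (h.symm_of_eq he) hbc.2 he.symm).symm
  ext x
  constructor
  · intro hx
    exact key x hx.1
  · rintro (rfl | rfl)
    · exact ⟨Relation.ReflTransGen.refl, v, hv, h, he⟩
    · exact ⟨Relation.ReflTransGen.single ⟨hv, h⟩, u, hu, h.symm_of_eq he, he.symm⟩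

lemma wellFounded_early (hψ : Solvable ψ) : WellFounded fun v u : ψ.carrier =>
    Early ψ u.1 v.1 ∧ v.1.birth + gt ψ v.1 < u.1.birth + gt ψ u.1 := by
  rw [wellFounded_iff_isEmpty_descending_chain]
  refine ⟨fun ⟨x, hx⟩ => ?_⟩
  have hfin := finite_range_of_early hψ (x := fun n => (x n).1) (fun i => (x i).2)
    (fun i => (hx i).1)
  have hanti : StrictAnti fun i => (x i).1.birth + gt ψ (x i).1 :=
    strictAnti_nat_of_succ_lt fun i => (hx i).2
  exact Set.infinite_range_of_injective
    (fun i j hij => hanti.injective (congrArg (fun v => v.birth + gt ψ v) hij)) hfin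

/-- Well-founded induction on strictly earlier neighbours. A grain in a tie has just itself and its
partner as roots; any other grain inherits the roots of its earlier neighbours, provided that these
agree. -/
lemma roots_spec (hd : 1 ≤ d) (hψ : Generic ψ) (u : ψ.carrier) : 0 < gt ψ u.1 →
    (∀ v ∈ ψ.carrier, Early ψ u.1 v → roots ψ v = roots ψ u.1) ∧ (roots ψ u.1).encard ≤ 2 := by
  induction u using (wellFounded_early hψ.toSolvable).induction with
  | _ u ih =>
  intro hu0
  by_cases ht : Tie ψ u.1
  · obtain ⟨v, hv, huv, he⟩ := ht
    rw [roots_of_tie hψ u.2 hv huv he]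
    refine ⟨fun w hw huw => ?_, (Set.encard_insert_le _ _).trans (by
      rw [Set.encard_singleton]; norm_num)⟩
    rw [← hψ.tie_unique _ u.2 _ hv _ hw huv huw he,
      roots_of_tie hψ hv u.2 (huv.symm_of_eq he) he.symm, Set.pair_comm]
  · have hlt : ∀ v ∈ ψ.carrier, Early ψ u.1 v → v.birth + gt ψ v < u.1.birth + gt ψ u.1 :=
      fun v hv huv => lt_of_le_of_ne huv.2.2.2.1 fun h => ht ⟨v, hv, huv, h⟩
    have hconst : ∀ v ∈ ψ.carrier, Early ψ u.1 v → ∀ w ∈ ψ.carrier, Early ψ u.1 w →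
        roots ψ v = roots ψ w := by
      intro v hv huv w hw huw
      by_cases hvw : v = w
      · rw [hvw]
      have htouch := hψ.touch _ u.2 v hv w hw huv huw (hlt v hv huv) (hlt w hw huw)
      have hpos := pos_ne hv hw hvw
      -- By `Generic.touch` the two earlier neighbours touch, so one of them is an earlier neighbour
      -- of the other and the induction hypothesis identifies their roots.
      rcases le_total (w.birth + gt ψ w) (v.birth + gt ψ v) with h | h
      · exact ((ih ⟨v, hv⟩ ⟨huv, hlt v hv huv⟩ huv.2.2.1).1 w hw
          ⟨hpos, huv.2.2.1, huw.2.2.1, h, htouch⟩).symm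
      · exact (ih ⟨w, hw⟩ ⟨huw, hlt w hw huw⟩ huw.2.2.1).1 v hv
          ⟨hpos.symm, huw.2.2.1, huv.2.2.1, h, htouch.symm⟩
    have heq : ∀ v ∈ ψ.carrier, Early ψ u.1 v → roots ψ v = roots ψ u.1 := by
      intro v hv huv
      refine Set.Subset.antisymm (fun ρ hρ => mem_roots_of_early hv huv hρ) fun ρ hρ => ?_
      obtain ⟨w, hw, huw, hρw⟩ := exists_early_of_mem_roots hρ ht
      rwa [hconst v hv huv w hw huw]
    obtain ⟨v, hv, huv⟩ := exists_early hd hψ.toSolvable u.2 hu0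
    exact ⟨heq, heq v hv huv ▸ (ih ⟨v, hv⟩ ⟨huv, hlt v hv huv⟩ huv.2.2.1).2⟩

lemma roots_eq_of_touch (hd : 1 ≤ d) (hψ : Generic ψ) {u v : Grain d} (hu : u ∈ ψ.carrier)
    (hv : v ∈ ψ.carrier) (huv : u ≠ v) (hu0 : 0 < gt ψ u) (hv0 : 0 < gt ψ v)
    (ht : Touch u (gt ψ u) v (gt ψ v)) : roots ψ u = roots ψ v := by
  have hpos := pos_ne hu hv huv
  rcases le_total (v.birth + gt ψ v) (u.birth + gt ψ u) with h | h
  · exact ((roots_spec hd hψ ⟨u, hu⟩ hu0).1 v hv ⟨hpos, hu0, hv0, h, ht⟩).symm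
  · exact (roots_spec hd hψ ⟨v, hv⟩ hv0).1 u hu ⟨hpos.symm, hv0, hu0, h, ht.symm⟩

/-- Touching grains share their roots, so a whole cluster lies among the grains that have a given
root `ρ`. -/
lemma cluster_finite (hd : 1 ≤ d) (hψ : Generic ψ)
    (hfin : ∀ ρ ∈ ψ.carrier, {w ∈ ψ.carrier | ρ ∈ roots ψ w}.Finite)
    {R : ψ.carrier → ℝ≥0} (hR : IsGrowthMaximal R) (c : Cluster R) : c.supp.Finite := by
  have hRg : ∀ u, R u = gt ψ u.1 := fun u => by rw [gt, hψ.eq_growth hR u]; rfl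
  induction c using SimpleGraph.ConnectedComponent.ind with
  | _ u =>
  have hconst : ∀ v, (contactGraph R).Reachable u v → roots ψ u.1.1 = roots ψ v.1.1 := by
    rintro v ⟨p⟩
    induction p with
    | nil => rfl
    | @cons a b _ h _ ih =>
      rw [← ih]
      refine roots_eq_of_touch hd hψ a.1.2 b.1.2 ?_ (hRg a.1 ▸ a.2) (hRg b.1 ▸ b.2) ?_
      · exact fun h' => h.1 (Subtype.ext (Subtype.ext h'))
      · rw [← hRg, ← hRg]; exact h.2
  obtain ⟨ρ, hρ⟩ := roots_nonempty hd hψ.toSolvable u.1.2 (hRg u.1 ▸ u.2)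
  have hρψ : ρ ∈ ψ.carrier := by
    rcases Relation.ReflTransGen.cases_tail hρ.1 with h | ⟨_, _, h⟩
    · exact h ▸ u.1.2
    · exact h.1
  refine Set.Finite.of_finite_image (f := fun v : {u : ψ.carrier // 0 < R u} => v.1.1)
    ((hfin ρ hρψ).subset ?_) (fun a _ b _ h => Subtype.ext (Subtype.ext h))
  rintro _ ⟨v, hv, rfl⟩
  refine ⟨v.1.2, ?_⟩
  show ρ ∈ roots ψ v.1.1
  rw [← hconst v (SimpleGraph.ConnectedComponent.exact hv).symm]
  exact hρ

end Config

end

/-! ### Percolation -/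

noncomputable section

section Continua

variable {X : Type*} [TopologicalSpace X] [CompactSpace X] [T2Space X]

/-- Boundary bumping: a component of the trace of a continuum on the closure of an open set leaves
the open set. -/
lemma exists_subcontinuum {C U : Set X} (hC : IsClosed C) (hCc : IsPreconnected C) (hU : IsOpen U)
    {z : X} (hz : z ∈ C) (hzU : z ∈ U) (hCU : ¬ C ⊆ U) :
    ∃ C' ⊆ C, IsClosed C' ∧ IsPreconnected C' ∧ z ∈ C' ∧ C' ⊆ closure U ∧ ¬ C' ⊆ U := by
  have hYc : IsClosed (C ∩ closure U) := hC.inter isClosed_closure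
  have : CompactSpace ↥(C ∩ closure U) := isCompact_iff_compactSpace.1 hYc.isCompact
  let z' : ↥(C ∩ closure U) := ⟨z, hz, subset_closure hzU⟩
  refine ⟨Subtype.val '' connectedComponent z', ?_, ?_, ?_, ⟨z', mem_connectedComponent, rfl⟩, ?_, ?_⟩
  · rintro _ ⟨y, -, rfl⟩; exact y.2.1
  · exact hYc.isClosedEmbedding_subtypeVal.isClosedMap _ isClosed_connectedComponent
  · exact isPreconnected_connectedComponent.image _ continuous_subtype_val.continuousOn
  · rintro _ ⟨y, -, rfl⟩; exact y.2.2
  intro hsub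
  have hsub' : connectedComponent z' ⊆ Subtype.val ⁻¹' U := Set.image_subset_iff.1 hsub
  rw [connectedComponent_eq_iInter_isClopen] at hsub'
  have : Nonempty {s : Set ↥(C ∩ closure U) // IsClopen s ∧ z' ∈ s} :=
    ⟨⟨Set.univ, isClopen_univ, trivial⟩⟩
  obtain ⟨⟨s, hs, hzs⟩, hsU⟩ := exists_subset_nhds_of_compactSpace
    (V := fun s : {s : Set ↥(C ∩ closure U) // IsClopen s ∧ z' ∈ s} => s.1)
    (fun s t => ⟨⟨s.1 ∩ t.1, s.2.1.inter t.2.1, s.2.2, t.2.2⟩, Set.inter_subset_left,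
      Set.inter_subset_right⟩) (fun s => s.2.1.isClosed)
    (fun x hx => (hU.preimage continuous_subtype_val).mem_nhds (hsub' hx))
  have hV := hYc.isClosedEmbedding_subtypeVal.isClosedMap _ hs.isClosed
  have hV' := hYc.isClosedEmbedding_subtypeVal.isClosedMap _ hs.compl.isClosed
  obtain ⟨c, hcC, hcU⟩ := Set.not_subset.1 hCU
  obtain ⟨x, -, ⟨y, hy, rfl⟩, hx2⟩ := isPreconnected_closed_iff.1 hCc (Subtype.val '' s)
    (Subtype.val '' sᶜ ∪ C ∩ Uᶜ) hV (hV'.union (hC.inter hU.isClosed_compl)) (by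
      intro x hx
      by_cases hxU : x ∈ U
      · by_cases hxs : (⟨x, hx, subset_closure hxU⟩ : ↥(C ∩ closure U)) ∈ s
        · exact Or.inl ⟨_, hxs, rfl⟩
        · exact Or.inr (Or.inl ⟨_, hxs, rfl⟩)
      · exact Or.inr (Or.inr ⟨hx, hxU⟩)) ⟨z, hz, z', hzs, rfl⟩ ⟨c, hcC, Or.inr ⟨hcC, hcU⟩⟩
  rcases hx2 with ⟨y', hy', h⟩ | ⟨-, h⟩
  · exact hy' (Subtype.ext h ▸ hy)
  · exact h (hsU hy)

/-- **Sierpiński's theorem**: a continuum is not a disjoint union of countably many closed sets,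
two of which are nonempty. -/
theorem sierpinski_continuum [PreconnectedSpace X] {ι : Type*} [Countable ι] {A : ι → Set X}
    (hA : ∀ i, IsClosed (A i)) (hd : Pairwise fun i j => Disjoint (A i) (A j))
    (hU : ∀ x, ∃ i, x ∈ A i) {i j : ι} (hij : i ≠ j) (hi : (A i).Nonempty) (hj : (A j).Nonempty) :
    False := by
  -- Any subcontinuum meeting two of the sets contains a smaller one that avoids a prescribed `A n`
  -- and still meets two. Iterating over all `n` gives a nested sequence whose intersection would be
  -- nonempty and uncovered.
  let M := {C : Set X // IsClosed C ∧ IsPreconnected C ∧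
    ∃ i j, i ≠ j ∧ (C ∩ A i).Nonempty ∧ (C ∩ A j).Nonempty}
  have hstep : ∀ (C : M) (n : ι), ∃ C' : M, C'.1 ⊆ C.1 ∧ Disjoint C'.1 (A n) := by
    rintro ⟨C, hC, hCc, i, j, hij, hi, hj⟩ n
    by_cases hn : (C ∩ A n).Nonempty
    swap
    · exact ⟨⟨C, hC, hCc, i, j, hij, hi, hj⟩, le_rfl,
        Set.disjoint_iff_inter_eq_empty.2 (Set.not_nonempty_iff_eq_empty.1 hn)⟩
    obtain ⟨m, hmn, z, hzC, hzm⟩ : ∃ m, m ≠ n ∧ (C ∩ A m).Nonempty := by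
      by_cases h : i = n
      · exact ⟨j, fun h' => hij (h.trans h'.symm), hj⟩
      · exact ⟨i, h, hi⟩
    obtain ⟨U, V, hUo, hVo, hmU, hnV, hUV⟩ := normal_separation (hA m) (hA n) (hd hmn)
    have hcl : Disjoint (closure U) (A n) := by
      have : closure U ⊆ Vᶜ := closure_minimal hUV.subset_compl_right hVo.isClosed_compl
      exact Set.disjoint_left.2 fun x hx hx' => this hx (hnV hx')
    obtain ⟨c, hcC, hcn⟩ := hn
    obtain ⟨C', hC'C, h1, h2, hzC', h4, h5⟩ := exists_subcontinuum hC hCc hUo hzC (hmU hzm)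
      (fun h => Set.disjoint_left.1 hcl (subset_closure (h hcC)) hcn)
    obtain ⟨y, hyC', hyU⟩ := Set.not_subset.1 h5
    obtain ⟨k, hk⟩ := hU y
    refine ⟨⟨C', h1, h2, m, k, ?_, ⟨z, hzC', hzm⟩, ⟨y, hyC', hk⟩⟩, hC'C, hcl.mono_left h4⟩
    rintro rfl
    exact hyU (hmU hk)
  choose next hnext1 hnext2 using hstep
  have : Nonempty ι := ⟨i⟩
  obtain ⟨f, hf⟩ := exists_surjective_nat ι
  let x : ℕ → M := fun n => Nat.rec ⟨Set.univ, isClosed_univ, isPreconnected_univ, i, j, hij,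
    by simpa using hi, by simpa using hj⟩ (fun n C => next C (f n)) n
  obtain ⟨y, hy⟩ := IsCompact.nonempty_iInter_of_sequence_nonempty_isCompact_isClosed
    (fun n => (x n).1) (fun n => hnext1 (x n) (f n))
    (fun n => by
      obtain ⟨a, b, -, h, -⟩ := (x n).2.2.2
      exact h.mono Set.inter_subset_left) ((x 0).2.1.isCompact) (fun n => (x n).2.1)
  obtain ⟨k, hk⟩ := hU y
  obtain ⟨n, rfl⟩ := hf k
  exact Set.disjoint_left.1 (hnext2 (x n) (f n)) (Set.mem_iInter.1 hy (n + 1)) hk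

end Continua

/-- A closed connected set that is covered by countably many disjoint compact sets is bounded. -/
theorem isBounded_of_countable_cover {E : Type*} [MetricSpace E] [ProperSpace E] {F : Set E}
    (hF : IsClosed F) (hFc : IsConnected F) {ι : Type*} [Countable ι] {C : ι → Set E}
    (hC : ∀ i, IsCompact (C i)) (hd : Pairwise fun i j => Disjoint (C i) (C j))
    (hFC : ∀ x ∈ F, ∃ i, x ∈ C i) : Bornology.IsBounded F := by
  by_contra hb
  have : LocallyCompactSpace F := hF.isClosedEmbedding_subtypeVal.locallyCompactSpace
  have : PreconnectedSpace F := isPreconnected_iff_preconnectedSpace.1 hFc.isPreconnected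
  have : NoncompactSpace F := by
    rw [← not_compactSpace_iff, ← isCompact_iff_compactSpace]
    exact fun h => hb h.isBounded
  -- The one-point compactification of the noncompact connected `F` is a continuum; the point at
  -- infinity is one more closed piece.
  let A : Option ι → Set (OnePoint F) := fun o => o.elim {OnePoint.infty}
    fun i => OnePoint.some '' (Subtype.val ⁻¹' C i)
  obtain ⟨x, hx⟩ := hFc.nonempty
  obtain ⟨i, hi⟩ := hFC x hx
  refine sierpinski_continuum (A := A) (i := none) (j := some i) ?_ ?_ ?_ (by simp)
    ⟨_, Set.mem_singleton _⟩ ⟨_, ⟨x, hx⟩, hi, rfl⟩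
  · rintro (_ | i)
    · exact isClosed_singleton
    · exact ((hF.isClosedEmbedding_subtypeVal.isCompact_preimage (hC i)).image
        OnePoint.continuous_coe).isClosed
  · rintro (_ | i) (_ | j) hij
    · exact absurd rfl hij
    · rw [Set.disjoint_left]
      rintro _ rfl ⟨y, -, h⟩
      exact OnePoint.coe_ne_infty _ h
    · rw [Set.disjoint_left]
      rintro _ ⟨y, -, rfl⟩ h
      exact OnePoint.coe_ne_infty _ h
    · rw [Set.disjoint_left]
      rintro _ ⟨y, hy, rfl⟩ ⟨y', hy', h⟩
      rw [OnePoint.coe_injective h] at hy'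
      exact Set.disjoint_left.1 (hd fun h => hij (by rw [h])) hy hy'
  · intro y
    induction y using OnePoint.rec with
    | infty => exact ⟨none, rfl⟩
    | coe y =>
      obtain ⟨i, hi⟩ := hFC y y.2
      exact ⟨some i, y, hi, rfl⟩

namespace Config

open Grain

variable {d : ℕ} {ψ : Config d}

lemma countable_carrier (ψ : Config d) : ψ.carrier.Countable := by
  have : ψ.carrier = ⋃ n : ℕ, {u ∈ ψ.carrier | u.pos ∈ Metric.ball (0 : Space d) n} := by
    ext u
    simp only [Set.mem_iUnion, Set.mem_ofPred_eq, exists_and_left]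
    refine ⟨fun h => ⟨h, ?_⟩, fun h => h.1⟩
    obtain ⟨n, hn⟩ := exists_nat_gt ‖u.pos‖
    exact ⟨n, by simpa using hn⟩
  rw [this]
  exact Set.countable_iUnion fun n => (ψ.locallyFinite _ Metric.isBounded_ball).countable

lemma not_percolates {R : ψ.carrier → ℝ≥0} (hR : IsGrowthMaximal R)
    (hfin : ∀ c : Cluster R, c.supp.Finite) : ¬ Percolates R := by
  rintro ⟨F, hFZ, hF, hFc, hb⟩
  apply hb
  have : Countable ψ.carrier := ψ.countable_carrier.to_subtype
  have : Countable (Cluster R) :=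
    Function.Surjective.countable (f := (contactGraph R).connectedComponentMk) Quot.mk_surjective
  refine isBounded_of_countable_cover hF hFc
    (C := fun c : Cluster R => ⋃ u ∈ c.supp, fullGrain R u.1) ?_ ?_ ?_
  · exact fun c => (hfin c).isCompact_biUnion fun u _ => isCompact_grown _ _
  · intro c c' hc
    rw [Set.disjoint_left]
    intro z hz hz'
    simp only [Set.mem_iUnion] at hz hz'
    obtain ⟨u, hu, hzu⟩ := hz
    obtain ⟨v, hv, hzv⟩ := hz'
    apply hc
    rw [← hu, ← hv]
    by_cases huv : u = v
    · rw [huv]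
    · have hadj : (contactGraph R).Adj u v := ⟨huv, z, hzu, hzv⟩
      exact SimpleGraph.ConnectedComponent.sound hadj.reachable
  · intro x hx
    obtain ⟨u, hu⟩ := Set.mem_iUnion.1 (hFZ hx)
    -- Clusters contain only grains with positive growth times. A grain that did not grow is a point
    -- covered by its earlier neighbour, so nothing is lost.
    obtain ⟨v, hv0, hxv⟩ : ∃ v, 0 < R v ∧ x ∈ fullGrain R v := by
      rcases eq_or_lt_of_le (zero_le : 0 ≤ R u) with h0 | h0
      · obtain ⟨v, -, hv0, ⟨-, h, -⟩ | ⟨h, -⟩⟩ := hR.2 u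
        · refine ⟨v, hv0, ?_⟩
          rw [fullGrain, ← h0, NNReal.coe_zero, grown_zero] at hu
          rwa [Set.mem_singleton_iff.1 hu]
        · exact absurd h0 h.ne
      · exact ⟨u, h0, hu⟩
    exact ⟨(contactGraph R).connectedComponentMk ⟨v, hv0⟩,
      Set.mem_biUnion (x := ⟨v, hv0⟩) rfl hxv⟩

end Config

end

/-! ### Measurability -/

noncomputable section

open ProbabilityTheory

/-- Inherited from the nonempty compact sets with the Hausdorff metric. It makes closed sets in
products of grain spaces measurable for the product σ-field. -/
instance ConvexBody.instSecondCountableTopology (d : ℕ) :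
    SecondCountableTopology (ConvexBody (Space d)) := by
  let f : ConvexBody (Space d) → TopologicalSpace.NonemptyCompacts (Space d) := fun K =>
    ⟨⟨K, K.isCompact⟩, K.nonempty⟩
  have hf : Isometry f := fun K L => ConvexBody.hausdorffEDist_coe (K := K) (L := L)
  exact hf.isUniformInducing.isInducing.secondCountableTopology

instance Shape.instSecondCountableTopology (d : ℕ) : SecondCountableTopology (Shape d) :=
  inferInstanceAs (SecondCountableTopology
    {K : ConvexBody (Space d) // (0 : Space d) ∈ interior (K : Set (Space d))})

namespace Grain

variable {d : ℕ}

lemma measurable_pos : Measurable (Grain.pos (d := d)) := measurable_fst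

lemma measurable_birth : Measurable (Grain.birth (d := d)) := measurable_fst.comp measurable_snd

lemma measurableSet_touch :
    MeasurableSet {p : (Grain d × ℝ≥0) × (Grain d × ℝ≥0) | Touch p.1.1 p.1.2 p.2.1 p.2.2} :=
  isClosed_touch.measurableSet

lemma _root_.MeasurableSet.touch {α : Type*} [MeasurableSpace α] {u v : α → Grain d}
    {r s : α → ℝ≥0} (hu : Measurable u) (hr : Measurable r) (hv : Measurable v)
    (hs : Measurable s) : MeasurableSet {a | Touch (u a) (r a) (v a) (s a)} :=
  ((hu.prodMk hr).prodMk (hv.prodMk hs)) measurableSet_touch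

lemma _root_.Measurable.hit {α : Type*} [MeasurableSpace α] {u v : α → Grain d} {r : α → ℝ≥0}
    (hu : Measurable u) (hv : Measurable v) (hr : Measurable r) :
    Measurable fun a => hit (u a) (v a) (r a) := by
  refine measurable_of_Iic fun q => ?_
  have : (fun a => Grain.hit (u a) (v a) (r a)) ⁻¹' Set.Iic q =
      {a | Touch (u a) q (v a) (r a)} := by
    ext a; exact hit_le_iff
  rw [this]
  exact MeasurableSet.touch hu measurable_const hv hr

lemma measurable_rad (θ : ℝ) : Measurable (rad (d := d) θ) := by
  have := measurable_birth (d := d)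
  unfold rad
  fun_prop

lemma measurableSet_touchAt (θ : ℝ) : MeasurableSet {p : Grain d × Grain d | TouchAt θ p.1 p.2} :=
  MeasurableSet.touch measurable_fst ((measurable_rad θ).comp measurable_fst) measurable_snd
    ((measurable_rad θ).comp measurable_snd)

lemma measurable_translate (x : Space d) : Measurable (Grain.translate x) :=
  (measurable_fst.const_add x).prodMk measurable_snd

end Grain

namespace Config

open Grain

variable {d : ℕ} {ψ : Config d}

lemma measurable_encard_inter {C : Set (Grain d)} (hC : MeasurableSet C) (g : ℕ∞ → ℝ≥0∞) :
    Measurable fun ψ : Config d => g (ψ.carrier ∩ C).encard := by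
  have h1 : Measurable[MeasurableSpace.comap (fun ψ : Config d => (ψ.carrier ∩ C).encard) ⊤]
      fun ψ : Config d => g (ψ.carrier ∩ C).encard := by
    intro s _
    exact ⟨g ⁻¹' s, trivial, rfl⟩
  exact h1.mono (le_iSup (fun C : {C : Set (Grain d) // MeasurableSet C} =>
    MeasurableSpace.comap (fun ψ : Config d => (ψ.carrier ∩ C.1).encard) ⊤) ⟨C, hC⟩) le_rfl

lemma measurable_of_encard {α : Type*} [MeasurableSpace α] {f : α → Config d}
    (h : ∀ C : Set (Grain d), MeasurableSet C → Measurable fun a =>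
      (((f a).carrier ∩ C).encard : ℝ≥0∞)) : Measurable f := by
  have : MeasurableSpace.comap f (Config.instMeasurableSpace d) ≤ ‹MeasurableSpace α› := by
    rw [Config.instMeasurableSpace, MeasurableSpace.comap_iSup]
    refine iSup_le fun C => ?_
    rw [MeasurableSpace.comap_comp]
    rintro _ ⟨s, -, rfl⟩
    -- The σ-field on `ℕ∞` is the full one; every image in `ℝ≥0∞` is countable, hence measurable.
    have e : ((fun ψ : Config d => (ψ.carrier ∩ C.1).encard) ∘ f) ⁻¹' s =
        (fun a => (((f a).carrier ∩ C.1).encard : ℝ≥0∞)) ⁻¹' (ENat.toENNReal '' s) := by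
      ext a
      simp [Set.mem_image]
    rw [e]
    exact h C.1 C.2 ((Set.countable_univ.mono (Set.subset_univ s)).image _).measurableSet
  exact measurable_iff_comap_le.2 this

/-- The counting measure on the points of a configuration. -/
def points (ψ : Config d) : Measure (Grain d) := Measure.count.restrict ψ.carrier

lemma points_apply {C : Set (Grain d)} (hC : MeasurableSet C) (ψ : Config d) :
    points ψ C = (ψ.carrier ∩ C).encard := by
  rw [points, Measure.restrict_apply hC, Measure.count_apply
    (hC.inter ψ.countable_carrier.measurableSet), Set.inter_comm]

lemma lintegral_points (ψ : Config d) (h : Grain d → ℝ≥0∞) :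
    ∫⁻ u, h u ∂points ψ = ∑' u : ψ.carrier, h u := by
  rw [points, lintegral_countable _ ψ.countable_carrier]
  simp

lemma measurable_points : Measurable (points (d := d)) := by
  refine Measure.measurable_of_measurable_coe _ fun C hC => ?_
  simp_rw [points_apply hC]
  exact measurable_encard_inter hC _

/-- The counting measures on the points as a kernel. -/
def pointsKernel (d : ℕ) : Kernel (Config d) (Grain d) := ⟨points, measurable_points⟩

/-- The grains with positions in a spherical shell. -/
def shell (d n : ℕ) : Set (Grain d) := {u | ⌊‖u.pos‖⌋₊ = n}

lemma measurableSet_shell (n : ℕ) : MeasurableSet (shell d n) :=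
  (Nat.measurable_floor.comp measurable_pos.norm) (measurableSet_singleton n)

lemma points_shell_lt_top (ψ : Config d) (n : ℕ) : ∃ m : ℕ, points ψ (shell d n) = m := by
  have hfin : (ψ.carrier ∩ shell d n).Finite := by
    refine (ψ.locallyFinite _ (Metric.isBounded_ball (x := 0) (r := n + 1))).subset ?_
    rintro u ⟨hu, hn⟩
    refine ⟨hu, ?_⟩
    have hn' : ⌊‖u.pos‖⌋₊ = n := hn
    rw [mem_ball_zero_iff, ← hn']
    exact Nat.lt_floor_add_one _
  refine ⟨hfin.toFinset.card, ?_⟩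
  rw [points_apply (measurableSet_shell n), hfin.encard_eq_coe_toFinset_card]
  rfl

instance instIsSFiniteKernelPointsKernel : IsSFiniteKernel (pointsKernel d) := by
  classical
  have hms : ∀ n m : ℕ, MeasurableSet {ψ : Config d | points ψ (shell d n) = m} := fun n m =>
    ((Measure.measurable_coe (measurableSet_shell n)).comp measurable_points)
      (measurableSet_singleton _)
  -- The number of points in a shell is finite but not bounded over all configurations; splitting
  -- also by its value `m` gives finite kernels.
  let κ : ℕ × ℕ → Kernel (Config d) (Grain d) := fun p =>
    Kernel.piecewise (hms p.1 p.2) ((pointsKernel d).restrict (measurableSet_shell p.1)) 0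
  have hκ : ∀ p, IsFiniteKernel (κ p) := by
    intro p
    refine ⟨⟨p.2, ENNReal.natCast_lt_top _, fun ψ => ?_⟩⟩
    rw [Kernel.piecewise_apply]
    split_ifs with h
    · rw [Kernel.restrict_apply, Measure.restrict_apply_univ]
      exact le_of_eq h
    · simp
  have hsum : pointsKernel d = Kernel.sum κ := by
    ext ψ C hC
    rw [Kernel.sum_apply' _ _ hC, show ∑' p, κ p ψ C = ∑' n, ∑' m, κ (n, m) ψ C from
      ENNReal.tsum_prod (f := fun n m => κ (n, m) ψ C)]
    have h1 : ∀ n, ∑' m, κ (n, m) ψ C = points ψ (C ∩ shell d n) := by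
      intro n
      obtain ⟨m, hm⟩ := points_shell_lt_top ψ n
      rw [tsum_eq_single m]
      · rw [Kernel.piecewise_apply, if_pos (by exact hm), Kernel.restrict_apply, Measure.restrict_apply hC]
        rfl
      · intro m' hm'
        rw [Kernel.piecewise_apply, if_neg]
        · simp
        · intro h
          exact hm' (by exact_mod_cast (h.symm.trans hm : (m' : ℝ≥0∞) = m))
    simp_rw [h1]
    rw [← measure_iUnion]
    · rw [← Set.inter_iUnion]
      have : ⋃ n, shell d n = Set.univ := by
        ext u; simp [shell]
      rw [this, Set.inter_univ]; rfl
    · intro i j hij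
      rw [Function.onFun, Set.disjoint_left]
      rintro u ⟨-, h1⟩ ⟨-, h2⟩
      have h1' : ⌊‖u.pos‖⌋₊ = i := h1
      have h2' : ⌊‖u.pos‖⌋₊ = j := h2
      exact hij (h1'.symm.trans h2')
    · exact fun n => hC.inter (measurableSet_shell n)
  rw [hsum]
  exact Kernel.isSFiniteKernel_sum

lemma _root_.Measurable.lintegral_points {α : Type*} [MeasurableSpace α] {ψ : α → Config d}
    (hψ : Measurable ψ) {h : α → Grain d → ℝ≥0∞} (hh : Measurable (Function.uncurry h)) :
    Measurable fun a => ∫⁻ u, h a u ∂points (ψ a) :=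
  Measurable.lintegral_kernel_prod_right (κ := (pointsKernel d).comap ψ hψ) hh

/-- A point with the property exists exactly if the number of such points, a measurable kernel
integral, is not zero. This replaces a measurable enumeration of the points. -/
lemma measurableSet_exists_mem {α : Type*} [MeasurableSpace α] {ψ : α → Config d}
    (hψ : Measurable ψ) {S : Set (α × Grain d)} (hS : MeasurableSet S) :
    MeasurableSet {a | ∃ u ∈ (ψ a).carrier, (a, u) ∈ S} := by
  have h1 : Measurable fun a => ∫⁻ u, S.indicator 1 (a, u) ∂points (ψ a) :=
    hψ.lintegral_points (h := fun a u => S.indicator 1 (a, u)) (measurable_one.indicator hS)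
  have h2 : {a | ∃ u ∈ (ψ a).carrier, (a, u) ∈ S} =
      {a | ∫⁻ u, S.indicator (1 : α × Grain d → ℝ≥0∞) (a, u) ∂points (ψ a) = 0}ᶜ := by
    ext a
    simp only [Set.mem_ofPred_eq, Set.mem_compl_iff, Config.lintegral_points, ENNReal.tsum_eq_zero,
      Set.indicator_apply_eq_zero, Pi.one_apply, one_ne_zero, imp_false]
    push Not
    simp
  rw [h2]
  exact (h1 (measurableSet_singleton 0)).compl

/-- Contact is monotone in the radius of the blocker, so the quantifier over `s` can be replaced by
the largest admissible radius `m`. The subtraction is truncated, but `0 < m p` ensures that the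
blocker is born in time. -/
lemma measurableSet_blockedBy {f : Config d → Grain d → ℝ≥0∞}
    (hf : Measurable (Function.uncurry f)) (q : ℝ≥0) :
    MeasurableSet {p : (Config d × Grain d) × Grain d | BlockedBy (f p.1.1) p.1.2 q p.2} := by
  let m : (Config d × Grain d) × Grain d → ℝ≥0 := fun p =>
    (min (f p.1.1 p.2) ((p.1.2.birth + q - p.2.birth : ℝ≥0) : ℝ≥0∞)).toNNReal
  have hmc : ∀ p, (m p : ℝ≥0∞) = min (f p.1.1 p.2) ((p.1.2.birth + q - p.2.birth : ℝ≥0) : ℝ≥0∞) :=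
    fun p => ENNReal.coe_toNNReal (ne_top_of_le_ne_top ENNReal.coe_ne_top (min_le_right _ _))
  have h1 : Measurable fun p : (Config d × Grain d) × Grain d => p.1.2 := by fun_prop
  have h2 : Measurable fun p : (Config d × Grain d) × Grain d => p.2 := by fun_prop
  have hb := measurable_birth (d := d)
  have hm : Measurable m := by
    refine Measurable.ennreal_toNNReal (Measurable.min ?_ ?_)
    · exact hf.comp ((measurable_fst.comp measurable_fst).prodMk h2)
    · exact (((hb.comp h1).add_const q).sub (hb.comp h2)).coe_nnreal_ennreal
  have e : {p : (Config d × Grain d) × Grain d | BlockedBy (f p.1.1) p.1.2 q p.2} =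
      {p | p.2.pos = p.1.2.pos}ᶜ ∩ ({p | 0 < m p} ∩ {p | Touch p.1.2 q p.2 (m p)}) := by
    ext p
    simp only [BlockedBy, Set.mem_ofPred_eq, Set.mem_inter_iff, Set.mem_compl_iff]
    refine and_congr_right fun _ => ⟨?_, ?_⟩
    · rintro ⟨s, hs0, hsf, hst, ht⟩
      have hsm : s ≤ m p := by
        rw [← ENNReal.coe_le_coe, hmc]
        exact le_min hsf (ENNReal.coe_le_coe.2 (le_tsub_of_add_le_left hst))
      exact ⟨hs0.trans_le hsm, ht.mono le_rfl hsm⟩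
    · rintro ⟨h0, ht⟩
      have hle : m p ≤ p.1.2.birth + q - p.2.birth := by
        rw [← ENNReal.coe_le_coe, hmc]; exact min_le_right _ _
      refine ⟨m p, h0, hmc p ▸ min_le_left _ _, ?_, ht⟩
      have h3 : p.2.birth ≤ p.1.2.birth + q := by
        by_contra hlt
        rw [tsub_eq_zero_of_le (not_le.1 hlt).le] at hle
        exact absurd h0 (not_lt.2 hle)
      calc p.2.birth + m p ≤ p.2.birth + (p.1.2.birth + q - p.2.birth) := by gcongr
        _ = _ := add_tsub_cancel_of_le h3
  rw [e]
  refine (measurableSet_eq_fun (measurable_pos.comp h2) (measurable_pos.comp h1)).compl.inter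
    ((measurableSet_lt measurable_const hm).inter (MeasurableSet.touch h1 measurable_const h2 hm))

lemma measurable_stopTime {f : Config d → Grain d → ℝ≥0∞}
    (hf : Measurable (Function.uncurry f)) :
    Measurable (Function.uncurry fun ψ u => stopTime ψ (f ψ) u) := by
  have hb : ∀ q : ℝ≥0, MeasurableSet {p : Config d × Grain d | Blocked p.1 (f p.1) p.2 q} := fun q =>
    measurableSet_exists_mem measurable_fst (measurableSet_blockedBy hf q)
  obtain ⟨D, hDc, hDd⟩ := TopologicalSpace.exists_countable_dense ℝ≥0
  classical
  -- Blocking is monotone in the radius, so the infimum may be taken over a countable dense set of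
  -- radii.
  have e : (Function.uncurry fun ψ u => stopTime ψ (f ψ) u) = fun p : Config d × Grain d =>
      ⨅ q ∈ D, if Blocked p.1 (f p.1) p.2 q then (q : ℝ≥0∞) else ⊤ := by
    ext ⟨ψ, u⟩
    refine le_antisymm (le_iInf₂ fun q _ => ?_) ?_
    · split_ifs with h
      · exact stopTime_le h
      · exact le_top
    · refine le_of_forall_gt_imp_ge_of_dense fun c hc => ?_
      obtain ⟨r, hr, hrc⟩ := stopTime_lt_iff.1 hc
      obtain ⟨r', hr1, hr2⟩ := ENNReal.lt_iff_exists_nnreal_btwn.1 hrc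
      obtain ⟨q, hq, hqD⟩ := hDd.exists_between (ENNReal.coe_lt_coe.1 hr1)
      refine (iInf₂_le q hq).trans ?_
      rw [if_pos (hr.mono le_rfl hqD.1.le)]
      exact (ENNReal.coe_le_coe.2 hqD.2.le).trans hr2.le
  rw [e]
  exact Measurable.biInf D hDc fun q _ => Measurable.ite (hb q) measurable_const measurable_const

lemma measurable_iter (n : ℕ) : Measurable (Function.uncurry fun ψ : Config d => iter ψ n) := by
  induction n with
  | zero => exact measurable_const
  | succ n ih => exact measurable_stopTime ih

lemma measurable_growth : Measurable (Function.uncurry (growth (d := d))) :=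
  Measurable.iSup fun n => measurable_iter (2 * n)

lemma measurable_gt : Measurable (Function.uncurry (gt (d := d))) :=
  measurable_growth.ennreal_toNNReal

lemma _root_.Measurable.gt {α : Type*} [MeasurableSpace α] {ψ : α → Config d} {u : α → Grain d}
    (hψ : Measurable ψ) (hu : Measurable u) : Measurable fun a => gt (ψ a) (u a) :=
  measurable_gt.comp (hψ.prodMk hu)

lemma measurableSet_early :
    MeasurableSet {p : (Config d × Grain d) × Grain d | Early p.1.1 p.1.2 p.2} := by
  have h0 : Measurable fun p : (Config d × Grain d) × Grain d => p.1.1 := by fun_prop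
  have h1 : Measurable fun p : (Config d × Grain d) × Grain d => p.1.2 := by fun_prop
  have h2 : Measurable fun p : (Config d × Grain d) × Grain d => p.2 := by fun_prop
  have hb := measurable_birth (d := d)
  exact (measurableSet_eq_fun (measurable_pos.comp h1) (measurable_pos.comp h2)).compl.inter
    ((measurableSet_lt measurable_const (h0.gt h1)).inter
    ((measurableSet_lt measurable_const (h0.gt h2)).inter
    ((measurableSet_le ((hb.comp h2).add (h0.gt h2)) ((hb.comp h1).add (h0.gt h1))).inter
    (MeasurableSet.touch h1 (h0.gt h1) h2 (h0.gt h2)))))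

lemma measurableSet_tie : MeasurableSet {p : Config d × Grain d | Tie p.1 p.2} := by
  have h0 : Measurable fun p : (Config d × Grain d) × Grain d => p.1.1 := by fun_prop
  have h1 : Measurable fun p : (Config d × Grain d) × Grain d => p.1.2 := by fun_prop
  have h2 : Measurable fun p : (Config d × Grain d) × Grain d => p.2 := by fun_prop
  have hb := measurable_birth (d := d)
  exact measurableSet_exists_mem measurable_fst (measurableSet_early.inter
    (measurableSet_eq_fun ((hb.comp h2).add (h0.gt h2)) ((hb.comp h1).add (h0.gt h1))))

/-- Chains of `n` earlier neighbours. -/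
def DescN (ψ : Config d) : ℕ → Grain d → Grain d → Prop
  | 0, u, ρ => u = ρ
  | n + 1, u, ρ => ∃ v ∈ ψ.carrier, Early ψ u v ∧ DescN ψ n v ρ

lemma desc_iff {u ρ : Grain d} : Desc ψ u ρ ↔ ∃ n, DescN ψ n u ρ := by
  constructor
  · intro h
    induction h using Relation.ReflTransGen.head_induction_on with
    | refl => exact ⟨0, rfl⟩
    | head h _ ih =>
      obtain ⟨n, hn⟩ := ih
      exact ⟨n + 1, _, h.1, h.2, hn⟩
  · rintro ⟨n, hn⟩
    induction n generalizing u with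
    | zero => exact hn ▸ Relation.ReflTransGen.refl
    | succ n ih =>
      obtain ⟨v, hv, huv, h⟩ := hn
      exact Relation.ReflTransGen.head ⟨hv, huv⟩ (ih h)

lemma measurableSet_desc :
    MeasurableSet {p : (Config d × Grain d) × Grain d | Desc p.1.1 p.1.2 p.2} := by
  simp_rw [desc_iff]
  have : {p : (Config d × Grain d) × Grain d | ∃ n, DescN p.1.1 n p.1.2 p.2} =
      ⋃ n, {p | DescN p.1.1 n p.1.2 p.2} := by ext; simp
  rw [this]
  refine MeasurableSet.iUnion fun n => ?_
  induction n with
  | zero =>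
    exact measurableSet_eq_fun (f := fun p : (Config d × Grain d) × Grain d => p.1.2)
      (g := fun p => p.2) (by fun_prop) (by fun_prop)
  | succ n ih =>
    have h1 : Measurable fun q : ((Config d × Grain d) × Grain d) × Grain d => (q.1.1, q.2) := by
      fun_prop
    have h2 : Measurable fun q : ((Config d × Grain d) × Grain d) × Grain d =>
        ((q.1.1.1, q.2), q.1.2) := by fun_prop
    have h3 : Measurable fun q : (Config d × Grain d) × Grain d => q.1.1 := by fun_prop
    exact measurableSet_exists_mem h3 ((h1 measurableSet_early).inter (h2 ih))

lemma measurableSet_roots :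
    MeasurableSet {p : (Config d × Grain d) × Grain d | p.2 ∈ roots p.1.1 p.1.2} :=
  measurableSet_desc.inter
    ((by fun_prop : Measurable fun q : (Config d × Grain d) × Grain d => (q.1.1, q.2))
      measurableSet_tie)

end Config

end

/-! ### Tuples of points and moment bounds -/

noncomputable section

open ProbabilityTheory

lemma measurable_finCons {α β : Type*} [MeasurableSpace α] [MeasurableSpace β] {k : ℕ}
    {f : α → β} {g : α → Fin k → β} (hf : Measurable f) (hg : Measurable g) :
    Measurable fun a => (Fin.cons (f a) (g a) : Fin (k + 1) → β) := by
  refine measurable_pi_iff.2 fun i => ?_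
  induction i using Fin.cases with
  | zero => exact hf
  | succ i => exact (measurable_pi_apply i).comp hg

lemma pi_succ_apply {α : Type*} [MeasurableSpace α] (μ : Measure α) [SigmaFinite μ] {k : ℕ}
    {S : Set (Fin (k + 1) → α)} (hS : MeasurableSet S) :
    Measure.pi (fun _ : Fin (k + 1) => μ) S =
      ∫⁻ w, Measure.pi (fun _ : Fin k => μ) {v | (Fin.cons w v : Fin (k + 1) → α) ∈ S} ∂μ := by
  have h := (measurePreserving_piFinSuccAbove (fun _ : Fin (k + 1) => μ) 0).symm
  rw [← h.measure_preimage_equiv, Measure.prod_apply ((MeasurableEquiv.measurable _) hS)]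
  refine lintegral_congr fun w => congrArg _ ?_
  ext v
  simp only [MeasurableEquiv.piFinSuccAbove, Set.mem_preimage, MeasurableEquiv.symm_mk,
    MeasurableEquiv.coe_mk, Fin.insertNthEquiv_zero, Equiv.symm_symm, Set.mem_ofPred_eq]
  rfl

lemma pi_succ_apply_symm {α : Type*} [MeasurableSpace α] (μ : Measure α) [SigmaFinite μ] {k : ℕ}
    {S : Set (Fin (k + 1) → α)} (hS : MeasurableSet S) :
    Measure.pi (fun _ : Fin (k + 1) => μ) S =
      ∫⁻ v, μ {w | (Fin.cons w v : Fin (k + 1) → α) ∈ S} ∂Measure.pi (fun _ : Fin k => μ) := by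
  have h := (measurePreserving_piFinSuccAbove (fun _ : Fin (k + 1) => μ) 0).symm
  rw [← h.measure_preimage_equiv, Measure.prod_apply_symm ((MeasurableEquiv.measurable _) hS)]
  refine lintegral_congr fun w => congrArg _ ?_
  ext v
  simp only [MeasurableEquiv.piFinSuccAbove, Set.mem_preimage, MeasurableEquiv.symm_mk,
    MeasurableEquiv.coe_mk, Fin.insertNthEquiv_zero, Equiv.symm_symm, Set.mem_ofPred_eq]
  rfl

lemma measurableSet_injective {α : Type*} [MeasurableSpace α] [MeasurableEq α] (k : ℕ) :
    MeasurableSet {v : Fin k → α | Function.Injective v} := by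
  have : {v : Fin k → α | Function.Injective v} =
      ⋂ i, ⋂ j, {v | v i = v j}ᶜ ∪ {_v | i = j} := by
    ext v
    simp only [Function.Injective, Set.mem_ofPred_eq, Set.mem_iInter, Set.mem_union,
      Set.mem_compl_iff]
    exact forall_congr' fun i => forall_congr' fun j => imp_iff_not_or
  rw [this]
  exact MeasurableSet.iInter fun i => MeasurableSet.iInter fun j =>
    (measurableSet_eq_fun (measurable_pi_apply i) (measurable_pi_apply j)).compl.union
      (MeasurableSet.const _)

namespace Config

open Grain

variable {d : ℕ}

/-- The parameter space `α` is general because the induction moves the first point of the tuple into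
it. -/
lemma measurableSet_exists_tuple_param {k : ℕ} {α : Type*} [MeasurableSpace α] {ψ : α → Config d}
    (hψ : Measurable ψ) {S : Set (α × (Fin k → Grain d))} (hS : MeasurableSet S) :
    MeasurableSet {a | ∃ v : Fin k → Grain d, (∀ i, v i ∈ (ψ a).carrier) ∧ (a, v) ∈ S} := by
  induction k generalizing α with
  | zero =>
    have : {a | ∃ v : Fin 0 → Grain d, (∀ i, v i ∈ (ψ a).carrier) ∧ (a, v) ∈ S} =
        (fun a => (a, (Fin.elim0 : Fin 0 → Grain d))) ⁻¹' S := by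
      ext a
      constructor
      · rintro ⟨v, -, h⟩
        rwa [Subsingleton.elim v Fin.elim0] at h
      · exact fun h => ⟨Fin.elim0, fun i => i.elim0, h⟩
    rw [this]
    exact (measurable_id.prodMk measurable_const) hS
  | succ k ih =>
    have hm : Measurable fun p : (α × Grain d) × (Fin k → Grain d) =>
        (p.1.1, (Fin.cons p.1.2 p.2 : Fin (k + 1) → Grain d)) :=
      (measurable_fst.comp measurable_fst).prodMk
        (measurable_finCons (measurable_snd.comp measurable_fst) measurable_snd)
    have h1 := measurableSet_exists_mem hψ (ih (hψ.comp measurable_fst) (hm hS))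
    convert h1 using 1
    ext a
    constructor
    · rintro ⟨v, hv, h⟩
      refine ⟨v 0, hv 0, Fin.tail v, fun i => hv i.succ, ?_⟩
      show (a, Fin.cons (v 0) (Fin.tail v)) ∈ S
      rwa [Fin.cons_self_tail]
    · rintro ⟨u, hu, v, hv, h⟩
      exact ⟨Fin.cons u v, fun i => Fin.cases hu hv i, h⟩

/-- There are pairwise different points of `ψ` that form a tuple in `C`. -/
def HasTuple (ψ : Config d) {k : ℕ} (C : Set (Fin k → Grain d)) : Prop :=
  ∃ v : Fin k → Grain d, Function.Injective v ∧ (∀ i, v i ∈ ψ.carrier) ∧ v ∈ C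

lemma measurableSet_hasTuple {k : ℕ} {C : Set (Fin k → Grain d)} (hC : MeasurableSet C) :
    MeasurableSet {ψ : Config d | HasTuple ψ C} := by
  have h := measurableSet_exists_tuple_param (d := d) (ψ := id) measurable_id
    (S := {p : Config d × (Fin k → Grain d) | Function.Injective p.2 ∧ p.2 ∈ C})
    (measurable_snd ((measurableSet_injective k).inter hC))
  convert h using 1
  ext ψ
  constructor
  · rintro ⟨v, h1, h2, h3⟩; exact ⟨v, h2, h1, h3⟩
  · rintro ⟨v, h2, h1, h3⟩; exact ⟨v, h1, h2, h3⟩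

variable {Ω : Type*} [MeasurableSpace Ω] {P : Measure Ω} {Ψ : Ω → Config d}

lemma measure_hasTuple_le (hΨ : Measurable Ψ) {k : ℕ} {C : Set (Fin k → Grain d)}
    (hC : MeasurableSet C) : P {ω | HasTuple (Ψ ω) C} ≤ factorialMoment P Ψ k C := by
  have e : {ω | HasTuple (Ψ ω) C} = Ψ ⁻¹' {ψ | HasTuple ψ C} := rfl
  rw [e, ← lintegral_indicator_one (hΨ (measurableSet_hasTuple hC))]
  refine lintegral_mono fun ω => ?_
  by_cases h : HasTuple (Ψ ω) C
  · rw [Set.indicator_of_mem (by exact h), Pi.one_apply]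
    have h1 : (1 : ℕ∞) ≤ {v : Fin k → Grain d | Function.Injective v ∧
        (∀ i, v i ∈ (Ψ ω).carrier) ∧ v ∈ C}.encard := by
      rw [Set.one_le_encard_iff_nonempty]; exact h
    calc (1 : ℝ≥0∞) = ((1 : ℕ∞) : ℝ≥0∞) := by simp
      _ ≤ _ := ENat.toENNReal_le.2 h1
  · rw [Set.indicator_of_notMem (by exact h)]; exact zero_le

/-- The bound on the factorial moment measures. -/
def MomentBound (P : Measure Ω) (Ψ : Ω → Config d) (a : ℝ≥0) (μ : Measure (Grain d)) : Prop :=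
  ∀ k : ℕ, 1 ≤ k → ∀ C : Set (Fin k → Grain d), MeasurableSet C →
    factorialMoment P Ψ k C ≤ (a : ℝ≥0∞) ^ k * Measure.pi (fun _ : Fin k => μ) C

lemma MomentBound.measure_hasTuple_le {a : ℝ≥0} {μ : Measure (Grain d)}
    (h : MomentBound P Ψ a μ) (hΨ : Measurable Ψ) {k : ℕ} {C : Set (Fin (k + 1) → Grain d)}
    (hC : MeasurableSet C) :
    P {ω | HasTuple (Ψ ω) C} ≤ (a : ℝ≥0∞) ^ (k + 1) * Measure.pi (fun _ : Fin (k + 1) => μ) C :=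
  (Config.measure_hasTuple_le hΨ hC).trans (h _ (Nat.succ_pos k) C hC)

lemma MomentBound.ae_not_hasTuple {a : ℝ≥0} {μ : Measure (Grain d)}
    (h : MomentBound P Ψ a μ) (hΨ : Measurable Ψ) {k : ℕ} {C : Set (Fin (k + 1) → Grain d)}
    (hC : MeasurableSet C) (h0 : Measure.pi (fun _ : Fin (k + 1) => μ) C = 0) :
    ∀ᵐ ω ∂P, ¬ HasTuple (Ψ ω) C := by
  rw [ae_iff]
  simp only [not_not]
  exact le_antisymm ((h.measure_hasTuple_le hΨ hC).trans (by rw [h0, mul_zero])) zero_le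

end Config

/-- If a graph is locally finite and has no self-avoiding path of length `n` that starts in `u`,
then the component of `u` is finite. -/
lemma SimpleGraph.finite_reachable {V : Type*} (G : SimpleGraph V) (hG : ∀ u, {v | G.Adj u v}.Finite)
    (u : V) (n : ℕ) (hn : ∀ x : ℕ → V, x 0 = u → (∀ i < n, G.Adj (x i) (x (i + 1))) →
      ¬ Set.InjOn x {i | i ≤ n}) : {v | G.Reachable u v}.Finite := by
  have hball : ∀ m, {v | ∃ p : G.Walk u v, p.length ≤ m}.Finite := by
    intro m
    induction m with
    | zero =>
      refine (Set.finite_singleton u).subset ?_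
      rintro v ⟨p, hp⟩
      exact (SimpleGraph.Walk.eq_of_length_eq_zero (Nat.le_zero.1 hp)).symm
    | succ m ih =>
      refine (ih.union (ih.biUnion fun w _ => hG w)).subset ?_
      rintro v ⟨p, hp⟩
      rcases Nat.lt_or_ge p.length (m + 1) with h | h
      · exact Or.inl ⟨p, Nat.lt_succ_iff.1 h⟩
      · right
        refine Set.mem_biUnion (x := p.getVert m) ⟨p.take m, ?_⟩ ?_
        · rw [SimpleGraph.Walk.take_length]; exact min_le_left _ _
        · have h1 := p.adj_getVert_succ (i := m) (by omega)
          rwa [p.getVert_of_length_le (by omega : p.length ≤ m + 1)] at h1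
  refine (hball n).subset ?_
  rintro v ⟨p⟩
  classical
  refine ⟨p.bypass, ?_⟩
  by_contra hlt
  rw [not_le] at hlt
  refine hn p.bypass.getVert (SimpleGraph.Walk.getVert_zero _)
    (fun i hi => SimpleGraph.Walk.adj_getVert_succ _ (hi.trans hlt)) ?_
  exact (p.bypass_isPath.getVert_injOn).mono fun i (hi : i ≤ n) => hi.trans hlt.le

end

/-! ### Short time windows -/

noncomputable section

open ProbabilityTheory
open scoped Pointwise

namespace Shape

variable {d : ℕ}

/-- The radius of the smallest ball around the origin that contains the shape. -/
def size (K : Shape d) : ℝ := dist K.1 0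

lemma size_nonneg (K : Shape d) : 0 ≤ K.size := dist_nonneg

lemma measurable_size : Measurable (Shape.size (d := d)) := by
  have : Continuous (Shape.size (d := d)) := by unfold size; fun_prop
  exact this.measurable

lemma norm_le_size {K : Shape d} {k : Space d} (hk : k ∈ K.toSet) : ‖k‖ ≤ K.size := by
  have h := Metric.infDist_le_hausdorffDist_of_mem (t := ((0 : ConvexBody (Space d)) : Set (Space d)))
    hk (ConvexBody.hausdorffEDist_ne_top (K := K.1) (L := 0))
  rw [ConvexBody.coe_zero] at h
  have e : Metric.infDist k (0 : Set (Space d)) = ‖k‖ := by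
    rw [← Set.singleton_zero, Metric.infDist_singleton, dist_zero_right]
  rw [e] at h
  have h2 : Metric.hausdorffDist K.toSet (0 : Set (Space d)) = K.size := by
    rw [size, ← ConvexBody.hausdorffDist_coe, ConvexBody.coe_zero]; rfl
  rwa [h2] at h

lemma size_le {K : Shape d} {r : ℝ} (h0 : 0 ≤ r) (h : ∀ k ∈ K.toSet, ‖k‖ ≤ r) : K.size ≤ r := by
  rw [size, ← ConvexBody.hausdorffDist_coe, ConvexBody.coe_zero]
  refine Metric.hausdorffDist_le_of_mem_dist h0 (fun k hk => ⟨0, rfl, ?_⟩) fun x hx =>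
    ⟨0, K.zero_mem, ?_⟩
  · rw [dist_zero_right]; exact h k hk
  · have : x = 0 := hx
    rw [this, dist_self]; exact h0

lemma circumradius_nonneg (K : Shape d) : 0 ≤ K.circumradius := Real.sInf_nonneg fun _ hr => hr.1

/-- The origin lies in `K`, so it has distance at most `r` from the centre of a ball of radius `r`
around `K`, whence the factor 2. The summand 1 avoids attainment of the infimum. -/
lemma size_le_circumradius (K : Shape d) : K.size ≤ 2 * (K.circumradius + 1) := by
  have hne : {r : ℝ | 0 ≤ r ∧ ∃ c : Space d, K.toSet ⊆ Metric.closedBall c r}.Nonempty :=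
    ⟨K.size, K.size_nonneg, 0, fun k hk => by
      rw [mem_closedBall_zero_iff]; exact norm_le_size hk⟩
  obtain ⟨r, ⟨hr0, c, hc⟩, hr⟩ := exists_lt_of_csInf_lt hne
    (show K.circumradius < K.circumradius + 1 by linarith)
  have := K.circumradius_nonneg
  refine size_le (by linarith) fun k hk => ?_
  have h1 := hc hk
  have h2 := hc K.zero_mem
  rw [Metric.mem_closedBall] at h1 h2
  calc ‖k‖ = dist k 0 := (dist_zero_right k).symm
    _ ≤ dist k c + dist 0 c := dist_triangle_right _ _ _
    _ ≤ _ := by linarith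

end Shape

namespace Grain

variable {d : ℕ}

/-- Two freely growing grains meet in the time window `(τ, τ']`. -/
def Win (τ τ' : ℝ) (u v : Grain d) : Prop := TouchAt τ' u v ∧ ¬ TouchAt τ u v

lemma Win.mono {τ τ' σ σ' : ℝ} {u v : Grain d} (h : Win τ τ' u v) (h1 : σ ≤ τ) (h2 : τ' ≤ σ') :
    Win σ σ' u v := ⟨h.1.mono h2, fun h' => h.2 (h'.mono h1)⟩

lemma measurableSet_win (τ τ' : ℝ) : MeasurableSet {p : Grain d × Grain d | Win τ τ' p.1 p.2} :=
  (measurableSet_touchAt τ').inter (measurableSet_touchAt τ).compl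

lemma measurableSet_win_right (τ τ' : ℝ) (u : Grain d) : MeasurableSet {v | Win τ τ' u v} :=
  measurable_prodMk_left (measurableSet_win τ τ')

lemma touch_translate {x : Space d} {u v : Grain d} {r s : ℝ≥0} :
    Touch (translate x u) r (translate x v) s ↔ Touch u r v s := by
  have h : ∀ (u : Grain d) (r : ℝ), (translate x u).grown r = (fun z => x + z) '' u.grown r := by
    intro u r
    simp only [grown, Set.image_image, translate, pos, add_assoc]
    rfl
  rw [Touch, h, h, ← Set.image_inter (add_right_injective x), Set.image_nonempty, Touch]

lemma win_translate {τ τ' : ℝ} {x : Space d} {u v : Grain d} :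
    Win τ τ' (translate x u) (translate x v) ↔ Win τ τ' u v :=
  and_congr touch_translate (not_congr touch_translate)

lemma norm_sub_le_of_touch {u v : Grain d} {r s : ℝ≥0} (h : Touch u r v s) :
    ‖v.pos - u.pos‖ ≤ r * u.shape.size + s * v.shape.size := by
  obtain ⟨z, ⟨k, hk, rfl⟩, ⟨l, hl, h⟩⟩ := h
  have e : v.pos - u.pos = (r : ℝ) • k - (s : ℝ) • l := by
    have h' : v.pos + (s : ℝ) • l = u.pos + (r : ℝ) • k := h
    rw [sub_eq_sub_iff_add_eq_add, h']; abel
  rw [e]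
  refine (norm_sub_le _ _).trans ?_
  rw [norm_smul, norm_smul, Real.norm_of_nonneg (NNReal.coe_nonneg r),
    Real.norm_of_nonneg (NNReal.coe_nonneg s)]
  gcongr
  · exact Shape.norm_le_size hk
  · exact Shape.norm_le_size hl

lemma rad_le (θ : ℝ) (u : Grain d) : rad θ u ≤ θ.toNNReal :=
  Real.toNNReal_le_toNNReal (by have := u.birth.2; linarith [NNReal.coe_nonneg u.birth])

/-- The positions at which a grain touches a given convex set form a convex set. -/
lemma convex_touch (u : Grain d) (r : ℝ≥0) (m : ℝ≥0 × Shape d) (s : ℝ≥0) :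
    Convex ℝ {y : Space d | Touch u r (y, m) s} := by
  have h := ((u.convex_grown r).prod m.2.convex_toSet).is_linear_image
    (f := fun p : Space d × Space d => p.1 - (s : ℝ) • p.2)
    ⟨fun a b => by simp; abel, fun c a => by simp [smul_sub, smul_comm c]⟩
  have e : {y : Space d | Touch u r (y, m) s} =
      (fun p : Space d × Space d => p.1 - (s : ℝ) • p.2) '' (u.grown r ×ˢ m.2.toSet) := ?_
  · rw [e]; exact h
  ext y
  constructor
  · rintro ⟨z, hz, k, hk, rfl⟩
    refine ⟨(y + (s : ℝ) • k, k), ⟨hz, hk⟩, ?_⟩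
    simp
  · rintro ⟨⟨z, k⟩, ⟨hz, hk⟩, rfl⟩
    refine ⟨z, hz, k, hk, ?_⟩
    simp [pos]

end Grain

open Grain

variable {d : ℕ}

/-- The weight of a mark. -/
def weight (m : ℝ≥0 × Shape d) : ℝ≥0∞ := ENNReal.ofReal ((1 + m.2.size) ^ d)

lemma measurable_weight : Measurable (weight (d := d)) := by
  have := Shape.measurable_size (d := d)
  unfold weight; fun_prop

lemma one_le_weight (m : ℝ≥0 × Shape d) : 1 ≤ weight m := by
  rw [weight, ← ENNReal.ofReal_one]
  exact ENNReal.ofReal_le_ofReal (one_le_pow₀ (by linarith [m.2.size_nonneg]))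

lemma lintegral_weight_sq_lt_top {Q : Measure (ℝ≥0 × Shape d)} (hmom : ∫⁻ m, ENNReal.ofReal
      (((m.1 : ℝ) ^ (2 * d) + 1) * (m.2.circumradius ^ (2 * d) + 1)) ∂Q < ⊤) :
    ∫⁻ m, weight m * weight m ∂Q < ⊤ := by
  have hb : ∀ m : ℝ≥0 × Shape d, weight m * weight m ≤ ENNReal.ofReal (6 ^ (2 * d)) *
      ENNReal.ofReal (((m.1 : ℝ) ^ (2 * d) + 1) * (m.2.circumradius ^ (2 * d) + 1)) := by
    intro m
    have h0 := m.2.circumradius_nonneg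
    have h1 := m.2.size_nonneg
    have h2 := m.2.size_le_circumradius
    rw [weight, ← ENNReal.ofReal_mul (by positivity), ← ENNReal.ofReal_mul (by positivity)]
    refine ENNReal.ofReal_le_ofReal ?_
    set ρ := m.2.circumradius with hρ
    -- Here `1 + size ≤ 3 + 2 * ρ ≤ 5 * max ρ 1`, so 6 suffices.
    have h3 : (1 + m.2.size) ^ d * (1 + m.2.size) ^ d ≤ 6 ^ (2 * d) * (max ρ 1) ^ (2 * d) := by
      rw [← pow_add, ← two_mul, ← mul_pow]
      refine pow_le_pow_left₀ (by positivity) ?_ _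
      have := le_max_left ρ 1
      have := le_max_right ρ 1
      linarith
    have h4 : (max ρ 1) ^ (2 * d) ≤ ρ ^ (2 * d) + 1 := by
      rcases max_cases ρ 1 with ⟨h, -⟩ | ⟨h, -⟩ <;> rw [h]
      · linarith
      · rw [one_pow]; have := pow_nonneg h0 (2 * d); linarith
    have h5 : ρ ^ (2 * d) + 1 ≤ ((m.1 : ℝ) ^ (2 * d) + 1) * (ρ ^ (2 * d) + 1) := by
      refine le_mul_of_one_le_left (by positivity) ?_
      have : (0 : ℝ) ≤ (m.1 : ℝ) ^ (2 * d) := by positivity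
      linarith
    calc _ ≤ _ := h3
      _ ≤ 6 ^ (2 * d) * (ρ ^ (2 * d) + 1) := by gcongr
      _ ≤ _ := by gcongr
  refine (lintegral_mono hb).trans_lt ?_
  rw [lintegral_const_mul' _ _ ENNReal.ofReal_ne_top]
  exact ENNReal.mul_lt_top ENNReal.ofReal_lt_top hmom

/-- The volume of the set of relative positions for which two grains meet in a time window. -/
def winVol (τ τ' : ℝ) (m m' : ℝ≥0 × Shape d) : ℝ≥0∞ :=
  volume {z : Space d | Win τ τ' ((0 : Space d), m) (z, m')}

lemma measurable_winVol (τ τ' : ℝ) : Measurable (Function.uncurry (winVol (d := d) τ τ')) := by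
  have hm : Measurable fun q : ((ℝ≥0 × Shape d) × (ℝ≥0 × Shape d)) × Space d =>
      ((((0 : Space d), q.1.1) : Grain d), ((q.2, q.1.2) : Grain d)) := by fun_prop
  exact measurable_measure_prodMk_left (hm (measurableSet_win τ τ'))

lemma volume_win (τ τ' : ℝ) (u : Grain d) (m' : ℝ≥0 × Shape d) :
    volume {y : Space d | Win τ τ' u (y, m')} = winVol τ τ' u.2 m' := by
  rw [winVol, ← measure_preimage_add volume u.1 {y : Space d | Win τ τ' u (y, m')}]
  congr 1
  ext z
  have := win_translate (τ := τ) (τ' := τ') (x := u.1) (u := ((0 : Space d), u.2)) (v := (z, m'))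
  simp only [Grain.translate, add_zero] at this
  exact this

/-- The constant in the bound for `winVol`. -/
def winConst (d : ℕ) (T : ℝ) : ℝ≥0∞ :=
  ENNReal.ofReal ((T.toNNReal : ℝ) ^ d) * volume (Metric.ball (0 : Space d) 1)

lemma winConst_lt_top (d : ℕ) (T : ℝ) : winConst d T < ⊤ :=
  ENNReal.mul_lt_top ENNReal.ofReal_lt_top measure_ball_lt_top

/-- Contact by time `τ'` bounds the distance by `τ'` times the sum of the sizes. The sum is replaced
by a product of the factors `1 + size` so that the bound separates. -/
lemma winVol_le (τ τ' : ℝ) (m m' : ℝ≥0 × Shape d) :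
    winVol τ τ' m m' ≤ winConst d τ' * (weight m * weight m') := by
  have h1 := m.2.size_nonneg
  have h2 := m'.2.size_nonneg
  have hsub : {z : Space d | Win τ τ' ((0 : Space d), m) (z, m')} ⊆
      Metric.closedBall 0 (τ'.toNNReal * ((1 + m.2.size) * (1 + m'.2.size))) := by
    intro z hz
    rw [mem_closedBall_zero_iff]
    have h := norm_sub_le_of_touch hz.1
    have e : (Grain.pos (z, m') : Space d) - Grain.pos ((0 : Space d), m) = z := sub_zero z
    rw [e] at h
    refine h.trans ?_
    have r1 := NNReal.coe_le_coe.2 (rad_le τ' ((0 : Space d), m))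
    have r2 := NNReal.coe_le_coe.2 (rad_le τ' (z, m'))
    have hT : (0 : ℝ) ≤ τ'.toNNReal := NNReal.coe_nonneg _
    calc _ ≤ (τ'.toNNReal : ℝ) * m.2.size + τ'.toNNReal * m'.2.size :=
          add_le_add (mul_le_mul_of_nonneg_right r1 h1) (mul_le_mul_of_nonneg_right r2 h2)
      _ ≤ _ := by
          rw [← mul_add]
          refine mul_le_mul_of_nonneg_left ?_ hT
          nlinarith
  refine (measure_mono hsub).trans ?_
  rw [Measure.addHaar_closedBall _ _ (by positivity), finrank_euclideanSpace_fin, mul_pow, mul_pow,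
    ENNReal.ofReal_mul (by positivity), ENNReal.ofReal_mul (by positivity), winConst, weight, weight]
  exact le_of_eq (by ring)

lemma setLIntegral_win (Q : Measure (ℝ≥0 × Shape d)) [IsProbabilityMeasure Q] (τ τ' : ℝ)
    (u : Grain d) {h : ℝ≥0 × Shape d → ℝ≥0∞} (hh : Measurable h) :
    ∫⁻ v in {v : Grain d | Win τ τ' u v}, h v.2 ∂((volume : Measure (Space d)).prod Q) =
      ∫⁻ m', h m' * winVol τ τ' u.2 m' ∂Q := by
  have hm : Measurable ({v : Grain d | Win τ τ' u v}.indicator fun v : Grain d => h v.2) :=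
    (hh.comp measurable_snd).indicator (measurableSet_win_right τ τ' u)
  rw [← lintegral_indicator (measurableSet_win_right τ τ' u), lintegral_prod_symm _ hm.aemeasurable]
  refine lintegral_congr fun m' => ?_
  have hms : MeasurableSet {y : Space d | Win τ τ' u (y, m')} :=
    (by fun_prop : Measurable fun y : Space d => ((y, m') : Grain d))
      (measurableSet_win_right τ τ' u)
  rw [← volume_win, ← lintegral_indicator_const hms]
  rfl

/-- The weighted mean volume of the window. -/
def winMass (Q : Measure (ℝ≥0 × Shape d)) (τ τ' : ℝ) : ℝ≥0∞ :=
  ∫⁻ m, weight m * ∫⁻ m', weight m' * winVol τ τ' m m' ∂Q ∂Q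

/-- The first step is bounded crudely by the weights of both grains; the second keeps the small
window volume. Together the weights of the middle grain reproduce `winMass`, so only square
integrability of the weight is needed for smallness over two steps. -/
lemma two_step_le (Q : Measure (ℝ≥0 × Shape d)) [IsProbabilityMeasure Q] (τ τ' : ℝ)
    (u : Grain d) :
    ∫⁻ v in {v : Grain d | Win τ τ' u v}, ∫⁻ w in {w : Grain d | Win τ τ' v w}, weight w.2
      ∂((volume : Measure (Space d)).prod Q) ∂((volume : Measure (Space d)).prod Q) ≤
      winConst d τ' * winMass Q τ τ' * weight u.2 := by
  have hG : Measurable fun m => ∫⁻ m', weight m' * winVol τ τ' m m' ∂Q :=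
    Measurable.lintegral_prod_right ((measurable_weight.comp measurable_snd).mul
      (measurable_winVol τ τ'))
  simp_rw [setLIntegral_win Q τ τ' _ measurable_weight]
  rw [setLIntegral_win Q τ τ' u (h := fun m => ∫⁻ m', weight m' * winVol τ τ' m m' ∂Q) hG]
  calc _ ≤ ∫⁻ m, (winConst d τ' * weight u.2) *
        (weight m * ∫⁻ m', weight m' * winVol τ τ' m m' ∂Q) ∂Q := by
        refine lintegral_mono fun m => ?_
        calc _ ≤ (∫⁻ m', weight m' * winVol τ τ' m m' ∂Q) *
              (winConst d τ' * (weight u.2 * weight m)) := by gcongr; exact winVol_le _ _ _ _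
          _ = _ := by ring
    _ = _ := by
        have hm : Measurable fun m => weight m * ∫⁻ m', weight m' * winVol τ τ' m m' ∂Q :=
          measurable_weight.mul hG
        rw [lintegral_const_mul _ hm, winMass]; ring

/-- If `c⁻¹ • z` is still a contact position for some `c < 1`, scaling by `c` shows that contact at
`z` needs only radii `c * rad θ`, which are reached strictly before `θ`. -/
lemma not_win_of_mem_interior {θ : ℝ} {m m' : ℝ≥0 × Shape d} {z : Space d}
    (hz : z ∈ interior {z : Space d | TouchAt θ ((0 : Space d), m) (z, m')}) :
    ∃ σ < θ, ∀ τ, σ < τ → TouchAt τ ((0 : Space d), m) (z, m') := by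
  have hc : Filter.Tendsto (fun c : ℝ => c⁻¹ • z) (nhdsWithin 1 (Set.Iio 1)) (nhds z) := by
    have h : ContinuousAt (fun c : ℝ => c⁻¹ • z) 1 := by
      refine ContinuousAt.smul (continuousAt_inv₀ one_ne_zero) continuousAt_const
    have h := (h.tendsto).mono_left (nhdsWithin_le_nhds (s := Set.Iio 1))
    simpa using h
  have h1 := hc.eventually (isOpen_interior.mem_nhds hz)
  have h2 : ∀ᶠ c : ℝ in nhdsWithin 1 (Set.Iio 1), 0 < c :=
    (nhdsWithin_le_nhds (s := Set.Iio 1)) (lt_mem_nhds one_pos)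
  obtain ⟨c, ⟨hc, hc0⟩, hc1⟩ := ((h1.and h2).and self_mem_nhdsWithin).exists
  have hc1 : c < 1 := hc1
  obtain ⟨c', hc'⟩ : ∃ c' : ℝ≥0, (c' : ℝ) = c := ⟨⟨c, hc0.le⟩, rfl⟩
  set ρ := rad θ ((0 : Space d), m) with hρ
  set ρ' := rad θ (z, m') with hρ'
  obtain ⟨y, ⟨k, hk, hky⟩, ⟨l, hl, hly⟩⟩ := interior_subset hc
  have hkl : (ρ : ℝ) • k = c⁻¹ • z + (ρ' : ℝ) • l := by
    have h3 : (0 : Space d) + (ρ : ℝ) • k = c⁻¹ • z + (ρ' : ℝ) • l := hky.trans hly.symm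
    rwa [zero_add] at h3
  have hT : Touch ((0 : Space d), m) (c' * ρ) (z, m') (c' * ρ') := by
    refine ⟨(0 : Space d) + (c * ρ) • k, ⟨k, hk, ?_⟩, ⟨l, hl, ?_⟩⟩
    · rw [NNReal.coe_mul, hc']; rfl
    rw [NNReal.coe_mul, hc']
    show z + (c * (ρ' : ℝ)) • l = 0 + (c * (ρ : ℝ)) • k
    rw [mul_smul, mul_smul, hkl, smul_add, smul_inv_smul₀ hc0.ne', zero_add]
  have key : ∀ u : Grain d, ∃ σ < θ, ∀ τ, σ < τ → c' * rad θ u ≤ rad τ u := by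
    intro u
    rcases le_or_gt θ u.birth with h | h
    · refine ⟨θ - 1, by linarith, fun τ _ => ?_⟩
      rw [rad, Real.toNNReal_of_nonpos (by linarith), mul_zero]; exact zero_le
    · refine ⟨u.birth + c * (θ - u.birth), by nlinarith, fun τ hτ => ?_⟩
      rw [← NNReal.coe_le_coe, NNReal.coe_mul, hc', rad, Real.coe_toNNReal _ (by linarith)]
      refine le_trans ?_ (Real.le_coe_toNNReal _)
      linarith
  obtain ⟨σ, h1, h2⟩ := key ((0 : Space d), m)
  obtain ⟨σ', h1', h2'⟩ := key (z, m')
  exact ⟨max σ σ', max_lt h1 h1', fun τ hτ => hT.mono (h2 τ ((le_max_left _ _).trans_lt hτ))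
    (h2' τ ((le_max_right _ _).trans_lt hτ))⟩

lemma Grain.exists_window_of_forall {θ : ℝ} {u v : Grain d}
    (h : ∀ n : ℕ, Win (θ - 1 / ((n : ℝ) + 1)) (θ + 1 / ((n : ℝ) + 1)) u v) :
    TouchAt θ u v ∧ ∀ σ < θ, ¬ TouchAt σ u v := by
  have hlim0 : Filter.Tendsto (fun n : ℕ => (1 : ℝ) / (n + 1)) Filter.atTop (nhds 0) :=
    tendsto_one_div_add_atTop_nhds_zero_nat
  constructor
  · have hcl : IsClosed {τ : ℝ | TouchAt τ u v} :=
      (isClosed_touch_radii u v).preimage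
        (f := fun τ : ℝ => (rad τ u, rad τ v))
        ((continuous_rad u).prodMk (continuous_rad v))
    have hl : Filter.Tendsto (fun n : ℕ => θ + (1 : ℝ) / (n + 1)) Filter.atTop (nhds θ) := by
      simpa using hlim0.const_add θ
    exact hcl.mem_of_tendsto hl (Filter.Eventually.of_forall fun n => (h n).1)
  · intro σ hσ hT
    obtain ⟨n, hn⟩ := (hlim0.eventually (gt_mem_nhds (show 0 < θ - σ by linarith))).exists
    exact (h n).2 (hT.mono (by linarith))

/-- Relative positions in all windows have their first contact exactly at `θ`, so they lie on the
frontier of the convex set of contact positions, which is null. -/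
lemma volume_forall_win (θ : ℝ) (m m' : ℝ≥0 × Shape d) :
    volume (⋂ n : ℕ, {z : Space d | Win (θ - 1 / ((n : ℝ) + 1)) (θ + 1 / ((n : ℝ) + 1))
      ((0 : Space d), m) (z, m')}) = 0 := by
  have hDc : Convex ℝ {z : Space d | TouchAt θ ((0 : Space d), m) (z, m')} :=
    convex_touch ((0 : Space d), m) (rad θ ((0 : Space d), m)) m' (rad θ ((0 : Space d), m'))
  refine measure_mono_null ?_ (hDc.addHaar_frontier volume)
  intro z hz
  rw [Set.mem_iInter] at hz
  obtain ⟨h1, h2⟩ := exists_window_of_forall hz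
  refine ⟨subset_closure h1, fun hzi => ?_⟩
  obtain ⟨σ, hσ, h⟩ := not_win_of_mem_interior hzi
  exact h2 ((σ + θ) / 2) (by linarith) (h _ (by linarith))

lemma tendsto_winVol (θ : ℝ) (m m' : ℝ≥0 × Shape d) :
    Filter.Tendsto (fun n : ℕ => winVol (θ - 1 / ((n : ℝ) + 1)) (θ + 1 / ((n : ℝ) + 1)) m m')
      Filter.atTop (nhds 0) := by
  have hanti : Antitone fun n : ℕ => {z : Space d |
      Win (θ - 1 / ((n : ℝ) + 1)) (θ + 1 / ((n : ℝ) + 1)) ((0 : Space d), m) (z, m')} := by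
    intro i j hij z hz
    have : (1 : ℝ) / (j + 1) ≤ 1 / (i + 1) := by gcongr
    exact Win.mono hz (by linarith) (by linarith)
  have hms : ∀ n : ℕ, NullMeasurableSet {z : Space d |
      Win (θ - 1 / ((n : ℝ) + 1)) (θ + 1 / ((n : ℝ) + 1)) ((0 : Space d), m) (z, m')} volume := by
    intro n
    have hm : Measurable fun y : Space d => ((y, m') : Grain d) := by fun_prop
    exact (hm (measurableSet_win_right (θ - 1 / ((n : ℝ) + 1)) (θ + 1 / ((n : ℝ) + 1))
      ((0 : Space d), m))).nullMeasurableSet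
  have hfin : ∃ n : ℕ, volume {z : Space d |
      Win (θ - 1 / ((n : ℝ) + 1)) (θ + 1 / ((n : ℝ) + 1)) ((0 : Space d), m) (z, m')} ≠ ⊤ :=
    ⟨0, (lt_of_le_of_lt (winVol_le _ _ m m') (ENNReal.mul_lt_top (winConst_lt_top _ _)
      (ENNReal.mul_lt_top ENNReal.ofReal_lt_top ENNReal.ofReal_lt_top))).ne⟩
  have hlim := tendsto_measure_iInter_atTop hms hanti hfin
  rw [volume_forall_win] at hlim
  exact hlim

lemma winMass_mono (Q : Measure (ℝ≥0 × Shape d)) {τ τ' σ σ' : ℝ} (h1 : σ ≤ τ) (h2 : τ' ≤ σ') :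
    winMass Q τ τ' ≤ winMass Q σ σ' := by
  unfold winMass
  gcongr with m m'
  exact measure_mono fun z hz => Win.mono hz h1 h2

lemma weight_lt_top (m : ℝ≥0 × Shape d) : weight m < ⊤ := ENNReal.ofReal_lt_top

/-- The integrand of `winMass`. -/
def winDens (τ τ' : ℝ) (x : (ℝ≥0 × Shape d) × (ℝ≥0 × Shape d)) : ℝ≥0∞ :=
  weight x.1 * (weight x.2 * winVol τ τ' x.1 x.2)

lemma measurable_winDens (τ τ' : ℝ) : Measurable (winDens (d := d) τ τ') :=
  (measurable_weight.comp measurable_fst).mul ((measurable_weight.comp measurable_snd).mul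
    (measurable_winVol τ τ'))

lemma winMass_eq (Q : Measure (ℝ≥0 × Shape d)) [IsProbabilityMeasure Q] (τ τ' : ℝ) :
    winMass Q τ τ' = ∫⁻ x, winDens τ τ' x ∂Q.prod Q := by
  rw [lintegral_prod _ (measurable_winDens τ τ').aemeasurable, winMass]
  refine lintegral_congr fun m => ?_
  have h1 : Measurable fun m' => winVol τ τ' m m' := (measurable_winVol τ τ').of_uncurry_left
  have h2 : Measurable fun m' => weight m' * winVol τ τ' m m' := measurable_weight.mul h1
  rw [← lintegral_const_mul (weight m) h2]
  rfl

lemma winDens_le (τ τ' T : ℝ) (h : τ' ≤ T) (x : (ℝ≥0 × Shape d) × (ℝ≥0 × Shape d)) :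
    winDens τ τ' x ≤
      winConst d T * ((weight x.1 * weight x.1) * (weight x.2 * weight x.2)) := by
  have h1 : winVol τ τ' x.1 x.2 ≤ winVol τ T x.1 x.2 :=
    measure_mono fun z hz => Win.mono hz le_rfl h
  rw [winDens]
  calc _ ≤ weight x.1 * (weight x.2 * (winConst d T * (weight x.1 * weight x.2))) := by
        gcongr; exact h1.trans (winVol_le _ _ _ _)
    _ = _ := by ring

lemma tendsto_winDens (θ : ℝ) (x : (ℝ≥0 × Shape d) × (ℝ≥0 × Shape d)) :
    Filter.Tendsto (fun n : ℕ => winDens (θ - 1 / ((n : ℝ) + 1)) (θ + 1 / ((n : ℝ) + 1)) x)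
      Filter.atTop (nhds 0) := by
  have h := tendsto_winVol θ x.1 x.2
  have h1 := ENNReal.Tendsto.const_mul (a := weight x.2) h (Or.inr (weight_lt_top x.2).ne)
  have h2 := ENNReal.Tendsto.const_mul (a := weight x.1) h1 (Or.inr (weight_lt_top x.1).ne)
  rw [mul_zero, mul_zero] at h2
  exact h2

lemma tendsto_winMass (Q : Measure (ℝ≥0 × Shape d)) [IsProbabilityMeasure Q]
    (hQ : ∫⁻ m, weight m * weight m ∂Q < ⊤) (θ : ℝ) :
    Filter.Tendsto (fun n : ℕ => winMass Q (θ - 1 / ((n : ℝ) + 1)) (θ + 1 / ((n : ℝ) + 1)))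
      Filter.atTop (nhds 0) := by
  have hsq : Measurable fun m : ℝ≥0 × Shape d => weight m * weight m :=
    measurable_weight.mul measurable_weight
  have hb2 : Measurable fun x : (ℝ≥0 × Shape d) × (ℝ≥0 × Shape d) =>
      (weight x.1 * weight x.1) * (weight x.2 * weight x.2) :=
    (hsq.comp measurable_fst).mul (hsq.comp measurable_snd)
  have hle : ∀ n : ℕ, θ + 1 / ((n : ℝ) + 1) ≤ θ + 1 := by
    intro n
    have : (1 : ℝ) / (n + 1) ≤ 1 := by
      rw [div_le_one (by positivity)]; linarith [Nat.cast_nonneg (α := ℝ) n]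
    linarith
  have hfin : ∫⁻ x, winConst d (θ + 1) * ((weight x.1 * weight x.1) * (weight x.2 * weight x.2))
      ∂(Q.prod Q) ≠ ⊤ := by
    rw [lintegral_const_mul _ hb2]
    refine (ENNReal.mul_lt_top (winConst_lt_top _ _) ?_).ne
    rw [lintegral_prod_mul hsq.aemeasurable hsq.aemeasurable]
    exact ENNReal.mul_lt_top hQ hQ
  have hlim := tendsto_lintegral_of_dominated_convergence (μ := Q.prod Q)
    (F := fun n : ℕ => winDens (θ - 1 / ((n : ℝ) + 1)) (θ + 1 / ((n : ℝ) + 1))) (f := fun _ => 0)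
    (fun x => winConst d (θ + 1) * ((weight x.1 * weight x.1) * (weight x.2 * weight x.2)))
    (fun n => measurable_winDens _ _)
    (fun n => Filter.Eventually.of_forall fun x => winDens_le _ _ _ (hle n) x)
    hfin (Filter.Eventually.of_forall fun x => tendsto_winDens θ x)
  rw [lintegral_zero] at hlim
  simp_rw [winMass_eq]
  exact hlim

/-- Rational endpoints leave only countably many windows, so one almost sure event serves all times
`θ`. -/
lemma exists_winMass_lt (Q : Measure (ℝ≥0 × Shape d)) [IsProbabilityMeasure Q]
    (hQ : ∫⁻ m, weight m * weight m ∂Q < ⊤) (θ : ℝ) {ε : ℝ≥0∞} (hε : 0 < ε) :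
    ∃ p q : ℚ, (p : ℝ) < θ ∧ θ < q ∧ (q : ℝ) ≤ θ + 1 ∧ winMass Q p q < ε := by
  obtain ⟨n, hn⟩ := ((tendsto_winMass Q hQ θ).eventually (gt_mem_nhds hε)).exists
  have hpos : (0 : ℝ) < 1 / (n + 1) := by positivity
  have hle : (1 : ℝ) / (n + 1) ≤ 1 := by
    rw [div_le_one (by positivity)]; linarith [Nat.cast_nonneg (α := ℝ) n]
  obtain ⟨p, hp1, hp2⟩ := exists_rat_btwn (show θ - 1 / ((n : ℝ) + 1) < θ by linarith)
  obtain ⟨q, hq1, hq2⟩ := exists_rat_btwn (show θ < θ + 1 / ((n : ℝ) + 1) by linarith)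
  exact ⟨p, q, hp2, hq1, by linarith, (winMass_mono Q hp1.le hq2.le).trans_lt hn⟩

end

/-! ### Almost sure regularity -/

noncomputable section

open ProbabilityTheory

namespace Grain

variable {d : ℕ}

/-- Tuples of grains in which consecutive grains meet in a time window. -/
def Chain (τ τ' : ℝ) {k : ℕ} (v : Fin (k + 1) → Grain d) : Prop :=
  ∀ i : Fin k, Win τ τ' (v i.castSucc) (v i.succ)

lemma chain_cons {τ τ' : ℝ} {k : ℕ} {u : Grain d} {v : Fin (k + 1) → Grain d} :
    Chain τ τ' (Fin.cons u v : Fin (k + 2) → Grain d) ↔ Win τ τ' u (v 0) ∧ Chain τ τ' v := by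
  rw [Chain, Fin.forall_fin_succ]
  refine and_congr ?_ (forall_congr' fun i => ?_)
  · simp
  · rw [← Fin.succ_castSucc, Fin.cons_succ, Fin.cons_succ]

lemma measurableSet_chain (τ τ' : ℝ) (k : ℕ) :
    MeasurableSet {v : Fin (k + 1) → Grain d | Chain τ τ' v} := by
  have : {v : Fin (k + 1) → Grain d | Chain τ τ' v} =
      ⋂ i : Fin k, (fun v : Fin (k + 1) → Grain d => (v i.castSucc, v i.succ)) ⁻¹'
        {p | Win τ τ' p.1 p.2} := by
    ext v; simp [Chain]
  rw [this]
  exact MeasurableSet.iInter fun i => ((measurable_pi_apply _).prodMk (measurable_pi_apply _))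
    (measurableSet_win τ τ')

end Grain

open Grain

variable {d : ℕ}

/-- The measure of the chains that start in a given grain. -/
def chainMass (Q : Measure (ℝ≥0 × Shape d)) (τ τ' : ℝ) (k : ℕ) (u : Grain d) : ℝ≥0∞ :=
  Measure.pi (fun _ : Fin k => (volume : Measure (Space d)).prod Q)
    {v | Chain τ τ' (Fin.cons u v : Fin (k + 1) → Grain d)}

lemma chainMass_zero (Q : Measure (ℝ≥0 × Shape d)) (τ τ' : ℝ) (u : Grain d) :
    chainMass Q τ τ' 0 u = 1 := by
  have : {v : Fin 0 → Grain d | Chain τ τ' (Fin.cons u v : Fin 1 → Grain d)} = Set.univ := by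
    ext v; simp [Chain]
  rw [chainMass, this]
  simp

lemma chainMass_succ (Q : Measure (ℝ≥0 × Shape d)) [IsProbabilityMeasure Q] (τ τ' : ℝ) (k : ℕ)
    (u : Grain d) :
    chainMass Q τ τ' (k + 1) u = ∫⁻ w in {w : Grain d | Win τ τ' u w}, chainMass Q τ τ' k w
      ∂((volume : Measure (Space d)).prod Q) := by
  have hS : MeasurableSet {v : Fin (k + 1) → Grain d |
      Chain τ τ' (Fin.cons u v : Fin (k + 2) → Grain d)} :=
    measurable_finCons measurable_const measurable_id (measurableSet_chain τ τ' (k + 1))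
  rw [chainMass, pi_succ_apply _ hS, ← lintegral_indicator (measurableSet_win_right τ τ' u)]
  refine lintegral_congr fun w => ?_
  by_cases h : Win τ τ' u w
  · rw [Set.indicator_of_mem (by exact h), chainMass]
    congr 1
    ext v
    show Chain τ τ' (Fin.cons u (Fin.cons w v) : Fin (k + 2) → Grain d) ↔ _
    rw [chain_cons, Fin.cons_zero]
    exact and_iff_right h
  · rw [Set.indicator_of_notMem (by exact h)]
    convert measure_empty
    · ext v
      refine iff_of_false (fun h' => h ?_) (fun h' => h')
      exact (chain_cons.1 h').1
    · infer_instance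

/-- Each pair of steps contributes the factor of `two_step_le` and returns the weight of the
starting grain, so the estimate iterates. -/
lemma chainMass_two_mul_le (Q : Measure (ℝ≥0 × Shape d)) [IsProbabilityMeasure Q] (τ τ' : ℝ)
    (j : ℕ) (u : Grain d) :
    chainMass Q τ τ' (2 * j) u ≤ (winConst d τ' * winMass Q τ τ') ^ j * weight u.2 := by
  induction j generalizing u with
  | zero => rw [mul_zero, chainMass_zero, pow_zero, one_mul]; exact one_le_weight _
  | succ j ih =>
    rw [show 2 * (j + 1) = 2 * j + 1 + 1 by ring, chainMass_succ]
    simp_rw [chainMass_succ]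
    have hm : Measurable fun w : Grain d => weight w.2 := measurable_weight.comp measurable_snd
    calc _ ≤ ∫⁻ v in {v : Grain d | Win τ τ' u v}, ∫⁻ w in {w : Grain d | Win τ τ' v w},
          (winConst d τ' * winMass Q τ τ') ^ j * weight w.2
          ∂((volume : Measure (Space d)).prod Q) ∂((volume : Measure (Space d)).prod Q) :=
          lintegral_mono fun v => lintegral_mono fun w => ih w
      _ ≤ (winConst d τ' * winMass Q τ τ') ^ j *
          ∫⁻ v in {v : Grain d | Win τ τ' u v}, ∫⁻ w in {w : Grain d | Win τ τ' v w}, weight w.2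
          ∂((volume : Measure (Space d)).prod Q) ∂((volume : Measure (Space d)).prod Q) := by
          simp_rw [lintegral_const_mul _ hm]
          rw [lintegral_const_mul]
          have hG : Measurable fun m => ∫⁻ m', weight m' * winVol τ τ' m m' ∂Q :=
            Measurable.lintegral_prod_right ((measurable_weight.comp measurable_snd).mul
              (measurable_winVol τ τ'))
          simp_rw [setLIntegral_win Q τ τ' _ measurable_weight]
          exact hG.comp measurable_snd
      _ ≤ _ := by
          rw [pow_succ, mul_assoc]
          gcongr
          exact two_step_le Q τ τ' u

lemma lintegral_weight_lt_top {Q : Measure (ℝ≥0 × Shape d)}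
    (hQ : ∫⁻ m, weight m * weight m ∂Q < ⊤) : ∫⁻ m, weight m ∂Q < ⊤ :=
  (lintegral_mono fun m => le_mul_of_one_le_left (zero_le) (one_le_weight m)).trans_lt hQ

lemma chainMass_one_le (Q : Measure (ℝ≥0 × Shape d)) [IsProbabilityMeasure Q] (τ τ' : ℝ)
    (u : Grain d) :
    chainMass Q τ τ' 1 u ≤ (winConst d τ' * ∫⁻ m, weight m ∂Q) * weight u.2 := by
  rw [show 1 = 0 + 1 from rfl, chainMass_succ]
  simp_rw [chainMass_zero]
  rw [setLIntegral_win Q τ τ' u (h := fun _ => 1) measurable_const]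
  calc _ ≤ ∫⁻ m, (winConst d τ' * weight u.2) * weight m ∂Q := by
        refine lintegral_mono fun m => ?_
        rw [one_mul, mul_assoc]
        exact winVol_le _ _ _ _
    _ = _ := by rw [lintegral_const_mul _ measurable_weight]; ring

/-- Chains whose first grain has its position in a given set. -/
def chainsFrom (B : Set (Space d)) (τ τ' : ℝ) (k : ℕ) : Set (Fin (k + 1) → Grain d) :=
  {v | (v 0).1 ∈ B ∧ Chain τ τ' v}

lemma measurableSet_chainsFrom {B : Set (Space d)} (hB : MeasurableSet B) (τ τ' : ℝ) (k : ℕ) :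
    MeasurableSet (chainsFrom B τ τ' k) := by
  have h : Measurable fun v : Fin (k + 1) → Grain d => (v 0).1 :=
    measurable_fst.comp (measurable_pi_apply 0)
  exact (h hB).inter (measurableSet_chain τ τ' k)

lemma pi_chainsFrom_le {Q : Measure (ℝ≥0 × Shape d)} [IsProbabilityMeasure Q] {B : Set (Space d)}
    (hB : MeasurableSet B) {τ τ' : ℝ} {k : ℕ} {K : ℝ≥0∞}
    (hK : ∀ u : Grain d, chainMass Q τ τ' k u ≤ K * weight u.2) :
    Measure.pi (fun _ : Fin (k + 1) => (volume : Measure (Space d)).prod Q)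
      (chainsFrom B τ τ' k) ≤ K * (volume B * ∫⁻ m, weight m ∂Q) := by
  rw [pi_succ_apply _ (measurableSet_chainsFrom hB τ τ' k)]
  have hm : Measurable fun w : Grain d => weight w.2 := measurable_weight.comp measurable_snd
  have hBm : MeasurableSet {u : Grain d | u.1 ∈ B} := measurable_fst hB
  calc _ ≤ ∫⁻ u : Grain d, K * ({u : Grain d | u.1 ∈ B}.indicator (fun u => weight u.2) u)
        ∂((volume : Measure (Space d)).prod Q) := by
        refine lintegral_mono fun u => ?_
        by_cases h : u.1 ∈ B
        · rw [Set.indicator_of_mem (by exact h)]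
          exact (measure_mono fun v hv => hv.2).trans (hK u)
        · refine le_of_eq_of_le (measure_mono_null (t := ∅) ?_ measure_empty) zero_le
          intro v hv
          exact h hv.1
    _ = K * (volume B * ∫⁻ m, weight m ∂Q) := by
        rw [lintegral_const_mul _ (hm.indicator hBm)]
        congr 1
        have e : ({u : Grain d | u.1 ∈ B}.indicator fun u : Grain d => weight u.2) =
            fun u : Grain d => B.indicator (fun _ => 1) u.1 * weight u.2 := by
          ext u
          by_cases h : u.1 ∈ B
          · rw [Set.indicator_of_mem (by exact h), Set.indicator_of_mem h, one_mul]
          · rw [Set.indicator_of_notMem (by exact h), Set.indicator_of_notMem h, zero_mul]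
        rw [e, lintegral_prod_mul (f := B.indicator fun _ => 1) (g := weight)
          (measurable_const.indicator hB).aemeasurable measurable_weight.aemeasurable,
          lintegral_indicator_const hB, one_mul]

namespace Config

variable {Ω : Type*} [MeasurableSpace Ω] {P : Measure Ω} {Ψ : Ω → Config d}

/-- The event that all the tuples exist lies in each single event, and the probabilities of these
tend to `0`. -/
lemma ae_exists_not_hasTuple {k : ℕ → ℕ} {C : (j : ℕ) → Set (Fin (k j) → Grain d)}
    (h : Filter.Tendsto (fun j => P {ω | HasTuple (Ψ ω) (C j)}) Filter.atTop (nhds 0)) :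
    ∀ᵐ ω ∂P, ∃ j, ¬ HasTuple (Ψ ω) (C j) := by
  rw [ae_iff]
  refine le_antisymm (ge_of_tendsto' h fun j => measure_mono fun ω hω => ?_) zero_le
  have hω : ¬ ∃ j, ¬ HasTuple (Ψ ω) (C j) := hω
  push Not at hω
  exact hω j

/-- Configurations with few grains that meet in a short time window. -/
structure Sparse (Q : Measure (ℝ≥0 × Shape d)) (a : ℝ≥0) (ψ : Config d) : Prop where
  chains : ∀ (p q : ℚ) (N : ℕ), (a : ℝ≥0∞) ^ 2 * (winConst d q * winMass Q p q) < 1 →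
    ∃ j : ℕ, ¬ HasTuple ψ (chainsFrom (Metric.closedBall (0 : Space d) N) p q (2 * j))
  far : ∀ N T : ℕ, ∃ n : ℕ, ¬ HasTuple ψ (chainsFrom (Metric.closedBall (0 : Space d) N) (-1) T 1 ∩
    {v | (n : ℝ) ≤ ‖(v 1).1‖})

lemma ae_sparse {Q : Measure (ℝ≥0 × Shape d)} [IsProbabilityMeasure Q] {a : ℝ≥0}
    (h : MomentBound P Ψ a ((volume : Measure (Space d)).prod Q)) (hΨ : Measurable Ψ)
    (hQ : ∫⁻ m, weight m * weight m ∂Q < ⊤) : ∀ᵐ ω ∂P, Sparse Q a (Ψ ω) := by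
  have hW := lintegral_weight_lt_top hQ
  have hvol : ∀ N : ℕ, volume (Metric.closedBall (0 : Space d) N) < ⊤ :=
    fun N => measure_closedBall_lt_top
  have h1 : ∀ᵐ ω ∂P, ∀ (p q : ℚ) (N : ℕ), (a : ℝ≥0∞) ^ 2 * (winConst d q * winMass Q p q) < 1 →
      ∃ j : ℕ, ¬ HasTuple (Ψ ω) (chainsFrom (Metric.closedBall (0 : Space d) N) p q (2 * j)) := by
    rw [ae_all_iff]; intro p
    rw [ae_all_iff]; intro q
    rw [ae_all_iff]; intro N
    rw [Filter.eventually_imp_distrib_left]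
    intro hlt
    refine ae_exists_not_hasTuple ?_
    -- A chain of `2 * j` steps has `2 * j + 1` points: one factor `a` belongs to the first point,
    -- and each pair of steps takes `a ^ 2`.
    have hb : ∀ j : ℕ, P {ω | HasTuple (Ψ ω)
        (chainsFrom (Metric.closedBall (0 : Space d) N) p q (2 * j))} ≤
        ((a : ℝ≥0∞) ^ 2 * (winConst d q * winMass Q p q)) ^ j *
          (a * (volume (Metric.closedBall (0 : Space d) N) * ∫⁻ m, weight m ∂Q)) := by
      intro j
      refine (h.measure_hasTuple_le hΨ (measurableSet_chainsFrom measurableSet_closedBall _ _ _)).trans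
        ?_
      refine (mul_le_mul_right (pi_chainsFrom_le measurableSet_closedBall
        (chainMass_two_mul_le Q p q j)) _).trans (le_of_eq ?_)
      rw [pow_succ, pow_mul, mul_pow]; ring
    refine tendsto_of_tendsto_of_tendsto_of_le_of_le tendsto_const_nhds ?_ (fun _ => zero_le) hb
    have := ENNReal.Tendsto.mul_const (b := (a : ℝ≥0∞) * (volume (Metric.closedBall (0 : Space d) N) *
      ∫⁻ m, weight m ∂Q)) (ENNReal.tendsto_pow_atTop_nhds_zero_of_lt_one hlt) (Or.inr
        (ENNReal.mul_lt_top ENNReal.coe_lt_top (ENNReal.mul_lt_top (hvol N) hW)).ne)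
    rwa [zero_mul] at this
  have h2 : ∀ᵐ ω ∂P, ∀ N T : ℕ, ∃ n : ℕ, ¬ HasTuple (Ψ ω)
      (chainsFrom (Metric.closedBall (0 : Space d) N) (-1) T 1 ∩ {v | (n : ℝ) ≤ ‖(v 1).1‖}) := by
    rw [ae_all_iff]; intro N
    rw [ae_all_iff]; intro T
    refine ae_exists_not_hasTuple (k := fun _ => 2) ?_
    have hms : ∀ n : ℕ, MeasurableSet (chainsFrom (Metric.closedBall (0 : Space d) N) (-1) T 1 ∩
        {v | (n : ℝ) ≤ ‖(v 1).1‖}) := fun n =>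
      (measurableSet_chainsFrom measurableSet_closedBall _ _ _).inter
        (measurableSet_le measurable_const (measurable_fst.comp (measurable_pi_apply 1)).norm)
    have hlim := tendsto_measure_iInter_atTop
      (μ := Measure.pi (fun _ : Fin 2 => (volume : Measure (Space d)).prod Q))
      (fun n => (hms n).nullMeasurableSet)
      (fun i j hij v hv => ⟨hv.1, le_trans (Nat.cast_le.2 hij : (i : ℝ) ≤ j) hv.2⟩)
      ⟨0, ((measure_mono Set.inter_subset_left).trans_lt ((pi_chainsFrom_le measurableSet_closedBall
        (chainMass_one_le Q (-1) T)).trans_lt (ENNReal.mul_lt_top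
          (ENNReal.mul_lt_top (winConst_lt_top _ _) hW) (ENNReal.mul_lt_top (hvol N) hW)))).ne⟩
    have hempty : ⋂ n : ℕ, (chainsFrom (Metric.closedBall (0 : Space d) N) (-1) T 1 ∩
        {v | (n : ℝ) ≤ ‖(v 1).1‖}) = ∅ := by
      refine Set.eq_empty_of_forall_notMem fun v hv => ?_
      rw [Set.mem_iInter] at hv
      obtain ⟨n, hn⟩ := exists_nat_gt ‖(v 1).1‖
      exact absurd (hv n).2 (not_le.2 hn)
    rw [hempty, measure_empty] at hlim
    have hlim2 := ENNReal.Tendsto.const_mul (a := (a : ℝ≥0∞) ^ 2) hlim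
      (Or.inr (ENNReal.pow_lt_top ENNReal.coe_lt_top).ne)
    rw [mul_zero] at hlim2
    exact tendsto_of_tendsto_of_tendsto_of_le_of_le tendsto_const_nhds hlim2 (fun _ => zero_le)
      fun n => h.measure_hasTuple_le hΨ (hms n)
  filter_upwards [h1, h2] with ω h1 h2
  exact ⟨h1, h2⟩

lemma Sparse.finite_touchAt {Q : Measure (ℝ≥0 × Shape d)} {a : ℝ≥0} {ψ : Config d}
    (h : Sparse Q a ψ) {u : Grain d} (hu : u ∈ ψ.carrier) (T : ℝ) :
    {v ∈ ψ.carrier | TouchAt T u v}.Finite := by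
  obtain ⟨N, hN⟩ := exists_nat_ge ‖u.1‖
  obtain ⟨T', hT⟩ := exists_nat_ge T
  obtain ⟨n, hn⟩ := h.far N T'
  refine ((Set.finite_singleton u).union
    (ψ.locallyFinite (Metric.ball 0 n) Metric.isBounded_ball)).subset ?_
  rintro v ⟨hv, ht⟩
  by_cases huv : u.pos = v.pos
  · exact Or.inl (ψ.pos_injOn hu hv huv).symm
  · refine Or.inr ⟨hv, ?_⟩
    rw [mem_ball_zero_iff]
    by_contra hlt
    rw [not_lt] at hlt
    refine hn ⟨![u, v], ?_, ?_, ⟨⟨?_, ?_⟩, hlt⟩⟩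
    · intro i j hij
      have hne : u ≠ v := fun e => huv (congrArg _ e)
      fin_cases i <;> fin_cases j <;> simp_all
    · intro i; fin_cases i
      exacts [hu, hv]
    · rw [mem_closedBall_zero_iff]; exact hN
    · intro i
      fin_cases i
      refine ⟨ht.mono hT, fun h0 => huv ?_⟩
      -- At time `-1` every grain is a point, so for distinct positions the window from `-1` imposes
      -- no lower restriction.
      have e : ∀ w : Grain d, rad (-1) w = 0 := fun w =>
        Real.toNNReal_of_nonpos (by linarith [NNReal.coe_nonneg w.birth])
      have h0 : Touch u (rad (-1) u) v (rad (-1) v) := h0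
      rw [e, e] at h0
      exact touch_zero_zero.1 h0

lemma Sparse.regular {Q : Measure (ℝ≥0 × Shape d)} [IsProbabilityMeasure Q]
    (hQ : ∫⁻ m, weight m * weight m ∂Q < ⊤) {a : ℝ≥0} {ψ : Config d} (h : Sparse Q a ψ) :
    Regular ψ := by
  refine ⟨fun u hu T => h.finite_touchAt hu T, fun θ _ => ?_⟩
  have hc : (a : ℝ≥0∞) ^ 2 * winConst d (θ + 1) < ⊤ :=
    ENNReal.mul_lt_top (ENNReal.pow_lt_top ENNReal.coe_lt_top) (winConst_lt_top _ _)
  -- As `q ≤ θ + 1`, the constant at `θ + 1` can be fixed before the window is chosen. The added 1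
  -- keeps the inverted quantity positive.
  obtain ⟨p, q, hp, hq, hq1, hlt⟩ := exists_winMass_lt Q hQ θ
    (ε := ((a : ℝ≥0∞) ^ 2 * winConst d (θ + 1) + 1)⁻¹)
    (ENNReal.inv_pos.2 (ENNReal.add_lt_top.2 ⟨hc, ENNReal.one_lt_top⟩).ne)
  have hcq : winConst d q ≤ winConst d (θ + 1) := by
    unfold winConst
    gcongr
  have hlt1 : (a : ℝ≥0∞) ^ 2 * (winConst d q * winMass Q p q) < 1 := by
    have h0 : (a : ℝ≥0∞) ^ 2 * winConst d (θ + 1) + 1 ≠ 0 := by positivity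
    have ht : (a : ℝ≥0∞) ^ 2 * winConst d (θ + 1) + 1 ≠ ⊤ :=
      (ENNReal.add_lt_top.2 ⟨hc, ENNReal.one_lt_top⟩).ne
    calc (a : ℝ≥0∞) ^ 2 * (winConst d q * winMass Q p q)
        ≤ ((a : ℝ≥0∞) ^ 2 * winConst d (θ + 1) + 1) * winMass Q p q := by
          rw [← mul_assoc]
          gcongr
          exact le_trans (by gcongr) le_self_add
      _ < ((a : ℝ≥0∞) ^ 2 * winConst d (θ + 1) + 1) *
          ((a : ℝ≥0∞) ^ 2 * winConst d (θ + 1) + 1)⁻¹ := ENNReal.mul_lt_mul_right h0 ht hlt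
      _ = 1 := ENNReal.mul_inv_cancel h0 ht
  refine ⟨p, q, hp, hq, fun u hu => ?_⟩
  obtain ⟨N, hN⟩ := exists_nat_ge ‖u.1‖
  obtain ⟨j, hj⟩ := h.chains p q N hlt1
  let G : SimpleGraph (Grain d) :=
    { Adj := WindowAdj ψ p q
      symm := ⟨fun _ _ h => ⟨h.2.1, h.1, h.2.2.1.symm, h.2.2.2.1.symm, fun h' => h.2.2.2.2 h'.symm⟩⟩
      loopless := ⟨fun _ h => h.2.2.1 rfl⟩ }
  have hfin := G.finite_reachable (fun u => ?_) u (2 * j) fun x hx0 hx hinj => ?_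
  · refine hfin.subset fun v hv => ?_
    exact (SimpleGraph.reachable_iff_reflTransGen u v).2 hv
  · by_cases hu : u ∈ ψ.carrier
    · exact (h.finite_touchAt hu q).subset fun v hv => ⟨hv.2.1, hv.2.2.2.1⟩
    · exact Set.finite_empty.subset fun v hv => hu hv.1
  · refine hj ⟨fun i => x i, fun i i' hii => ?_, fun i => ?_, ?_, fun i => ?_⟩
    · exact Fin.ext (hinj (Nat.lt_succ_iff.1 i.2) (Nat.lt_succ_iff.1 i'.2) hii)
    · rcases Nat.eq_zero_or_pos i.1 with h0 | h0
      · show x i.1 ∈ _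
        rw [h0, hx0]; exact hu
      · have := (hx (i.1 - 1) (by omega)).2.1
        rwa [Nat.sub_add_cancel h0] at this
    · show (x 0).1 ∈ _
      rw [hx0, mem_closedBall_zero_iff]; exact hN
    · exact (hx i.1 i.2).2.2.2

end Config

end

/-! ### Translations and stationarity -/

noncomputable section

open ProbabilityTheory

namespace Grain

variable {d : ℕ}

lemma translate_injective (x : Space d) : Function.Injective (translate x) := fun u v h =>
  Prod.ext (add_left_cancel (congrArg Prod.fst h : x + u.1 = x + v.1))
    (Prod.ext_iff.1 h).2

end Grain

namespace Config

open Grain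

variable {d : ℕ} {ψ : Config d}

lemma mem_translate {x : Space d} {u : Grain d} :
    Grain.translate x u ∈ (ψ.translate x).carrier ↔ u ∈ ψ.carrier :=
  (translate_injective x).mem_set_image

lemma exists_mem_translate {x : Space d} {p : Grain d → Prop} :
    (∃ v ∈ (ψ.translate x).carrier, p v) ↔ ∃ v ∈ ψ.carrier, p (Grain.translate x v) :=
  Set.exists_mem_image

lemma measurable_translate (x : Space d) : Measurable fun ψ : Config d => ψ.translate x := by
  refine measurable_of_encard fun C hC => ?_
  have h := measurable_encard_inter (Grain.measurable_translate x hC) (fun n => (n : ℝ≥0∞))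
  convert h using 3 with ψ
  rw [← (translate_injective x).encard_image (ψ.carrier ∩ _), Set.image_inter_preimage]
  rfl

lemma blocked_translate {x : Space d} {f : Grain d → ℝ≥0∞} {u : Grain d} {r : ℝ≥0} :
    Blocked (ψ.translate x) f (Grain.translate x u) r ↔
      Blocked ψ (fun v => f (Grain.translate x v)) u r := by
  rw [Blocked, exists_mem_translate]
  refine exists_congr fun v => and_congr_right fun _ => ?_
  refine and_congr (not_congr (add_right_inj x)) (exists_congr fun s => ?_)
  rw [touch_translate]
  rfl

lemma iter_translate (x : Space d) (n : ℕ) (u : Grain d) :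
    iter (ψ.translate x) n (Grain.translate x u) = iter ψ n u := by
  induction n generalizing u with
  | zero => rfl
  | succ n ih =>
    simp only [iter, stopTime, blocked_translate, ih]

lemma gt_translate (x : Space d) (u : Grain d) :
    gt (ψ.translate x) (Grain.translate x u) = gt ψ u := by
  simp only [gt, growth, lower, iter_translate]

lemma early_translate {x : Space d} {u v : Grain d} :
    Early (ψ.translate x) (Grain.translate x u) (Grain.translate x v) ↔ Early ψ u v := by
  rw [Early, gt_translate, gt_translate, touch_translate]
  exact and_congr (not_congr (add_right_inj x)) Iff.rfl

lemma mem_roots_translate {x : Space d} {u ρ : Grain d} :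
    Grain.translate x ρ ∈ roots (ψ.translate x) (Grain.translate x u) ↔ ρ ∈ roots ψ u := by
  refine and_congr ?_ ?_
  · rw [desc_iff, desc_iff]
    refine exists_congr fun n => ?_
    induction n generalizing u with
    | zero => exact (translate_injective x).eq_iff
    | succ n ih =>
      rw [DescN, exists_mem_translate]
      simp only [ih, early_translate, DescN]
  · rw [Tie, exists_mem_translate]
    simp only [early_translate, gt_translate]
    rfl

/-- Grains that were born early are found arbitrarily far away. -/
def Spread (ψ : Config d) : Prop :=
  ∃ S : ℕ, ∀ N : ℕ, ∃ v ∈ ψ.carrier, v.birth ≤ S ∧ (N : ℝ) < ‖v.pos‖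

/-- A grain born by time `S` at distance more than `S * u.shape.size` from `u` cannot be reached
within growth time `S`. -/
lemma Spread.outgrown (h : Spread ψ) : Outgrown ψ := by
  obtain ⟨S, hS⟩ := h
  intro u hu
  obtain ⟨N, hN⟩ := exists_nat_ge (‖u.pos‖ + S * u.shape.size)
  obtain ⟨v, hv, hb, hn⟩ := hS N
  refine ⟨v, hv, fun r hr => ?_⟩
  have hsub : ‖v.pos - u.pos‖ ≤ r * u.shape.size := by
    obtain ⟨k, hk, e⟩ := hr
    rw [← e, add_sub_cancel_left, norm_smul, Real.norm_of_nonneg (NNReal.coe_nonneg r)]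
    gcongr
    exact Shape.norm_le_size hk
  have h1 : (S : ℝ) * u.shape.size < r * u.shape.size := by
    have := norm_sub_norm_le v.pos u.pos
    linarith
  have h2 : (S : ℝ≥0) < r := by
    rw [← NNReal.coe_lt_coe]
    exact lt_of_mul_lt_mul_right h1 u.shape.size_nonneg
  exact (hb.trans_lt h2).trans_le le_add_self

/-- There are grains born until time `S`, and all of them lie in the ball with radius `N`. -/
def Confined (S N : ℕ) (ψ : Config d) : Prop :=
  (∃ v ∈ ψ.carrier, v.birth ≤ S) ∧ ¬ ∃ v ∈ ψ.carrier, v.birth ≤ S ∧ (N : ℝ) < ‖v.pos‖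

lemma measurableSet_confined (S N : ℕ) : MeasurableSet {ψ : Config d | Confined S N ψ} := by
  have h1 : MeasurableSet {u : Grain d | u.birth ≤ S} :=
    measurableSet_le measurable_birth measurable_const
  have h2 : MeasurableSet {u : Grain d | (N : ℝ) < ‖u.pos‖} :=
    measurableSet_lt measurable_const measurable_pos.norm
  exact (measurableSet_exists_mem measurable_id (measurable_snd h1)).inter
    (measurableSet_exists_mem measurable_id (measurable_snd (h1.inter h2))).compl

lemma not_confined_translate {S N : ℕ} {x y : Space d} (hxy : 2 * (N : ℝ) < ‖x - y‖)
    (h1 : Confined S N (ψ.translate x)) : ¬ Confined S N (ψ.translate y) := by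
  intro h2
  obtain ⟨v, hv, hb⟩ := (exists_mem_translate (p := fun v => v.birth ≤ S)).1 h1.1
  have key : ∀ z : Space d, Confined S N (ψ.translate z) → ‖z + v.pos‖ ≤ N := by
    intro z hz
    by_contra hlt
    exact hz.2 ⟨Grain.translate z v, mem_translate.2 hv, hb, not_le.1 hlt⟩
  have e : x - y = (x + v.pos) - (y + v.pos) := by abel
  have := norm_sub_le (x + v.pos) (y + v.pos)
  rw [← e] at this
  linarith [key x h1, key y h2]

variable {Ω : Type*} [MeasurableSpace Ω] {P : Measure Ω} [IsProbabilityMeasure P]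
  {Ψ : Ω → Config d}

/-- Shifts by different multiples of `2 * N + 1` along a unit vector give disjoint events, since an
early grain lies in at most one of the shifted balls. Stationarity makes them equally probable, so
the probability is `0`. -/
lemma measure_confined (hd : 1 ≤ d) (hΨ : Measurable Ψ) (hstat : IsStationaryPointProcess P Ψ)
    (S N : ℕ) : P {ω | Confined S N (Ψ ω)} = 0 := by
  let e : Space d := EuclideanSpace.single ⟨0, hd⟩ 1
  have he : ‖e‖ = 1 := by simp [e]
  let x : ℕ → Space d := fun n => ((2 * N + 1 : ℝ) * n) • e
  have hms : ∀ n, MeasurableSet {ω | Confined S N ((Ψ ω).translate (x n))} := fun n =>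
    ((measurable_translate (x n)).comp hΨ) (measurableSet_confined S N)
  have hdisj : Pairwise (Function.onFun Disjoint fun n =>
      {ω | Confined S N ((Ψ ω).translate (x n))}) := by
    intro i j hij
    refine Set.disjoint_left.2 fun ω h1 h2 => not_confined_translate ?_ h1 h2
    have e1 : x i - x j = ((2 * N + 1 : ℝ) * ((i : ℝ) - j)) • e := by
      simp only [x]; rw [← sub_smul]; congr 1; ring
    rw [e1, norm_smul, he, mul_one, Real.norm_eq_abs, abs_mul,
      abs_of_nonneg (by positivity : (0 : ℝ) ≤ 2 * N + 1)]
    have : (1 : ℝ) ≤ |(i : ℝ) - j| := by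
      have h3 : (1 : ℤ) ≤ |(i : ℤ) - j| := Int.one_le_abs (by omega)
      exact_mod_cast h3
    have : (0 : ℝ) ≤ N := Nat.cast_nonneg N
    nlinarith
  by_contra h0
  have h1 := measure_iUnion hdisj hms (μ := P)
  have h2 : ∀ n, P {ω | Confined S N ((Ψ ω).translate (x n))} = P {ω | Confined S N (Ψ ω)} :=
    fun n => hstat (x n) _ (measurableSet_confined S N)
  simp_rw [h2] at h1
  rw [ENNReal.tsum_const_eq_top_of_ne_zero h0] at h1
  exact measure_ne_top P _ h1

lemma ae_spread (hd : 1 ≤ d) (hΨ : Measurable Ψ) (hstat : IsStationaryPointProcess P Ψ)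
    (hne : ∀ᵐ ω ∂P, (Ψ ω).carrier.Nonempty) : ∀ᵐ ω ∂P, Spread (Ψ ω) := by
  have h : ∀ᵐ ω ∂P, ∀ S N : ℕ, ¬ Confined S N (Ψ ω) := by
    rw [ae_all_iff]; intro S
    rw [ae_all_iff]; intro N
    rw [ae_iff]
    simp only [not_not]
    exact measure_confined hd hΨ hstat S N
  filter_upwards [h, hne] with ω h hne
  obtain ⟨u, hu⟩ := hne
  obtain ⟨S, hS⟩ := exists_nat_ge u.birth
  refine ⟨S, fun N => ?_⟩
  by_contra hN
  exact h S N ⟨⟨u, hu, hS⟩, hN⟩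

end Config

end

/-! ### Hitting times as functions of the position -/

noncomputable section

open ProbabilityTheory

/-- On the zero set of a Lipschitz function, the derivative vanishes almost everywhere. -/
lemma LipschitzWith.ae_hasFDerivAt_zero {E : Type*} [NormedAddCommGroup E] [NormedSpace ℝ E]
    [FiniteDimensional ℝ E] [MeasurableSpace E] [BorelSpace E] [Nontrivial E] (μ : Measure E)
    [μ.IsAddHaarMeasure] {C : ℝ≥0} {f : E → ℝ} (hf : LipschitzWith C f) :
    ∀ᵐ x ∂μ, f x = 0 → HasFDerivAt f (0 : E →L[ℝ] ℝ) x := by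
  obtain ⟨e, he⟩ := exists_ne (0 : E)
  set s : Set E := {x | f x = 0} ∩ {x | DifferentiableAt ℝ f x} with hs
  have hsm : MeasurableSet s :=
    (isClosed_eq hf.continuous continuous_const).measurableSet.inter
      (measurableSet_of_differentiableAt ℝ f)
  -- Multiplication by a fixed nonzero `e` gives a map from `E` to `E` that vanishes on `s`; it is
  -- approximated there by `0` with constant `0`, so its derivative vanishes almost everywhere on
  -- `s`.
  have happ : ApproximatesLinearOn (fun x => f x • e) (0 : E →L[ℝ] E) s 0 := by
    intro x hx y hy
    have h1 : f x = 0 := hx.1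
    have h2 : f y = 0 := hy.1
    simp [h1, h2]
  have h := happ.norm_fderiv_sub_le μ hsm (fun x => (fderiv ℝ f x).smulRight e) fun x hx =>
    ((DifferentiableAt.hasFDerivAt hx.2).smul_const e).hasFDerivWithinAt
  rw [ae_restrict_iff' hsm] at h
  filter_upwards [h, hf.ae_differentiableAt (μ := μ)] with x hx hd h0
  have h1 := hx ⟨h0, hd⟩
  rw [sub_zero, nonpos_iff_eq_zero, nnnorm_eq_zero] at h1
  have h2 : fderiv ℝ f x = 0 := by
    ext v
    have h3 : fderiv ℝ f x v • e = 0 := by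
      have := congrArg (fun L : E →L[ℝ] E => L v) h1
      simpa using this
    simpa using (smul_eq_zero.1 h3).resolve_right he
  rw [← h2]
  exact hd.hasFDerivAt

lemma HasFDerivAt.apply_le {E : Type*} [NormedAddCommGroup E] [NormedSpace ℝ E] {f : E → ℝ}
    {L : E →L[ℝ] ℝ} {x : E} (h : HasFDerivAt f L x) {v : E} {b : ℝ}
    (hb : ∀ s : ℝ, 0 < s → s ≤ 1 → f (x + s • v) ≤ f x + s * b) : L v ≤ b := by
  refine le_of_tendsto (h.lim_real v) ?_
  filter_upwards [Filter.eventually_ge_atTop (1 : ℝ)] with c hc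
  have hc0 : 0 < c := by linarith
  have := hb c⁻¹ (inv_pos.2 hc0) (inv_le_one_of_one_le₀ hc)
  rw [smul_eq_mul]
  calc c * (f (x + c⁻¹ • v) - f x) ≤ c * (c⁻¹ * b) := by gcongr; linarith
    _ = b := by rw [mul_inv_cancel_left₀ hc0.ne']

namespace Grain

variable {d : ℕ}

lemma touch_mk_iff {x : Space d} {m : ℝ≥0 × Shape d} {c : ℝ≥0} {v : Grain d} {r : ℝ≥0} :
    Touch (x, m) c v r ↔ ∃ k ∈ m.2.toSet, x + (c : ℝ) • k ∈ v.grown r := by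
  constructor
  · rintro ⟨_, ⟨k, hk, rfl⟩, h⟩; exact ⟨k, hk, h⟩
  · rintro ⟨k, hk, h⟩; exact ⟨_, ⟨k, hk, rfl⟩, h⟩

/-- The hitting time as a real function of the position. -/
def hitReal (m : ℝ≥0 × Shape d) (v : Grain d) (r : ℝ≥0) (x : Space d) : ℝ := hit (x, m) v r

lemma hitReal_le_iff {m : ℝ≥0 × Shape d} {v : Grain d} {r : ℝ≥0} {x : Space d} {c : ℝ}
    (hc : 0 ≤ c) : hitReal m v r x ≤ c ↔ ∃ k ∈ m.2.toSet, x + c • k ∈ v.grown r := by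
  lift c to ℝ≥0 using hc
  rw [hitReal, NNReal.coe_le_coe, hit_le_iff, touch_mk_iff]

lemma hitReal_nonneg (m : ℝ≥0 × Shape d) (v : Grain d) (r : ℝ≥0) (x : Space d) :
    0 ≤ hitReal m v r x := NNReal.coe_nonneg _

lemma exists_hitReal (m : ℝ≥0 × Shape d) (v : Grain d) (r : ℝ≥0) (x : Space d) :
    ∃ k ∈ m.2.toSet, x + hitReal m v r x • k ∈ v.grown r :=
  (hitReal_le_iff (hitReal_nonneg m v r x)).1 le_rfl

/-- By convexity, growing for `s` in direction `k` and then for `c` in direction `l` stays within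
growth for `c + s`. -/
lemma hitReal_le_add (m : ℝ≥0 × Shape d) (v : Grain d) (r : ℝ≥0) (x : Space d) {k : Space d}
    (hk : k ∈ m.2.toSet) {s : ℝ} (hs : 0 ≤ s) :
    hitReal m v r x ≤ hitReal m v r (x + s • k) + s := by
  obtain ⟨l, hl, h⟩ := exists_hitReal m v r (x + s • k)
  set c := hitReal m v r (x + s • k) with hc
  have hc0 : 0 ≤ c := hitReal_nonneg _ _ _ _
  rw [hitReal_le_iff (by positivity)]
  rcases (add_nonneg hc0 hs).eq_or_lt with h0 | h0
  · refine ⟨0, m.2.zero_mem, ?_⟩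
    have e1 : c = 0 := by linarith
    have e2 : s = 0 := by linarith
    rw [e1, e2] at h
    simpa using h
  · refine ⟨(c / (c + s)) • l + (s / (c + s)) • k, m.2.convex_toSet hl hk (by positivity)
      (by positivity) (by rw [← add_div, div_self h0.ne']), ?_⟩
    rw [smul_add, smul_smul, smul_smul, mul_div_cancel₀ _ h0.ne', mul_div_cancel₀ _ h0.ne',
      add_comm (c • l), ← add_assoc]
    exact h

lemma exists_lipschitzWith_hitReal (m : ℝ≥0 × Shape d) :
    ∃ C : ℝ≥0, ∀ v r, LipschitzWith C (hitReal m v r) := by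
  obtain ⟨δ, hδ, hb⟩ := Metric.nhds_basis_closedBall.mem_iff.1
    (mem_interior_iff_mem_nhds.1 m.2.zero_mem_interior)
  refine ⟨⟨δ⁻¹, by positivity⟩, fun v r => LipschitzWith.of_le_add_mul _ fun x y => ?_⟩
  show hitReal m v r x ≤ hitReal m v r y + δ⁻¹ * dist x y
  rcases eq_or_ne x y with rfl | hxy
  · simp
  have hd : 0 < dist x y := dist_pos.2 hxy
  have h := hitReal_le_add m v r x (k := (δ⁻¹ * dist x y)⁻¹ • (y - x)) (hb ?_)
    (s := δ⁻¹ * dist x y) (by positivity)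
  · rwa [smul_inv_smul₀ (by positivity), add_sub_cancel] at h
  · rw [mem_closedBall_zero_iff, norm_smul, ← dist_eq_norm, dist_comm y x,
      Real.norm_of_nonneg (by positivity), mul_inv, inv_inv, mul_assoc, inv_mul_cancel₀ hd.ne',
      mul_one]

lemma hitReal_add_smul_le {m : ℝ≥0 × Shape d} {v : Grain d} {r : ℝ≥0} {x k : Space d} {c s : ℝ}
    (hc : 0 ≤ c) (hk : k ∈ m.2.toSet) (h : x + c • k ∈ v.grown r) (hs : s ≤ 1) :
    hitReal m v r (x + s • (c • k)) ≤ (1 - s) * c := by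
  rw [hitReal_le_iff (mul_nonneg (by linarith) hc)]
  refine ⟨k, hk, ?_⟩
  convert h using 1
  rw [smul_smul, add_assoc, ← add_smul]
  congr 2
  ring

/-- The sublevel set is convex, and the level set lies on its frontier: from an interior point one
may move away from `v.pos` within the sublevel set, and contraction towards `v.pos` then gives a
hitting time below `c`. -/
lemma volume_hitReal_eq (m : ℝ≥0 × Shape d) (v : Grain d) (r : ℝ≥0) {c : ℝ} (hc : 0 < c) :
    volume {x : Space d | hitReal m v r x = c} = 0 := by
  have hconv : Convex ℝ {x : Space d | hitReal m v r x ≤ c} := by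
    obtain ⟨c', rfl⟩ : ∃ c' : ℝ≥0, (c' : ℝ) = c := ⟨⟨c, hc.le⟩, rfl⟩
    have e : {x : Space d | hitReal m v r x ≤ c'} = {x : Space d | Touch v r (x, m) c'} := by
      ext x
      show hitReal m v r x ≤ c' ↔ Touch v r (x, m) c'
      rw [hitReal_le_iff hc.le, ← touch_mk_iff]
      exact ⟨Touch.symm, Touch.symm⟩
    rw [e]
    exact convex_touch v r m c'
  refine measure_mono_null ?_ (hconv.addHaar_frontier volume)
  intro x hx
  have hx : hitReal m v r x = c := hx
  refine ⟨subset_closure hx.le, fun hi => ?_⟩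
  have hlim : Filter.Tendsto (fun s : ℝ => x + s • (x - v.pos)) (nhdsWithin 0 (Set.Ioi 0))
      (nhds x) := by
    have h : Continuous fun s : ℝ => x + s • (x - v.pos) := by fun_prop
    have h := (h.tendsto 0).mono_left (nhdsWithin_le_nhds (s := Set.Ioi 0))
    simpa using h
  obtain ⟨s, hs, hs0⟩ := ((hlim.eventually (isOpen_interior.mem_nhds hi)).and
    self_mem_nhdsWithin).exists
  have hs0 : 0 < s := hs0
  have hs : x + s • (x - v.pos) ∈ {x : Space d | hitReal m v r x ≤ c} := interior_subset hs
  obtain ⟨k, hk, h⟩ := (hitReal_le_iff hc.le).1 hs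
  have h1 : hitReal m v r x ≤ c / (1 + s) := by
    rw [hitReal_le_iff (by positivity)]
    refine ⟨k, hk, ?_⟩
    have h2 := (v.convex_grown r) h (v.pos_mem_grown r)
      (show 0 ≤ 1 / (1 + s) by positivity) (show 0 ≤ s / (1 + s) by positivity)
      (by rw [← add_div, div_self (by positivity)])
    convert h2 using 1
    have h3 : (1 + s) ≠ 0 := by positivity
    have e1 : c / (1 + s) = (1 / (1 + s)) * c := by ring
    have e2 : s / (1 + s) = (1 / (1 + s)) * s := by ring
    have e3 : x = (1 / (1 + s)) • ((1 + s) • x) := by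
      rw [smul_smul, one_div, inv_mul_cancel₀ h3, one_smul]
    rw [e1, e2, mul_smul, mul_smul]
    nth_rewrite 1 [e3]
    rw [← smul_add, ← smul_add]
    congr 1
    rw [add_smul, one_smul, smul_sub]
    abel
  rw [hx] at h1
  have : c / (1 + s) < c := div_lt_self hc (by linarith)
  linarith

/-- Moving straight along the contact direction reduces the hitting time at unit rate. With
`neg_one_le_apply_of_hitReal`, the derivative attains its minimum `-1` over the shape at the contact
direction. -/
lemma apply_le_of_hitReal {m : ℝ≥0 × Shape d} {v : Grain d} {r : ℝ≥0} {x : Space d}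
    {L : Space d →L[ℝ] ℝ} (hL : HasFDerivAt (hitReal m v r) L x) (hc : 0 < hitReal m v r x)
    {k : Space d} (hk : k ∈ m.2.toSet) (h : x + hitReal m v r x • k ∈ v.grown r) : L k ≤ -1 := by
  have h1 : L (hitReal m v r x • k) ≤ -hitReal m v r x := hL.apply_le fun s _ hs1 => by
    have := hitReal_add_smul_le hc.le hk h hs1
    linarith
  rw [map_smul, smul_eq_mul] at h1
  nlinarith

lemma neg_one_le_apply_of_hitReal {m : ℝ≥0 × Shape d} {v : Grain d} {r : ℝ≥0} {x : Space d}
    {L : Space d →L[ℝ] ℝ} (hL : HasFDerivAt (hitReal m v r) L x)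
    {k : Space d} (hk : k ∈ m.2.toSet) : -1 ≤ L k := by
  have h1 : (-L) k ≤ 1 := hL.neg.apply_le fun s hs0 _ => by
    have := hitReal_le_add m v r x hk hs0.le
    simp only [Pi.neg_apply]
    linarith
  rw [neg_apply] at h1
  linarith

/-- Almost everywhere on the coincidence set both hitting times have the same derivative `L`. The
contact directions differ, as the targets are disjoint, and `L ≤ -1` at both. By strict convexity
their midpoint is interior to the shape; pushing it outwards gives a point of the shape with `L <
-1`, which is impossible. -/
lemma volume_hitReal_eq_hitReal (hd : 1 ≤ d) {m : ℝ≥0 × Shape d}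
    (hm : StrictConvex ℝ m.2.toSet) {v v' : Grain d} {r r' : ℝ≥0} (h : ¬ Touch v r v' r') :
    volume {x : Space d | hitReal m v r x = hitReal m v' r' x} = 0 := by
  have : NeZero d := ⟨by omega⟩
  have : Nontrivial (Space d) := inferInstance
  obtain ⟨C, hC⟩ := exists_lipschitzWith_hitReal m
  have h1 := ((hC v r).sub (hC v' r')).ae_hasFDerivAt_zero volume
  have h2 := (hC v r).ae_differentiableAt (μ := volume)
  have h3 := (hC v' r').ae_differentiableAt (μ := volume)
  have key : ∀ᵐ x ∂volume, ¬ hitReal m v r x = hitReal m v' r' x := by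
    filter_upwards [h1, h2, h3] with x h1 h2 h3 he
    obtain ⟨L, hL⟩ := h2
    have hL' : HasFDerivAt (hitReal m v' r') L x := by
      have := hL.sub (h1 (sub_eq_zero.2 he))
      rw [sub_zero] at this
      have e : hitReal m v' r' =
          hitReal m v r - fun x => hitReal m v r x - hitReal m v' r' x := by
        ext y
        simp
      rw [e]
      exact this
    obtain ⟨k, hk, hkv⟩ := exists_hitReal m v r x
    obtain ⟨k', hk', hkv'⟩ := exists_hitReal m v' r' x
    have hne : hitReal m v r x • k ≠ hitReal m v' r' x • k' := by
      intro e
      rw [← e] at hkv'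
      exact h ⟨_, hkv, hkv'⟩
    have hc : 0 < hitReal m v r x := by
      refine (hitReal_nonneg m v r x).lt_of_ne fun h0 => hne ?_
      rw [← he, ← h0, zero_smul, zero_smul]
    have hkk : k ≠ k' := fun e => hne (by rw [e, he])
    have l1 := apply_le_of_hitReal hL hc hk hkv
    have l2 := apply_le_of_hitReal hL' (he ▸ hc) hk' hkv'
    have hi := hm hk hk' hkk (show (0 : ℝ) < 1 / 2 by norm_num) (show (0 : ℝ) < 1 / 2 by norm_num)
      (by norm_num)
    set p := (1 / 2 : ℝ) • k + (1 / 2 : ℝ) • k' with hp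
    have lp : L p ≤ -1 := by
      rw [hp, map_add, map_smul, map_smul, smul_eq_mul, smul_eq_mul]; linarith
    have hlim : Filter.Tendsto (fun s : ℝ => s • p) (nhdsWithin 1 (Set.Ioi 1)) (nhds p) := by
      have h : Continuous fun s : ℝ => s • p := by fun_prop
      have h := (h.tendsto 1).mono_left (nhdsWithin_le_nhds (s := Set.Ioi 1))
      simpa using h
    obtain ⟨s, hs, hs1⟩ := ((hlim.eventually (isOpen_interior.mem_nhds hi)).and
      self_mem_nhdsWithin).exists
    have hs1 : 1 < s := hs1
    have l3 := neg_one_le_apply_of_hitReal hL (interior_subset hs)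
    rw [map_smul, smul_eq_mul] at l3
    nlinarith
  rw [ae_iff] at key
  simpa only [not_not] using key

end Grain

end

/-! ### Coincidences of hitting times -/

noncomputable section

open ProbabilityTheory

namespace Config

open Grain

variable {d : ℕ} {ψ : Config d}

/-- The configuration of the grains of a tuple with pairwise different positions. -/
def ofTuple {n : ℕ} (v : Fin n → Grain d) : Config d where
  carrier := {u | (Function.Injective fun i => (v i).pos) ∧ u ∈ Set.range v}
  locallyFinite _ _ := (Set.finite_range v).subset fun _ hu => hu.1.2
  pos_injOn := by
    rintro _ ⟨h, i, rfl⟩ _ ⟨-, j, rfl⟩ hij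
    rw [h hij]

lemma ofTuple_carrier {n : ℕ} {v : Fin n → Grain d} (h : Function.Injective fun i => (v i).pos) :
    (ofTuple v).carrier = Set.range v := Set.ext fun _ => and_iff_right h

lemma encard_range_inter {α : Type*} {n : ℕ} {v : Fin n → α} (h : Function.Injective v)
    (C : Set α) : ((Set.range v ∩ C).encard : ℝ≥0∞) = ∑ i, C.indicator 1 (v i) := by
  classical
  rw [Set.inter_comm, ← Set.image_preimage_eq_inter_range, h.encard_image,
    Set.encard_eq_coe_toFinset_card, ENat.toENNReal_coe, Finset.card_eq_sum_ones, Nat.cast_sum]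
  have e : (v ⁻¹' C).toFinset = Finset.univ.filter fun i => v i ∈ C := by ext; simp
  rw [e, Finset.sum_filter]
  refine Finset.sum_congr rfl fun i _ => ?_
  rw [Set.indicator_apply, Nat.cast_one, Pi.one_apply]

lemma measurable_ofTuple (n : ℕ) : Measurable (ofTuple (d := d) (n := n)) := by
  refine measurable_of_encard fun C hC => ?_
  have hpos : Measurable fun (v : Fin n → Grain d) (i : Fin n) => (v i).pos :=
    measurable_pi_iff.2 fun i => measurable_pos.comp (measurable_pi_apply i)
  have hinj : MeasurableSet {v : Fin n → Grain d | Function.Injective fun i => (v i).pos} :=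
    hpos (measurableSet_injective n)
  have hsum : Measurable fun v : Fin n → Grain d => ∑ i, C.indicator (1 : Grain d → ℝ≥0∞) (v i) :=
    Finset.measurable_sum _ fun i _ => (measurable_one.indicator hC).comp (measurable_pi_apply i)
  have e : (fun v : Fin n → Grain d => (((ofTuple v).carrier ∩ C).encard : ℝ≥0∞)) =
      {v : Fin n → Grain d | Function.Injective fun i => (v i).pos}.indicator
        fun v => ∑ i, C.indicator (1 : Grain d → ℝ≥0∞) (v i) := by
    ext v
    by_cases h : Function.Injective fun i => (v i).pos
    · rw [Set.indicator_of_mem (by exact h), ofTuple_carrier h,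
        encard_range_inter (fun i j hij => h (congrArg _ hij))]
    · rw [Set.indicator_of_notMem (by exact h)]
      have : (ofTuple v).carrier = ∅ := Set.eq_empty_of_forall_notMem fun u hu => h hu.1
      simp [this]
  rw [e]
  exact hsum.indicator hinj

/-- The first grain of the tuple hits the `i`-th other one at the time at which that one stops
growing in the model of the others. -/
def HitsTied {n : ℕ} (i : Fin n) (w : Grain d) (v : Fin n → Grain d) : Prop :=
  0 < hit w (v i) (gt (ofTuple v) (v i)) ∧
    w.birth + hit w (v i) (gt (ofTuple v) (v i)) = (v i).birth + gt (ofTuple v) (v i)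

/-- The first grain of the tuple hits two others, that do not touch in the model of the others, at
the same time. -/
def HitsTwo {n : ℕ} (i j : Fin n) (w : Grain d) (v : Fin n → Grain d) : Prop :=
  hit w (v i) (gt (ofTuple v) (v i)) = hit w (v j) (gt (ofTuple v) (v j)) ∧
    ¬ Touch (v i) (gt (ofTuple v) (v i)) (v j) (gt (ofTuple v) (v j))

lemma measurable_tail_apply {n : ℕ} :
    Measurable fun v : Fin (n + 1) → Grain d => (Fin.tail v : Fin n → Grain d) :=
  measurable_pi_iff.2 fun i => measurable_pi_apply i.succ

lemma measurable_gt_tail {n : ℕ} (i : Fin n) :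
    Measurable fun v : Fin (n + 1) → Grain d => gt (ofTuple (Fin.tail v)) (v i.succ) :=
  ((measurable_ofTuple n).comp measurable_tail_apply).gt (measurable_pi_apply i.succ)

lemma measurable_hit_tail {n : ℕ} (i : Fin n) : Measurable fun v : Fin (n + 1) → Grain d =>
    hit (v 0) (v i.succ) (gt (ofTuple (Fin.tail v)) (v i.succ)) :=
  Measurable.hit (measurable_pi_apply 0) (measurable_pi_apply i.succ) (measurable_gt_tail i)

lemma measurableSet_hitsTied {n : ℕ} (i : Fin n) :
    MeasurableSet {v : Fin (n + 1) → Grain d | HitsTied i (v 0) (Fin.tail v)} := by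
  have hb := measurable_birth (d := d)
  exact (measurableSet_lt measurable_const (measurable_hit_tail i)).inter
    (measurableSet_eq_fun ((hb.comp (measurable_pi_apply 0)).add (measurable_hit_tail i))
      ((hb.comp (measurable_pi_apply i.succ)).add (measurable_gt_tail i)))

lemma measurableSet_hitsTwo {n : ℕ} (i j : Fin n) :
    MeasurableSet {v : Fin (n + 1) → Grain d | HitsTwo i j (v 0) (Fin.tail v)} :=
  (measurableSet_eq_fun (measurable_hit_tail i) (measurable_hit_tail j)).inter
    (MeasurableSet.touch (measurable_pi_apply i.succ) (measurable_gt_tail i)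
      (measurable_pi_apply j.succ) (measurable_gt_tail j)).compl

/-- The growth times of the tuple's tail do not involve its first grain, so it is enough to
integrate over the position of that grain with everything else fixed. -/
lemma pi_eq_zero_of_slices (Q : Measure (ℝ≥0 × Shape d)) [IsProbabilityMeasure Q] {n : ℕ}
    {S : Set (Fin (n + 1) → Grain d)} (hS : MeasurableSet S)
    (h : ∀ᵐ m ∂Q, ∀ v : Fin n → Grain d,
      volume {x : Space d | (Fin.cons ((x, m) : Grain d) v : Fin (n + 1) → Grain d) ∈ S} = 0) :
    Measure.pi (fun _ : Fin (n + 1) => (volume : Measure (Space d)).prod Q) S = 0 := by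
  rw [pi_succ_apply_symm _ hS]
  have : ∀ v : Fin n → Grain d, (volume : Measure (Space d)).prod Q
      {w | (Fin.cons w v : Fin (n + 1) → Grain d) ∈ S} = 0 := by
    intro v
    have hm : Measurable fun w : Grain d => (Fin.cons w v : Fin (n + 1) → Grain d) :=
      measurable_finCons measurable_id measurable_const
    have hms : MeasurableSet {w : Grain d | (Fin.cons w v : Fin (n + 1) → Grain d) ∈ S} := hm hS
    rw [Measure.prod_apply_symm hms,
      lintegral_eq_zero_iff' (measurable_measure_prodMk_right hms).aemeasurable]
    filter_upwards [h] with m hm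
    exact hm v
  simp [this]

lemma pi_hitsTied (Q : Measure (ℝ≥0 × Shape d)) [IsProbabilityMeasure Q] {n : ℕ} (i : Fin n) :
    Measure.pi (fun _ : Fin (n + 1) => (volume : Measure (Space d)).prod Q)
      {v | HitsTied i (v 0) (Fin.tail v)} = 0 := by
  refine pi_eq_zero_of_slices Q (measurableSet_hitsTied i) (Filter.Eventually.of_forall fun m v => ?_)
  set c : ℝ := (v i).birth + gt (ofTuple v) (v i) - m.1 with hc
  have hsub : {x : Space d | (Fin.cons ((x, m) : Grain d) v : Fin (n + 1) → Grain d) ∈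
      {v : Fin (n + 1) → Grain d | HitsTied i (v 0) (Fin.tail v)}} ⊆
      {x | 0 < c ∧ hitReal m (v i) (gt (ofTuple v) (v i)) x = c} := by
    intro x hx
    have hx : HitsTied i ((x, m) : Grain d) v := hx
    obtain ⟨h1, h2⟩ := hx
    have h2' := congrArg (fun r : ℝ≥0 => (r : ℝ)) h2
    have h3 : hitReal m (v i) (gt (ofTuple v) (v i)) x = c := by
      rw [hc]
      simp only [NNReal.coe_add] at h2'
      exact eq_sub_of_add_eq' h2'
    exact ⟨h3 ▸ NNReal.coe_pos.2 h1, h3⟩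
  refine measure_mono_null hsub ?_
  by_cases h0 : 0 < c
  · simp only [h0, true_and]
    exact volume_hitReal_eq m (v i) _ h0
  · simp [h0]

lemma pi_hitsTwo (hd : 1 ≤ d) (Q : Measure (ℝ≥0 × Shape d)) [IsProbabilityMeasure Q]
    (hQ : ∀ᵐ m ∂Q, StrictConvex ℝ m.2.toSet) {n : ℕ} (i j : Fin n) :
    Measure.pi (fun _ : Fin (n + 1) => (volume : Measure (Space d)).prod Q)
      {v | HitsTwo i j (v 0) (Fin.tail v)} = 0 := by
  refine pi_eq_zero_of_slices Q (measurableSet_hitsTwo i j) ?_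
  filter_upwards [hQ] with m hm v
  by_cases ht : Touch (v i) (gt (ofTuple v) (v i)) (v j) (gt (ofTuple v) (v j))
  · refine measure_mono_null (t := ∅) (fun x hx => ?_) measure_empty
    have hx : HitsTwo i j ((x, m) : Grain d) v := hx
    exact hx.2 ht
  · refine measure_mono_null (fun x hx => ?_) (volume_hitReal_eq_hitReal hd hm ht)
    have hx : HitsTwo i j ((x, m) : Grain d) v := hx
    exact congrArg (fun r : ℝ≥0 => (r : ℝ)) hx.1

/-- There are no coincidences of hitting times. -/
structure NoCoincidence (ψ : Config d) : Prop where
  tied : ∀ (n : ℕ) (i : Fin n), ¬ HasTuple ψ {v : Fin (n + 1) → Grain d |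
    HitsTied i (v 0) (Fin.tail v)}
  two : ∀ (n : ℕ) (i j : Fin n), ¬ HasTuple ψ {v : Fin (n + 1) → Grain d |
    HitsTwo i j (v 0) (Fin.tail v)}

lemma ae_noCoincidence {Ω : Type*} [MeasurableSpace Ω] {P : Measure Ω} {Ψ : Ω → Config d}
    (hd : 1 ≤ d) {Q : Measure (ℝ≥0 × Shape d)} [IsProbabilityMeasure Q] {a : ℝ≥0}
    (h : MomentBound P Ψ a ((volume : Measure (Space d)).prod Q)) (hΨ : Measurable Ψ)
    (hQ : ∀ᵐ m ∂Q, StrictConvex ℝ m.2.toSet) : ∀ᵐ ω ∂P, NoCoincidence (Ψ ω) := by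
  have h1 : ∀ᵐ ω ∂P, ∀ (n : ℕ) (i : Fin n), ¬ HasTuple (Ψ ω) {v : Fin (n + 1) → Grain d |
      HitsTied i (v 0) (Fin.tail v)} := by
    rw [ae_all_iff]; intro n
    rw [ae_all_iff]; intro i
    exact h.ae_not_hasTuple hΨ (measurableSet_hitsTied i) (pi_hitsTied Q i)
  have h2 : ∀ᵐ ω ∂P, ∀ (n : ℕ) (i j : Fin n), ¬ HasTuple (Ψ ω) {v : Fin (n + 1) → Grain d |
      HitsTwo i j (v 0) (Fin.tail v)} := by
    rw [ae_all_iff]; intro n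
    rw [ae_all_iff]; intro i
    rw [ae_all_iff]; intro j
    exact h.ae_not_hasTuple hΨ (measurableSet_hitsTwo i j) (pi_hitsTwo hd Q hQ i j)
  filter_upwards [h1, h2] with ω h1 h2
  exact ⟨h1, h2⟩

/-- A finite set of grains in which every grain has an earlier neighbour can be listed in such a way
that the growth times are those of the model of the list. -/
lemma exists_tuple_of_closed (hd : 1 ≤ d) (hψ : Solvable ψ) {A : Set (Grain d)} (hA : A.Finite)
    (hAψ : A ⊆ ψ.carrier) (hcl : ∀ x ∈ A, ∃ y ∈ A, Early ψ x y) {w : Grain d}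
    (hw : w ∈ ψ.carrier) (hwA : w ∉ A) :
    ∃ (n : ℕ) (v : Fin n → Grain d), (∀ u ∈ A, ∃ i, v i = u ∧ gt (ofTuple v) (v i) = gt ψ u) ∧
      Function.Injective (Fin.cons w v : Fin (n + 1) → Grain d) ∧
      ∀ i, (Fin.cons w v : Fin (n + 1) → Grain d) i ∈ ψ.carrier := by
  have : Finite A := hA
  obtain ⟨n, ⟨e⟩⟩ := Finite.exists_equiv_fin A
  let v : Fin n → Grain d := fun i => (e.symm i).1
  have hv : Function.Injective v := Subtype.val_injective.comp e.symm.injective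
  have hrange : Set.range v = A := by
    rw [show v = Subtype.val ∘ e.symm from rfl, Set.range_comp, e.symm.range_eq_univ,
      Set.image_univ, Subtype.range_coe]
  have hpos : Function.Injective fun i => (v i).pos := fun i j hij =>
    hv (ψ.pos_injOn (hAψ (e.symm i).2) (hAψ (e.symm j).2) hij)
  have hcar : (ofTuple v).carrier = A := (ofTuple_carrier hpos).trans hrange
  refine ⟨n, v, fun u hu => ⟨e ⟨u, hu⟩, by simp [v], ?_⟩, ?_, ?_⟩
  · have e1 : v (e ⟨u, hu⟩) = u := by simp [v]
    rw [e1]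
    refine growth_eq_of_closed hd hψ ?_ ?_ ?_ ?_
    · rwa [hcar]
    · rwa [hcar]
    · rwa [hcar]
    · rwa [hcar]
  · rw [Fin.cons_injective_iff]
    exact ⟨hrange ▸ hwA, hv⟩
  · intro i
    refine Fin.cases ?_ (fun i => ?_) i
    · rwa [Fin.cons_zero]
    · rw [Fin.cons_succ]; exact hAψ (e.symm i).2

lemma NoCoincidence.not_tied (hd : 1 ≤ d) (hψ : Solvable ψ) (hn : NoCoincidence ψ)
    {A : Set (Grain d)} (hA : A.Finite) (hAψ : A ⊆ ψ.carrier)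
    (hcl : ∀ x ∈ A, ∃ y ∈ A, Early ψ x y) {w u : Grain d} (hw : w ∈ ψ.carrier) (hwA : w ∉ A)
    (hu : u ∈ A) (hwu : Early ψ u w) : w.birth + gt ψ w ≠ u.birth + gt ψ u := by
  intro he
  obtain ⟨n, v, hv, hinj, hmem⟩ := exists_tuple_of_closed hd hψ hA hAψ hcl hw hwA
  obtain ⟨i, hi, hgt⟩ := hv u hu
  refine hn.tied n i ⟨_, hinj, hmem, ?_⟩
  show HitsTied i w v
  have h1 := hit_eq_gt hd hψ hw (hAψ hu) hwu.1.symm hwu.2.1 hwu.2.2.2.2.symm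
  rw [HitsTied, hgt, hi, h1]
  exact ⟨hwu.2.2.1, he⟩

lemma NoCoincidence.generic (hd : 1 ≤ d) (hψ : Solvable ψ) (hn : NoCoincidence ψ) : Generic ψ where
  toSolvable := hψ
  tie_unique := by
    intro u hu v hv w hw huv huw he
    by_contra hvw
    rcases huw.2.2.2.1.lt_or_eq with hlt | heq
    -- The family of `w` together with `u` is closed under earlier neighbours and omits `v`, which
    -- stops later than `w`. So `v` hits `u` exactly when `u` stops in a model independent of `v`.
    · obtain ⟨A, hA, hAψ, hwA, hle, hcl⟩ := exists_finite_closed hd hψ hw huw.2.2.1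
      refine hn.not_tied hd hψ (A := insert u A) (hA.insert u) (Set.insert_subset hu hAψ) ?_ hv ?_
        (Set.mem_insert u A) huv he
      · rintro x (rfl | hx)
        · exact ⟨w, Or.inr hwA, huw⟩
        · obtain ⟨y, hy, hxy⟩ := hcl x hx
          exact ⟨y, Or.inr hy, hxy⟩
      · rintro (h | h)
        · exact huv.1 (congrArg _ h.symm)
        · exact absurd (hle v h) (not_le.2 (he ▸ hlt))
    -- If both neighbours are tied with `u`, then `u` and `v` already determine each other, and `w`
    -- is the grain that hits at the forbidden time.
    · refine hn.not_tied hd hψ (A := {u, v}) (Set.toFinite _) ?_ ?_ hw ?_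
        (Set.mem_insert u _) huw heq
      · rintro x (rfl | rfl)
        exacts [hu, hv]
      · rintro x (rfl | rfl)
        · exact ⟨v, Or.inr rfl, huv⟩
        · exact ⟨u, Or.inl rfl, huv.symm_of_eq he⟩
      · rintro (h | h)
        · exact huw.1 (congrArg _ h.symm)
        · exact hvw h.symm
  touch := by
    intro u hu v hv w hw huv huw hlv hlw
    by_contra hnt
    -- All grains in the two families stop strictly before `u`, so `u` is outside their union and
    -- hits two grains of an independent model simultaneously.
    obtain ⟨A, hA, hAψ, hvA, hle, hcl⟩ := exists_finite_closed hd hψ hv huv.2.2.1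
    obtain ⟨B, hB, hBψ, hwB, hle', hcl'⟩ := exists_finite_closed hd hψ hw huw.2.2.1
    obtain ⟨n, x, hx, hinj, hmem⟩ := exists_tuple_of_closed hd hψ (hA.union hB)
      (Set.union_subset hAψ hBψ) (by
        rintro x (hx | hx)
        · obtain ⟨y, hy, hxy⟩ := hcl x hx
          exact ⟨y, Or.inl hy, hxy⟩
        · obtain ⟨y, hy, hxy⟩ := hcl' x hx
          exact ⟨y, Or.inr hy, hxy⟩) hu (by
        rintro (h | h)
        · exact absurd (hle u h) (not_le.2 hlv)
        · exact absurd (hle' u h) (not_le.2 hlw))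
    obtain ⟨i, hi, hgi⟩ := hx v (Or.inl hvA)
    obtain ⟨j, hj, hgj⟩ := hx w (Or.inr hwB)
    refine hn.two n i j ⟨_, hinj, hmem, ?_⟩
    show HitsTwo i j u x
    rw [HitsTwo, hgi, hgj, hi, hj, hit_eq_gt hd hψ hu hv huv.1 huv.2.2.1 huv.2.2.2.2,
      hit_eq_gt hd hψ hu hw huw.1 huw.2.2.1 huw.2.2.2.2]
    exact ⟨rfl, hnt⟩

end Config

end

/-! ### Mass transport -/

noncomputable section

open ProbabilityTheory

namespace Grain

variable {d : ℕ}

/-- The index of the lattice cube that contains the position of a grain. -/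
def cell (u : Grain d) : Fin d → ℤ := fun i => ⌊u.pos i⌋

lemma measurable_cell : Measurable (cell (d := d)) := by
  refine measurable_pi_iff.2 fun i => Int.measurable_floor.comp ?_
  have h : Measurable fun x : Space d => x i := by fun_prop
  exact h.comp measurable_pos

lemma measurableSet_cell (z : Fin d → ℤ) : MeasurableSet {u : Grain d | cell u = z} :=
  measurable_cell (measurableSet_singleton z)

/-- A lattice vector. -/
def latticeVec (z : Fin d → ℤ) : Space d := WithLp.toLp 2 fun i => (z i : ℝ)

lemma cell_translate (y : Fin d → ℤ) (u : Grain d) :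
    cell (translate (latticeVec y) u) = y + cell u := by
  funext i
  show ⌊(y i : ℝ) + u.pos i⌋ = y i + ⌊u.pos i⌋
  exact Int.floor_intCast_add _ _

lemma volume_cell_lt_top (z : Fin d → ℤ) : volume {x : Space d | (fun i => ⌊x i⌋) = z} < ⊤ := by
  refine (Bornology.IsBounded.measure_lt_top ?_)
  rw [isBounded_iff_forall_norm_le]
  refine ⟨Real.sqrt (∑ i, (|(z i : ℝ)| + 1) ^ 2), fun x hx => ?_⟩
  rw [EuclideanSpace.norm_eq]
  refine Real.sqrt_le_sqrt (Finset.sum_le_sum fun i _ => ?_)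
  have hx : ⌊x i⌋ = z i := congrFun hx i
  have h1 := Int.floor_le (x i)
  have h2 := Int.lt_floor_add_one (x i)
  rw [hx] at h1 h2
  refine pow_le_pow_left₀ (norm_nonneg _) ?_ 2
  rw [Real.norm_eq_abs, abs_le]
  have h3 := neg_abs_le (z i : ℝ)
  have h4 := le_abs_self (z i : ℝ)
  constructor <;> linarith

end Grain

namespace Config

open Grain

variable {d : ℕ} {ψ : Config d}

lemma lintegral_points_translate (x : Space d) (ψ : Config d) (h : Grain d → ℝ≥0∞) :
    ∫⁻ u, h u ∂points (ψ.translate x) = ∫⁻ u, h (Grain.translate x u) ∂points ψ := by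
  rw [lintegral_points, lintegral_points]
  exact tsum_image h (translate_injective x).injOn

/-- The number of pairs of points of `ψ` that satisfy a relation. -/
def pairCount (S : Set ((Config d × Grain d) × Grain d)) (ψ : Config d) : ℝ≥0∞ :=
  ∫⁻ w, ∫⁻ ρ, S.indicator 1 ((ψ, w), ρ) ∂points ψ ∂points ψ

lemma measurable_indicator_section {S : Set ((Config d × Grain d) × Grain d)}
    (hS : MeasurableSet S) (ψ : Config d) (w : Grain d) :
    Measurable fun ρ => S.indicator (1 : (Config d × Grain d) × Grain d → ℝ≥0∞) ((ψ, w), ρ) :=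
  (measurable_one.indicator hS).comp measurable_prodMk_left

lemma measurable_inner {S : Set ((Config d × Grain d) × Grain d)} (hS : MeasurableSet S) :
    Measurable fun p : Config d × Grain d => ∫⁻ ρ, S.indicator 1 (p, ρ) ∂points p.1 :=
  measurable_fst.lintegral_points (h := fun p ρ => S.indicator 1 (p, ρ))
    (measurable_one.indicator hS)

lemma measurable_pairCount {S : Set ((Config d × Grain d) × Grain d)} (hS : MeasurableSet S) :
    Measurable (pairCount S) :=
  measurable_id.lintegral_points
    (h := fun ψ w => ∫⁻ ρ, S.indicator 1 ((ψ, w), ρ) ∂points ψ) (measurable_inner hS)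

lemma pairCount_iUnion {ι : Type*} [Countable ι] {S : ι → Set ((Config d × Grain d) × Grain d)}
    {T : Set ((Config d × Grain d) × Grain d)} (hS : ∀ i, MeasurableSet (S i))
    (f : (Config d × Grain d) × Grain d → ι) (hT : ∀ i q, q ∈ S i ↔ q ∈ T ∧ f q = i) :
    pairCount T ψ = ∑' i, pairCount (S i) ψ := by
  have hind : ∀ q, T.indicator (1 : (Config d × Grain d) × Grain d → ℝ≥0∞) q = ∑' i, (S i).indicator 1 q := by
    intro q
    rw [tsum_eq_single (f q) fun i hi => Set.indicator_of_notMem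
      (fun h => hi ((hT i q).1 h).2.symm) _]
    by_cases h : q ∈ T
    · rw [Set.indicator_of_mem h, Set.indicator_of_mem ((hT _ q).2 ⟨h, rfl⟩)]
    · rw [Set.indicator_of_notMem h, Set.indicator_of_notMem fun h' => h ((hT _ q).1 h').1]
  unfold pairCount
  have hm : ∀ i, Measurable fun w => ∫⁻ ρ, (S i).indicator 1 ((ψ, w), ρ) ∂points ψ := fun i =>
    (measurable_inner (hS i)).comp measurable_prodMk_left
  rw [← lintegral_tsum fun i => (hm i).aemeasurable]
  refine lintegral_congr fun w => ?_
  rw [← lintegral_tsum fun i => (measurable_indicator_section (hS i) ψ w).aemeasurable]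
  exact lintegral_congr fun ρ => hind _

/-- The pairs of a grain in one cube and one of its roots in another cube. -/
def flowSet (z z' : Fin d → ℤ) : Set ((Config d × Grain d) × Grain d) :=
  {q | cell q.1.2 = z ∧ cell q.2 = z' ∧ q.2 ∈ roots q.1.1 q.1.2}

/-- The pairs of a grain in a given cube and one of its roots. -/
def outSet (z : Fin d → ℤ) : Set ((Config d × Grain d) × Grain d) :=
  {q | cell q.1.2 = z ∧ q.2 ∈ roots q.1.1 q.1.2}

/-- The pairs of a grain and one of its roots in a given cube. -/
def inSet (z' : Fin d → ℤ) : Set ((Config d × Grain d) × Grain d) :=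
  {q | cell q.2 = z' ∧ q.2 ∈ roots q.1.1 q.1.2}

lemma measurableSet_inSet (z : Fin d → ℤ) : MeasurableSet (inSet z) :=
  (measurable_snd (measurableSet_cell z)).inter measurableSet_roots

lemma measurableSet_flowSet (z z' : Fin d → ℤ) : MeasurableSet (flowSet z z') :=
  ((measurable_snd.comp measurable_fst) (measurableSet_cell z)).inter (measurableSet_inSet z')

lemma pairCount_outSet (z : Fin d → ℤ) (ψ : Config d) :
    pairCount (outSet z) ψ = ∑' z', pairCount (flowSet z z') ψ :=
  pairCount_iUnion (fun z' => measurableSet_flowSet z z') (fun q => cell q.2) fun _ _ =>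
    ⟨fun h => ⟨⟨h.1, h.2.2⟩, h.2.1⟩, fun h => ⟨h.1.1, h.2, h.1.2⟩⟩

lemma pairCount_inSet (z' : Fin d → ℤ) (ψ : Config d) :
    pairCount (inSet z') ψ = ∑' z, pairCount (flowSet z z') ψ :=
  pairCount_iUnion (fun z => measurableSet_flowSet z z') (fun q => cell q.1.2) fun _ _ =>
    ⟨fun h => ⟨h.2, h.1⟩, fun h => ⟨h.2, h.1⟩⟩

lemma pairCount_flowSet_translate (y z z' : Fin d → ℤ) (ψ : Config d) :
    pairCount (flowSet (y + z) (y + z')) (ψ.translate (latticeVec y)) =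
      pairCount (flowSet z z') ψ := by
  unfold pairCount
  rw [lintegral_points_translate]
  refine lintegral_congr fun w => ?_
  rw [lintegral_points_translate]
  refine lintegral_congr fun ρ => ?_
  have h : ((ψ.translate (latticeVec y), Grain.translate (latticeVec y) w),
      Grain.translate (latticeVec y) ρ) ∈ flowSet (y + z) (y + z') ↔
      ((ψ, w), ρ) ∈ flowSet z z' := by
    refine and_congr ?_ (and_congr ?_ mem_roots_translate)
    · show cell (Grain.translate _ w) = _ ↔ _
      rw [cell_translate]; exact add_right_inj y
    · show cell (Grain.translate _ ρ) = _ ↔ _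
      rw [cell_translate]; exact add_right_inj y
  by_cases hq : ((ψ, w), ρ) ∈ flowSet z z'
  · rw [Set.indicator_of_mem hq, Set.indicator_of_mem (h.2 hq)]; rfl
  · rw [Set.indicator_of_notMem hq, Set.indicator_of_notMem (fun h' => hq (h.1 h'))]

variable {Ω : Type*} [MeasurableSpace Ω] {P : Measure Ω} {Ψ : Ω → Config d}

lemma lintegral_translate (hΨ : Measurable Ψ) (hstat : IsStationaryPointProcess P Ψ)
    {f : Config d → ℝ≥0∞} (hf : Measurable f) (x : Space d) :
    ∫⁻ ω, f ((Ψ ω).translate x) ∂P = ∫⁻ ω, f (Ψ ω) ∂P := by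
  have hm : Measurable fun ω => (Ψ ω).translate x := (measurable_translate x).comp hΨ
  have h : P.map (fun ω => (Ψ ω).translate x) = P.map Ψ := by
    ext A hA
    rw [Measure.map_apply hm hA, Measure.map_apply hΨ hA]
    exact hstat x A hA
  rw [← lintegral_map hf hm, h, lintegral_map hf hΨ]

/-- The mass transport principle on the lattice: the mean flow between two cells depends only on
their difference. -/
lemma lintegral_inSet_eq_outSet (hΨ : Measurable Ψ) (hstat : IsStationaryPointProcess P Ψ)
    (z' : Fin d → ℤ) :
    ∫⁻ ω, pairCount (inSet z') (Ψ ω) ∂P = ∫⁻ ω, pairCount (outSet z') (Ψ ω) ∂P := by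
  simp_rw [pairCount_inSet, pairCount_outSet]
  have hm : ∀ z z', AEMeasurable (fun ω => pairCount (flowSet z z') (Ψ ω)) P := fun z z' =>
    ((measurable_pairCount (measurableSet_flowSet z z')).comp hΨ).aemeasurable
  -- Source cells are reindexed by the reflection of `y` in `z'`; translation by `z' - y` then
  -- carries the flow from `z'` to `y` to the flow from the reflected cell to `z'`.
  rw [lintegral_tsum fun z => hm z z', lintegral_tsum fun y => hm z' y,
    ← (Equiv.subLeft (z' + z')).tsum_eq]
  refine tsum_congr fun y => ?_
  rw [← lintegral_translate hΨ hstat (measurable_pairCount (measurableSet_flowSet _ _))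
    (latticeVec (z' - y))]
  refine lintegral_congr fun ω => ?_
  have e1 : Equiv.subLeft (z' + z') y = (z' - y) + z' := by
    rw [Equiv.subLeft_apply]; abel
  have e2 : z' = (z' - y) + y := by abel
  rw [e1]
  nth_rewrite 3 [e2]
  exact pairCount_flowSet_translate _ _ _ _

/-- A grain with growth time `0` has no roots, because `Early` requires positive growth times; for
the others the bound is part of `roots_spec`. -/
lemma encard_roots_le (hd : 1 ≤ d) (hψ : Generic ψ) {w : Grain d} (hw : w ∈ ψ.carrier) :
    (roots ψ w).encard ≤ 2 := by
  by_cases h0 : 0 < gt ψ w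
  · exact (roots_spec hd hψ ⟨w, hw⟩ h0).2
  · have : roots ψ w = ∅ := by
      refine Set.eq_empty_of_forall_notMem fun ρ hρ => ?_
      rcases Relation.ReflTransGen.cases_head hρ.1 with rfl | ⟨v, ⟨_, h⟩, _⟩
      · obtain ⟨v, _, h, _⟩ := hρ.2
        exact h0 h.2.1
      · exact h0 h.2.1
    simp [this]

lemma pairCount_outSet_le (hd : 1 ≤ d) (hψ : Generic ψ) (z : Fin d → ℤ) :
    pairCount (outSet z) ψ ≤ 2 * points ψ {u | cell u = z} := by
  have hms := measurableSet_cell (d := d) z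
  rw [pairCount, lintegral_points, ← lintegral_indicator_one hms,
    ← lintegral_const_mul _ (measurable_one.indicator hms), lintegral_points]
  refine ENNReal.tsum_le_tsum fun w => ?_
  by_cases hw : cell w.1 = z
  · rw [Set.indicator_of_mem (by exact hw), Pi.one_apply, mul_one]
    have hr : MeasurableSet {ρ | ρ ∈ roots ψ w.1} :=
      (measurable_prodMk_left (x := (ψ, w.1))) measurableSet_roots
    calc _ ≤ ∫⁻ ρ, {ρ | ρ ∈ roots ψ w.1}.indicator 1 ρ ∂points ψ := by
          refine lintegral_mono fun ρ => ?_
          by_cases h : ρ ∈ roots ψ w.1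
          · rw [Set.indicator_of_mem (by exact ⟨hw, h⟩), Set.indicator_of_mem (by exact h)]; rfl
          · rw [Set.indicator_of_notMem (fun h' => h h'.2)]; exact zero_le
      _ = ((ψ.carrier ∩ roots ψ w.1).encard : ℝ≥0∞) := by
          rw [lintegral_indicator_one hr, points_apply hr]; rfl
      _ ≤ ((2 : ℕ∞) : ℝ≥0∞) := ENat.toENNReal_le.2
          ((Set.encard_le_encard Set.inter_subset_right).trans (encard_roots_le hd hψ w.2))
      _ = 2 := by simp
  · rw [lintegral_points]
    refine (ENNReal.tsum_eq_zero.2 fun ρ => ?_).trans_le zero_le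
    exact Set.indicator_of_notMem (fun h => hw h.1) _

lemma MomentBound.lintegral_points_le {a : ℝ≥0} {μ : Measure (Grain d)} [SigmaFinite μ]
    (h : MomentBound P Ψ a μ) {C : Set (Grain d)} (hC : MeasurableSet C) :
    ∫⁻ ω, points (Ψ ω) C ∂P ≤ a * μ C := by
  have h1 := h 1 le_rfl {v | v 0 ∈ C} ((measurable_pi_apply 0) hC)
  have e : {v : Fin 1 → Grain d | v 0 ∈ C} = Set.univ.pi fun _ => C := by
    ext v; simp
  rw [pow_one] at h1
  nth_rewrite 2 [e] at h1
  rw [Measure.pi_pi, Fin.prod_univ_one] at h1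
  refine (lintegral_mono fun ω => ?_).trans h1
  rw [points_apply hC]
  refine ENat.toENNReal_le.2 ?_
  refine Set.encard_le_encard_of_injOn (f := fun u (_ : Fin 1) => u) ?_
    fun u _ v _ huv => congrFun huv 0
  intro u hu
  exact ⟨Function.injective_of_subsingleton _, fun _ => hu.1, hu.2⟩

/-- Almost surely, every grain is the root of finitely many grains. -/
lemma ae_finite_roots (hd : 1 ≤ d) {Q : Measure (ℝ≥0 × Shape d)} [IsProbabilityMeasure Q] {a : ℝ≥0}
    (h : MomentBound P Ψ a ((volume : Measure (Space d)).prod Q)) (hΨ : Measurable Ψ)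
    (hstat : IsStationaryPointProcess P Ψ) (hgen : ∀ᵐ ω ∂P, Generic (Ψ ω)) :
    ∀ᵐ ω ∂P, ∀ ρ ∈ (Ψ ω).carrier, {w ∈ (Ψ ω).carrier | ρ ∈ roots (Ψ ω) w}.Finite := by
  have hfin : ∀ᵐ ω ∂P, ∀ z : Fin d → ℤ, pairCount (inSet z) (Ψ ω) < ⊤ := by
    rw [ae_all_iff]
    intro z
    refine ae_lt_top ((measurable_pairCount (measurableSet_inSet z)).comp hΨ) (ne_of_lt ?_)
    rw [lintegral_inSet_eq_outSet hΨ hstat]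
    have hvol : (volume : Measure (Space d)).prod Q {u : Grain d | cell u = z} < ⊤ := by
      have e : {u : Grain d | cell u = z} =
          {x : Space d | (fun i => ⌊x i⌋) = z} ×ˢ (Set.univ : Set (ℝ≥0 × Shape d)) := by
        ext u
        simp only [Set.mem_prod, Set.mem_univ, and_true]
        rfl
      rw [e, Measure.prod_prod, measure_univ, mul_one]
      exact volume_cell_lt_top z
    have hm : Measurable fun ω => points (Ψ ω) {u | cell u = z} :=
      (Measure.measurable_coe (measurableSet_cell z)).comp (measurable_points.comp hΨ)
    calc ∫⁻ ω, pairCount (outSet z) (Ψ ω) ∂P ≤ ∫⁻ ω, 2 * points (Ψ ω) {u | cell u = z} ∂P := by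
          refine lintegral_mono_ae ?_
          filter_upwards [hgen] with ω hω
          exact pairCount_outSet_le hd hω z
      _ = 2 * ∫⁻ ω, points (Ψ ω) {u | cell u = z} ∂P := lintegral_const_mul _ hm
      _ < ⊤ := ENNReal.mul_lt_top (by simp) ((h.lintegral_points_le (measurableSet_cell z)).trans_lt
          (ENNReal.mul_lt_top ENNReal.coe_lt_top hvol))
  filter_upwards [hfin] with ω hω ρ hρ
  have hr : MeasurableSet {w | ρ ∈ roots (Ψ ω) w} := by
    have hm : Measurable fun w : Grain d => ((Ψ ω, w), ρ) := by fun_prop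
    exact hm measurableSet_roots
  have h1 : points (Ψ ω) {w | ρ ∈ roots (Ψ ω) w} ≤ pairCount (inSet (cell ρ)) (Ψ ω) := by
    rw [← lintegral_indicator_one hr, pairCount]
    refine lintegral_mono fun w => ?_
    by_cases hw : ρ ∈ roots (Ψ ω) w
    · rw [Set.indicator_of_mem (by exact hw), lintegral_points]
      refine le_trans ?_ (ENNReal.le_tsum ⟨ρ, hρ⟩)
      rw [Set.indicator_of_mem (by exact ⟨rfl, hw⟩)]; rfl
    · rw [Set.indicator_of_notMem (by exact hw)]; exact zero_le
  have h2 := h1.trans_lt (hω (cell ρ))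
  rw [points_apply hr] at h2
  rw [← Set.encard_lt_top_iff]
  exact ENat.toENNReal_lt_top.1 h2

end Config

end

theorem theorem3p1 {Ω : Type*} [MeasurableSpace Ω] (P : Measure Ω) [IsProbabilityMeasure P]
    (d : ℕ) (hd : 1 ≤ d)
    (Ψ : Ω → Config d) (hΨ : Measurable Ψ)
    (Q : Measure (ℝ≥0 × Shape d)) [IsProbabilityMeasure Q]
    (a : ℝ≥0) (ha : 0 < a)
    (hfac : ∀ k : ℕ, 1 ≤ k → ∀ C : Set (Fin k → Grain d), MeasurableSet C →
      factorialMoment P Ψ k C ≤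
        (a : ℝ≥0∞) ^ k * Measure.pi (fun _ : Fin k => (volume : Measure (Space d)).prod Q) C)
    (hmom : ∫⁻ m, ENNReal.ofReal
      (((m.1 : ℝ) ^ (2 * d) + 1) * (m.2.circumradius ^ (2 * d) + 1)) ∂Q < ⊤)
    (hstrict : ∀ᵐ m ∂Q, StrictConvex ℝ m.2.toSet)
    (hstat : IsStationaryPointProcess P Ψ)
    (hne : ∀ᵐ ω ∂P, (Ψ ω).carrier.Nonempty) :
    ∀ᵐ ω ∂P,
      (∃! R : (Ψ ω).carrier → ℝ≥0, Config.IsGrowthMaximal R) ∧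
      ∀ R : (Ψ ω).carrier → ℝ≥0, Config.IsGrowthMaximal R →
        (∀ c : Config.Cluster R, c.supp.Finite) ∧ ¬ Config.Percolates R := by
  have hb : Config.MomentBound P Ψ a ((volume : Measure (Space d)).prod Q) := hfac
  have hQ := lintegral_weight_sq_lt_top hmom
  have hsolv : ∀ᵐ ω ∂P, Config.Solvable (Ψ ω) := by
    filter_upwards [Config.ae_sparse hb hΨ hQ, Config.ae_spread hd hΨ hstat hne] with ω h1 h2
    exact ⟨h1.regular hQ, h2.outgrown⟩
  have hgen : ∀ᵐ ω ∂P, Config.Generic (Ψ ω) := by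
    filter_upwards [hsolv, Config.ae_noCoincidence hd hb hΨ hstrict] with ω h1 h2
    exact h2.generic hd h1
  filter_upwards [hgen, Config.ae_finite_roots hd hb hΨ hstat hgen] with ω hω hroots
  refine ⟨hω.existsUnique hd hω.outgrown, fun R hR => ?_⟩
  have hcl : ∀ c : Config.Cluster R, c.supp.Finite := Config.cluster_finite hd hω hroots hR
  exact ⟨hcl, Config.not_percolates hR hcl⟩
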